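/- **Setting.** Let $T\ge 1$, $m\ge 0$, $N\ge 0$ be integers, let $\omega\in\mathbb C^\times$ be a primitive $T$-th root of unity, $\mathbb Z_T=\mathbb Z/T\mathbb Z$, and let $z_1,\dots,z_N\in\mathbb C^\times$ be such that $z_i\ne\omega^k z_j$ for all $i\neq j$ and all $k$. Let $\mathcal C_{0,N;m}$ be the arrangement in $\mathbb C^m$ of the hyperplanes $t_i=\omega^k t_j$ ($1\le i<j\le m$, $k\in\mathbb Z_T$), $t_i=\omega^k z_j$ ($1\le i\le m$, $1\le j\le N$, $k\in\mathbb Z_T$) and $t_i=0$ ($1\le i\le m$). *Flags.* An edge of $\mathcal C_{0,N;m}$ is a non-empty intersection of some of its hyperplanes (including $\mathbb C^m$). Let $\mathscr F^k=\mathscr F^k(\mathcal C_{0,N;m})$ be the complex vector space spanned by the flags $\mathbb C^m=L^0\supset L^1\supset\dots\supset L^k$ of edges with $\operatorname{codim}L^j=j$, modulo the relations, one for each flag with a gap at one position $0<i<k$, saying that the sum of all flags completing it is zero. The differential $d:\mathscr F^k\to\mathscr F^{k+1}$ sends $(L^0\supset\dots\supset L^k)$ to the sum of $(L^0\supset\dots\supset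 L^k\supset L^{k+1})$ over all edges $L^{k+1}\subset L^k$ of codimension $k+1$. *Chains.* Let $\mathfrak a$ be the free complex Lie algebra on generators $f_i^{(k)}$ ($1\le i\le m$, $k\in\mathbb Z_T$), let $\tau$ be its automorphism $f_i^{(k)}\mapsto f_i^{(k+1)}$, let $\bar{\mathfrak n}=\mathfrak a^\tau$ be the Lie subalgebra of $\tau$-fixed elements, and put $\bar g=\sum_{j\in\mathbb Z_T}\tau^j g\in\bar{\mathfrak n}$ for $g\in\mathfrak a$. Write $f_i=f_i^{(0)}$. Let $\mathcal M_{0,N}=U(\bar{\mathfrak n})\otimes U(\mathfrak a)^{\otimes N}$, on which $x\in\bar{\mathfrak n}$ acts as the sum over the $N+1$ tensor factors of left multiplication by $x$ in that factor. Let $d:\bigwedge^p\bar{\mathfrak n}\otimes\mathcal M_{0,N}\to\bigwedge^{p-1}\bar{\mathfrak n}\otimes\mathcal M_{0,N}$ be $$d(u_p\wedge\dots\wedge u_1\otimes x)=\sum_{i}(-1)^{i-1}u_p\wedge\dots\widehat{u_i}\dots\wedge u_1\otimes u_i x+\sum_{i<j}(-1)^{i+j}u_p\wedge\dots\widehat{u_j}\dots\widehat{u_i}\dots\wedge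 u_1\wedge[u_j,u_i]\otimes x .$$ A commutator is a generator $f_i^{(k)}$ or a bracket of two commutators. A monomial is an element $\bar g_p\wedge\dots\wedge\bar g_1\otimes x_0\otimes x_1\otimes\dots\otimes x_N$ where all $g_i$ are commutators, $x_0$ is a product of elements $\bar g$ with $g$ a commutator, and each $x_j$ ($j\ge1$) is a product of commutators. Let $(\bigwedge^p\bar{\mathfrak n}\otimes\mathcal M_{0,N})_{[1^m]}$ be the span of the monomials in which, for every $i=1,\dots,m$, exactly one of the commutators involved contains a generator $f_i^{(k)}$, and contains exactly one such generator, once; it is preserved by $d$. For a commutator $g$ in which the generators $f_{i_1}^{(k_1)},\dots,f_{i_l}^{(k_l)}$ occur, let $L_g$, $L_g^j$ ($1\le j\le N$), $L_g^0$ be the subspaces of $\mathbb C^m$ defined by $\omega^{k_1}t_{i_1}=\dots=\omega^{k_l}t_{i_l}$, by $\omega^{k_1}t_{i_1}=\dots=\omega^{k_l}t_{i_l}=z_j$, and by $t_{i_1}=\dots=t_{i_l}=0$, respectively. **Theorem.** There is a unique family of linear maps $$\psi_p:\Big(\textstyle\bigwedge^p\bar{\mathfrak n}\otimes\mathcal M_{0,N}\Big)_{[1^m]}\to\mathscr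 F^{m-p}(\mathcal C_{0,N;m}),\qquad 0\le p\le m,$$ such that $\psi_m(\bar f_1\wedge\dots\wedge\bar f_m\otimes1\otimes\dots\otimes1)$ is the trivial flag $(\mathbb C^m)$, such that $\psi_p$ sends every monomial to $\pm1$ times a flag, and such that the following rules hold. Let $0\le p<m$, let $x=\bar g_{p+1}\wedge\dots\wedge\bar g_1\otimes x_0\otimes\dots\otimes x_N$ be a monomial of multidegree $[1^m]$, and suppose $\psi_{p+1}(x)=\varepsilon F$ with $\varepsilon\in\{1,-1\}$ and a flag $F=(L^0\supset\dots\supset L^{m-p-1})$. Then, with $L=L^{m-p-1}$, * (A) $\psi_p(\bar g_{p+1}\wedge\dots\wedge\bar g_2\otimes x_0\otimes\dots\otimes g_1x_j\otimes\dots\otimes x_N)=\varepsilon\,(F\supset L\cap L_{g_1}^j)$ for $1\le j\le N$; * (B) $\psi_p(\bar g_{p+1}\wedge\dots\wedge\bar g_2\otimes\bar g_1x_0\otimes x_1\otimes\dots\otimes x_N)=\varepsilon\,(F\supset L\cap L_{g_1}^0)$; * (C) if $p\ge1$, $\psi_p(\bar g_{p+1}\wedge\dots\wedge\bar g_3\wedge\overline{[g_1,g_2]}\otimes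 x_0\otimes\dots\otimes x_N)=\varepsilon\,(F\supset L\cap L_{[g_1,g_2]})$, where in each case the right-hand side is indeed a flag of edges of $\mathcal C_{0,N;m}$. Every $\psi_p$ is a linear isomorphism. Moreover $d^2=0$ on both sides, $(\bigwedge^p\bar{\mathfrak n}\otimes\mathcal M_{0,N})_{[1^m]}=0$ for $p>m$, and $d\circ\psi_{p+1}=\psi_p\circ d$ for $0\le p<m$, so that $\psi_\bullet$ is an isomorphism of complexes $$\big((\textstyle\bigwedge^\bullet\bar{\mathfrak n}\otimes\mathcal M_{0,N})_{[1^m]},d\big)\to\big(\mathscr F^{m-\bullet}(\mathcal C_{0,N;m}),d\big).$$ -/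

import Mathlib

open scoped TensorProduct

namespace CycloArr

noncomputable section

/-! ### Hyperplane arrangements, flags, flag complex -/

section Arrangements

variable {V : Type*} [AddCommGroup V] [Module ℂ V]

/-- An edge of the arrangement `𝒜`: a non-empty intersection of some of its hyperplanes
(the empty intersection, i.e. the whole space, is the edge of codimension `0`). -/
def IsEdge (𝒜 : Set (AffineSubspace ℂ V)) (L : AffineSubspace ℂ V) : Prop :=
  (L : Set V).Nonempty ∧ ∃ S ⊆ 𝒜, L = sInf S

/-- `Flag 𝒜 k` is the set of flags `V = L⁰ ⊃ L¹ ⊃ ⋯ ⊃ Lᵏ` with `Lʲ` an edge of codimension `j`. -/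
@[ext]
structure Flag (𝒜 : Set (AffineSubspace ℂ V)) (k : ℕ) where
  edge : Fin (k + 1) → AffineSubspace ℂ V
  isEdge : ∀ j, IsEdge 𝒜 (edge j)
  codim : ∀ j, Module.finrank ℂ (edge j).direction + (j : ℕ) = Module.finrank ℂ V
  anti : ∀ j : Fin k, edge j.succ ≤ edge j.castSucc

variable {𝒜 : Set (AffineSubspace ℂ V)} {k : ℕ}

/-- The smallest edge of a flag. -/
def Flag.last (F : Flag 𝒜 k) : AffineSubspace ℂ V := F.edge (Fin.last k)

/-- The flag with its smallest edge removed. -/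
def Flag.init (F : Flag 𝒜 (k + 1)) : Flag 𝒜 k where
  edge j := F.edge j.castSucc
  isEdge _ := F.isEdge _
  codim j := F.codim j.castSucc
  anti j := F.anti j.castSucc

variable (𝒜) in
/-- The flag consisting of the whole space only. -/
def trivialFlag : Flag 𝒜 0 where
  edge _ := ⊤
  isEdge _ := ⟨⟨0, AffineSubspace.mem_top ℂ V 0⟩, ∅, Set.empty_subset _, sInf_empty.symm⟩
  codim j := by
    have : (j : ℕ) = 0 := Nat.lt_one_iff.1 j.2
    rw [this, AffineSubspace.direction_top, finrank_top, add_zero]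
  anti j := j.elim0

instance finite_flag [Finite 𝒜] : Finite (Flag 𝒜 k) := by
  have hfin : {L | IsEdge 𝒜 L}.Finite := by
    refine ((Set.toFinite 𝒜).finite_subsets.image sInf).subset ?_
    rintro L ⟨-, S, hS, rfl⟩
    exact ⟨S, hS, rfl⟩
  have : Finite {L | IsEdge 𝒜 L} := hfin
  refine Finite.of_injective
    (fun F : Flag 𝒜 k => fun j => (⟨F.edge j, F.isEdge j⟩ : {L | IsEdge 𝒜 L})) ?_
  intro F G h
  ext1
  funext j
  exact congrArg Subtype.val (congrFun h j)

instance fintypeFlag [Finite 𝒜] : Fintype (Flag 𝒜 k) := Fintype.ofFinite _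

open scoped Classical in
/-- The sum of all flags which agree with `F` except possibly at the edge number `i`, i.e. of all
completions of the flag with a gap obtained from `F` by deleting its edge number `i`. -/
def gapSum [Finite 𝒜] (F : Flag 𝒜 k) (i : Fin (k + 1)) : Flag 𝒜 k →₀ ℂ :=
  ∑ G : Flag 𝒜 k with ∀ j, j ≠ i → G.edge j = F.edge j, Finsupp.single G 1

variable (𝒜 k) in
/-- The span of the flag relations: one relation for every flag with a gap at `0 < i < k`. (A flag
with a gap which has no completion at all would only give the relation `0 = 0`.) -/
def flagRelations [Finite 𝒜] : Submodule ℂ (Flag 𝒜 k →₀ ℂ) :=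
  Submodule.span ℂ
    {r | ∃ (F : Flag 𝒜 k) (i : Fin (k + 1)), 0 < (i : ℕ) ∧ (i : ℕ) < k ∧ r = gapSum F i}

variable (𝒜 k) in
/-- The flag space `ℱᵏ(𝒜)` with complex coefficients. -/
abbrev FlagSpace [Finite 𝒜] : Type _ := (Flag 𝒜 k →₀ ℂ) ⧸ flagRelations 𝒜 k

/-- The class of a flag in the flag space. -/
def flagClass [Finite 𝒜] (F : Flag 𝒜 k) : FlagSpace 𝒜 k :=
  Submodule.Quotient.mk (Finsupp.single F 1)

open scoped Classical in
variable (𝒜 k) in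
/-- Extension of flags in all possible ways, before passing to the quotients. -/
def flagDRaw [Finite 𝒜] : (Flag 𝒜 k →₀ ℂ) →ₗ[ℂ] (Flag 𝒜 (k + 1) →₀ ℂ) :=
  Finsupp.linearCombination ℂ
    (fun F : Flag 𝒜 k => ∑ G : Flag 𝒜 (k + 1) with G.init = F, Finsupp.single G (1 : ℂ))

open scoped Classical in
theorem flagDRaw_mem [Finite 𝒜] :
    flagRelations 𝒜 k ≤ (flagRelations 𝒜 (k + 1)).comap (flagDRaw 𝒜 k) := by
  unfold flagRelations
  rw [Submodule.span_le]
  rintro _ ⟨F, i, hi0, hik, rfl⟩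
  change flagDRaw 𝒜 k (gapSum F i) ∈ flagRelations 𝒜 (k + 1)
  have h1 : flagDRaw 𝒜 k (gapSum F i) =
      ∑ G : Flag 𝒜 (k + 1) with ∀ j, j ≠ i → G.init.edge j = F.edge j,
        Finsupp.single G (1 : ℂ) := by
    simp only [gapSum, flagDRaw, map_sum, Finsupp.linearCombination_single, one_smul]
    rw [← Finset.sum_fiberwise_of_maps_to
      (s := Finset.univ.filter fun G : Flag 𝒜 (k + 1) =>
        ∀ j, j ≠ i → G.init.edge j = F.edge j)
      (t := Finset.univ.filter fun G : Flag 𝒜 k => ∀ j, j ≠ i → G.edge j = F.edge j)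
      (g := Flag.init) (by intro G hG; simpa using hG)]
    refine Finset.sum_congr rfl fun F' hF' => Finset.sum_congr ?_ fun _ _ => rfl
    ext G
    simp only [Finset.mem_filter, Finset.mem_univ, true_and] at hF' ⊢
    constructor
    · rintro rfl
      exact ⟨hF', rfl⟩
    · exact fun h => h.2
  rw [h1, ← Finset.sum_fiberwise_of_maps_to
      (t := (Finset.univ.filter fun G : Flag 𝒜 (k + 1) =>
        ∀ j, j ≠ i → G.init.edge j = F.edge j).image Flag.last)
      (g := Flag.last) (fun G hG => Finset.mem_image_of_mem _ hG)]
  refine Submodule.sum_mem _ fun L hL => ?_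
  obtain ⟨G₀, hG₀, rfl⟩ := Finset.mem_image.1 hL
  simp only [Finset.mem_filter, Finset.mem_univ, true_and] at hG₀
  refine Submodule.subset_span ⟨G₀, i.castSucc, hi0, by simp only [Fin.val_castSucc]; omega, ?_⟩
  unfold gapSum
  refine Finset.sum_congr ?_ fun _ _ => rfl
  ext G
  simp only [Finset.mem_filter, Finset.mem_univ, true_and]
  constructor
  · rintro ⟨h, hl⟩ j hj
    induction j using Fin.lastCases with
    | last => exact hl
    | cast j =>
      have hj' : j ≠ i := fun e => hj (by rw [e])
      exact (h j hj').trans (hG₀ j hj').symm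
  · intro h
    refine ⟨fun j hj => ?_, h _ ?_⟩
    · exact (h j.castSucc (fun e => hj (Fin.castSucc_injective _ e))).trans (hG₀ j hj)
    · intro e
      have := congrArg Fin.val e
      simp only [Fin.val_last, Fin.val_castSucc] at this
      omega

variable (𝒜 k) in
/-- The differential of the flag complex, `d (L⁰ ⊃ ⋯ ⊃ Lᵏ) = ∑ (L⁰ ⊃ ⋯ ⊃ Lᵏ ⊃ Lᵏ⁺¹)`. -/
def flagD [Finite 𝒜] : FlagSpace 𝒜 k →ₗ[ℂ] FlagSpace 𝒜 (k + 1) :=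
  Submodule.mapQ _ _ (flagDRaw 𝒜 k) flagDRaw_mem

open scoped Classical in
theorem flagD_flagClass [Finite 𝒜] (F : Flag 𝒜 k) :
    flagD 𝒜 k (flagClass F) = ∑ G : Flag 𝒜 (k + 1) with G.init = F, flagClass G := by
  simp only [flagD, flagClass, flagDRaw, Submodule.mapQ_apply,
    Finsupp.linearCombination_single, one_smul]
  exact map_sum (Submodule.mkQ (flagRelations 𝒜 (k + 1))) _ _

end Arrangements

/-! ### The cyclotomic discriminantal arrangement -/

section Arrangement

variable {T m N : ℕ}

/-- The hyperplane `t_i - ωᵏ t_j = 0`. -/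
def hypDiag (ω : ℂ) (i j : Fin m) (k : ZMod T) : AffineSubspace ℂ (Fin m → ℂ) where
  carrier := {t | t i = ω ^ k.val * t j}
  smul_vsub_vadd_mem' c p q r hp hq hr := by
    simp only [Set.mem_ofPred_eq, vsub_eq_sub, vadd_eq_add, Pi.add_apply, Pi.smul_apply,
      Pi.sub_apply, smul_eq_mul] at *
    rw [hp, hq, hr]; ring

/-- The hyperplane `t_i - c = 0`. -/
def hypPoint (c : ℂ) (i : Fin m) : AffineSubspace ℂ (Fin m → ℂ) where
  carrier := {t | t i = c}
  smul_vsub_vadd_mem' a p q r hp hq hr := by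
    simp only [Set.mem_ofPred_eq, vsub_eq_sub, vadd_eq_add, Pi.add_apply, Pi.smul_apply,
      Pi.sub_apply, smul_eq_mul] at *
    rw [hp, hq, hr]; ring

/-- The cyclotomic discriminantal arrangement `𝒞_{0,N;m}`. -/
def cda (T m : ℕ) {N : ℕ} (ω : ℂ) (z : Fin N → ℂ) : Set (AffineSubspace ℂ (Fin m → ℂ)) :=
  {H | ∃ (i j : Fin m) (k : ZMod T), i < j ∧ H = hypDiag ω i j k} ∪
  {H | ∃ (i : Fin m) (j : Fin N) (k : ZMod T), H = hypPoint (ω ^ k.val * z j) i} ∪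
  {H | ∃ i : Fin m, H = hypPoint 0 i}

instance finite_cda [NeZero T] (ω : ℂ) (z : Fin N → ℂ) :
    Finite (cda T m ω z) := by
  refine Set.Finite.to_subtype (Set.Finite.union (Set.Finite.union ?_ ?_) ?_)
  · refine (Set.finite_range
      (fun a : Fin m × Fin m × ZMod T => hypDiag ω a.1 a.2.1 a.2.2)).subset ?_
    rintro _ ⟨i, j, k, -, rfl⟩
    exact ⟨(i, j, k), rfl⟩
  · refine (Set.finite_range
      (fun a : Fin m × Fin N × ZMod T =>
        (hypPoint (ω ^ a.2.2.val * z a.2.1) a.1 : AffineSubspace ℂ (Fin m → ℂ)))).subset ?_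
    rintro _ ⟨i, j, k, rfl⟩
    exact ⟨(i, j, k), rfl⟩
  · refine (Set.finite_range (fun i : Fin m => hypPoint 0 i)).subset ?_
    rintro _ ⟨i, rfl⟩
    exact ⟨i, rfl⟩

end Arrangement

/-! ### Chevalley–Eilenberg chain complex of a Lie algebra with coefficients in a module -/

section ChevalleyEilenberg

open AlternatingMap

variable {L M : Type*} [LieRing L] [LieAlgebra ℂ L] [AddCommGroup M] [Module ℂ M]

variable (L M) in
/-- The space of `p`-chains `⋀ᵖ L ⊗ M`. -/
abbrev Chains (p : ℕ) : Type _ := (⋀[ℂ]^p L) ⊗[ℂ] M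

/-- The usual additive group structure on chains, with an additive monoid which Lean recognizes
without unfolding. -/
instance addCommGroupChains (n : ℕ) : AddCommGroup (Chains L M n) :=
  { (TensorProduct.addCommMonoid : AddCommMonoid ((⋀[ℂ]^n L) ⊗[ℂ] M)),
    (TensorProduct.addCommGroup : AddCommGroup ((⋀[ℂ]^n L) ⊗[ℂ] M)) with }

variable (L M) in
/-- For `y : L`, the alternating map `(v₀, …, vₙ₋₁) ↦ (x ↦ v₀ ∧ ⋯ ∧ vₙ₋₁ ∧ y ⊗ x)`. -/
def ceSnoc (n : ℕ) :
    L →ₗ[ℂ] L [⋀^Fin n]→ₗ[ℂ] (M →ₗ[ℂ] Chains L M (n + 1)) where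
  toFun y := ((TensorProduct.mk ℂ (⋀[ℂ]^(n + 1) L) M)).compAlternatingMap
    { ((LinearMap.applyₗ y).compMultilinearMap
        (exteriorPower.ιMulti ℂ (n + 1) (M := L)).toMultilinearMap.curryRight) with
      map_eq_zero_of_eq' := by
        intro v i j hv hij
        have := (exteriorPower.ιMulti ℂ (n + 1) (M := L)).map_eq_zero_of_eq
          (Fin.snoc (α := fun _ => L) v y) (i := i.castSucc) (j := j.castSucc) (by simpa using hv)
          (fun e => hij (Fin.castSucc_injective _ e))
        exact this }
  map_add' g h := by
    ext v x
    change ((exteriorPower.ιMulti ℂ (n + 1) (M := L)).toMultilinearMap.curryRight v (g + h)) ⊗ₜ[ℂ] x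
      = ((exteriorPower.ιMulti ℂ (n + 1) (M := L)).toMultilinearMap.curryRight v g) ⊗ₜ[ℂ] x
      + ((exteriorPower.ιMulti ℂ (n + 1) (M := L)).toMultilinearMap.curryRight v h) ⊗ₜ[ℂ] x
    rw [map_add, TensorProduct.add_tmul]
  map_smul' c g := by
    ext v x
    change ((exteriorPower.ιMulti ℂ (n + 1) (M := L)).toMultilinearMap.curryRight v (c • g)) ⊗ₜ[ℂ] x
      = c • (((exteriorPower.ιMulti ℂ (n + 1) (M := L)).toMultilinearMap.curryRight v g) ⊗ₜ[ℂ] x)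
    rw [map_smul, TensorProduct.smul_tmul']

theorem ceSnoc_apply (n : ℕ) (y : L) (v : Fin n → L) (x : M) :
    ceSnoc L M n y v x =
      exteriorPower.ιMulti ℂ (n + 1) (Fin.snoc (α := fun _ => L) v y) ⊗ₜ[ℂ] x := rfl

theorem ceSnoc_sum {ι : Type*} (s : Finset ι) (n : ℕ) (y : ι → L) (v : Fin n → L) (x : M) :
    ceSnoc L M n (∑ i ∈ s, y i) v x = ∑ i ∈ s, ceSnoc L M n (y i) v x := by
  classical
  induction s using Finset.induction_on with
  | empty => simp
  | insert a s ha ih =>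
    rw [Finset.sum_insert ha, Finset.sum_insert ha, map_add, AlternatingMap.add_apply,
      LinearMap.add_apply, ih]

variable (L M) in
/-- The bilinear map sending `(g, h)` to `(v₀, …, vₙ₋₁) ↦ (x ↦ v₀ ∧ ⋯ ∧ vₙ₋₁ ∧ [g, h] ⊗ x)`. -/
def ceBracket (n : ℕ) :
    L →ₗ[ℂ] L →ₗ[ℂ] L [⋀^Fin n]→ₗ[ℂ] (M →ₗ[ℂ] Chains L M (n + 1)) :=
  LinearMap.mk₂ ℂ (fun g h => ceSnoc L M n ⁅g, h⁆)
    (fun _ _ _ => by rw [add_lie, map_add]) (fun _ _ _ => by rw [smul_lie, map_smul])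
    (fun _ _ _ => by rw [lie_add, map_add]) (fun _ _ _ => by rw [lie_smul, map_smul])

variable [LieRingModule L M] [LieModule ℂ L M]

variable (L M) in
/-- For `g : L`, the alternating map `(v₀, …, vₙ₋₁) ↦ (x ↦ v₀ ∧ ⋯ ∧ vₙ₋₁ ⊗ g · x)`. -/
def ceAct (n : ℕ) : L →ₗ[ℂ] L [⋀^Fin n]→ₗ[ℂ] (M →ₗ[ℂ] Chains L M n) where
  toFun g := ((LinearMap.lcomp ℂ (Chains L M n) (LieModule.toEnd ℂ L M g)).comp
    (TensorProduct.mk ℂ (⋀[ℂ]^n L) M)).compAlternatingMap (exteriorPower.ιMulti ℂ n)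
  map_add' g h := by ext; simp [TensorProduct.tmul_add]
  map_smul' c g := by ext; simp

variable (L M) in
/-- The part of the differential which comes from the Lie bracket. Each pair is counted twice by
the double alternation, hence the factor `1/2`; see `ceD_apply` for the resulting formula. -/
def ceBracketPart : ∀ n : ℕ, L [⋀^Fin (n + 1)]→ₗ[ℂ] (M →ₗ[ℂ] Chains L M n)
  | 0 => 0
  | n + 1 => (-(1 / 2) : ℂ) •
      alternatizeUncurryFin 
        (alternatizeUncurryFinLM  ∘ₗ ceBracket L M n)

variable (L M) in
/-- The differential `⋀ⁿ⁺¹ L ⊗ M → ⋀ⁿ L ⊗ M` of the standard chain complex of the Lie algebra `L`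
with coefficients in the `L`-module `M`. In the notation `g_{n+1} ∧ ⋯ ∧ g_1 ⊗ x`, the first part is
`∑ᵢ (-1)^{i-1} ⋯ ĝ_i ⋯ ⊗ g_i · x`, and the second one is
`∑_{i<j} (-1)^{i+j} ⋯ ĝ_j ⋯ ĝ_i ⋯ ∧ [g_j, g_i] ⊗ x`. -/
def ceD (n : ℕ) : Chains L M (n + 1) →ₗ[ℂ] Chains L M n :=
  TensorProduct.lift (exteriorPower.alternatingMapLinearEquiv
     
    ((-1 : ℂ) ^ n • alternatizeUncurryFin  (ceAct L M n) + ceBracketPart L M n))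

theorem ceD_zero_apply (v : Fin 1 → L) (x : M) :
    ceD L M 0 (exteriorPower.ιMulti ℂ 1 v ⊗ₜ[ℂ] x) =
      exteriorPower.ιMulti ℂ 0 (Fin.removeNth 0 v) ⊗ₜ[ℂ] ⁅v 0, x⁆ := by
  simp [ceD, ceBracketPart, alternatizeUncurryFin_apply, ceAct]

/-- The explicit formula for the differential. In terms of `g_{n+2} ∧ ⋯ ∧ g_1 = v₀ ∧ ⋯ ∧ vₙ₊₁`, so
that `v_a = g_{n+2-a}`, the index `a` of the first sum stands for `g_i` with `i - 1 = n + 1 - a`,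
and the pair `a ≤ b` of the second one stands for `g_j = v_a` and `g_i = v_{b+1}`, which has
`i < j` and `(-1)^{i+j} = (-1)^{a+b+1}`. -/
theorem ceD_apply (n : ℕ) (v : Fin (n + 2) → L) (x : M) :
    ceD L M (n + 1) (exteriorPower.ιMulti ℂ (n + 2) v ⊗ₜ[ℂ] x) =
      ∑ a : Fin (n + 2), (-1 : ℂ) ^ (n + 1 - (a : ℕ)) •
        (exteriorPower.ιMulti ℂ (n + 1) (a.removeNth v) ⊗ₜ[ℂ] ⁅v a, x⁆) +
      ∑ a : Fin (n + 1), ∑ b ≥ a, (-1 : ℂ) ^ ((a : ℕ) + b + 1) •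
        (exteriorPower.ιMulti ℂ (n + 1)
          (Fin.snoc (α := fun _ => L) (b.removeNth (a.castSucc.removeNth v))
            ⁅v a.castSucc, v b.succ⁆) ⊗ₜ[ℂ] x) := by
  simp only [ceD, TensorProduct.lift.tmul, exteriorPower.alternatingMapLinearEquiv_apply_ιMulti,
    AlternatingMap.add_apply, LinearMap.add_apply]
  congr 1
  · rw [AlternatingMap.smul_apply, alternatizeUncurryFin_apply, LinearMap.smul_apply,
      LinearMap.sum_apply, Finset.smul_sum]
    refine Finset.sum_congr rfl fun a _ => ?_
    have ha : (a : ℕ) ≤ n + 1 := by omega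
    have hs : (-1 : ℂ) ^ (n + 1) = (-1) ^ (n + 1 - (a : ℕ)) * (-1) ^ (a : ℕ) := by
      rw [← pow_add, Nat.sub_add_cancel ha]
    have h2 : ((-1 : ℂ) ^ (a : ℕ)) * (-1) ^ (a : ℕ) = 1 := by
      rw [← mul_pow]; simp
    have h3 : ∀ f : M →ₗ[ℂ] Chains L M (n + 1),
        ((-1 : ℤ) ^ (a : ℕ) • f) x = ((-1 : ℂ) ^ (a : ℕ)) • f x := by
      intro f
      rcases Nat.even_or_odd (a : ℕ) with h | h
      · simp [h.neg_one_pow]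
      · simp [h.neg_one_pow]
    rw [h3, smul_smul, hs, mul_assoc, h2, mul_one]
    rfl
  · have key : ∀ a b : L, ∀ w : Fin n → L, ceBracket L M n a b w - ceBracket L M n b a w
        = (2 : ℂ) • ceSnoc L M n ⁅a, b⁆ w := by
      intro a b w
      simp only [ceBracket, LinearMap.mk₂_apply]
      rw [← lie_skew a b, map_neg, AlternatingMap.neg_apply, two_smul]
      abel
    simp only [ceBracketPart]
    rw [AlternatingMap.smul_apply, alternatizeUncurryFin_alternatizeUncurryFinLM_comp_apply]
    simp only [key, LinearMap.smul_apply, LinearMap.sum_apply, Finset.smul_sum]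
    refine Finset.sum_congr rfl fun a _ => Finset.sum_congr rfl fun b _ => ?_
    rw [← ceSnoc_apply]
    rcases Nat.even_or_odd ((a : ℕ) + b) with h | h
    · rw [h.neg_one_pow, h.add_one.neg_one_pow]
      simp [smul_smul]
    · rw [h.neg_one_pow, h.add_one.neg_one_pow]
      simp [smul_smul]

end ChevalleyEilenberg

/-! ### The free Lie algebra `𝔞`, its cyclic automorphism and the invariants `𝔫̄` -/

section FreeLie

variable (T m : ℕ)

/-- The free Lie algebra `𝔞` over `ℂ` with generators `f_i^{(k)}`, `k ∈ ℤ/T`, `i = 1, …, m`. -/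
abbrev FreeLie : Type := FreeLieAlgebra ℂ (ZMod T × Fin m)

/-- The automorphism `τʲ` of `𝔞`, `f_i^{(k)} ↦ f_i^{(k+j)}`; in particular `τ = shift 1`. -/
def shift (j : ZMod T) : FreeLie T m →ₗ⁅ℂ⁆ FreeLie T m :=
  FreeLieAlgebra.lift ℂ (fun a : ZMod T × Fin m => FreeLieAlgebra.of ℂ (a.1 + j, a.2))

variable {T m}

@[simp]
theorem shift_of (j : ZMod T) (a : ZMod T × Fin m) :
    shift T m j (FreeLieAlgebra.of ℂ a) = FreeLieAlgebra.of ℂ (a.1 + j, a.2) := by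
  simp [shift]

theorem shift_shift (j k : ZMod T) (x : FreeLie T m) :
    shift T m j (shift T m k x) = shift T m (j + k) x := by
  have : (shift T m j).comp (shift T m k) = shift T m (j + k) := by
    refine FreeLieAlgebra.hom_ext fun a => ?_
    simp [add_assoc, add_comm j k]
  exact congrArg (fun f : FreeLie T m →ₗ⁅ℂ⁆ FreeLie T m => f x) this

variable (T m)

/-- The Lie subalgebra `𝔫̄` of `τ`-invariant elements of `𝔞`. -/
def nbar : LieSubalgebra ℂ (FreeLie T m) where
  carrier := {x | shift T m 1 x = x}
  add_mem' {x y} hx hy := by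
    rw [Set.mem_ofPred_eq] at *
    rw [map_add, hx, hy]
  zero_mem' := map_zero _
  smul_mem' c x hx := by
    rw [Set.mem_ofPred_eq] at *
    rw [map_smul, hx]
  lie_mem' {x y} hx hy := by
    change shift T m 1 x = x at hx
    change shift T m 1 y = y at hy
    change shift T m 1 ⁅x, y⁆ = ⁅x, y⁆
    rw [LieHom.map_lie, hx, hy]

/-- The projection `g ↦ ḡ = ∑_{j ∈ ℤ/T} τʲ g` from `𝔞` onto `𝔫̄`. -/
def bar [NeZero T] : FreeLie T m →ₗ[ℂ] nbar T m :=
  LinearMap.codRestrict (nbar T m).toSubmodule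
    (∑ j : ZMod T, (shift T m j : FreeLie T m →ₗ[ℂ] FreeLie T m)) (by
      intro x
      change shift T m 1 _ = _
      simp only [LinearMap.sum_apply, map_sum, LieHom.coe_toLinearMap, shift_shift]
      exact Fintype.sum_equiv (Equiv.addLeft (1 : ZMod T)) _ _ fun j => rfl)

variable {T m}

theorem coe_bar [NeZero T] (x : FreeLie T m) :
    (bar T m x : FreeLie T m) = ∑ j : ZMod T, shift T m j x := by
  change (∑ j : ZMod T, (shift T m j : FreeLie T m →ₗ[ℂ] FreeLie T m)) x = _
  simp only [LinearMap.sum_apply, LieHom.coe_toLinearMap]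

end FreeLie

/-! ### The module `ℳ_{0,N} = U(𝔫̄) ⊗ U(𝔞)^{⊗N}` -/

section Module

variable (T m N : ℕ)

/-- The vector space `ℳ_{0,N} = U(𝔫̄) ⊗ U(𝔞)^{⊗N}` (it is also an algebra, the tensor product of
these algebras). -/
abbrev ModM : Type :=
  UniversalEnvelopingAlgebra ℂ (nbar T m) ⊗[ℂ]
    (⨂[ℂ] _ : Fin N, UniversalEnvelopingAlgebra ℂ (FreeLie T m))

/-- The element `x ⊗ 1 ⊗ ⋯ ⊗ 1 + 1 ⊗ x ⊗ 1 ⊗ ⋯ ⊗ 1 + ⋯ + 1 ⊗ ⋯ ⊗ 1 ⊗ x` of the algebra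
`U(𝔫̄) ⊗ U(𝔞)^{⊗N}`. -/
def coprod (x : nbar T m) : ModM T m N :=
  UniversalEnvelopingAlgebra.ι ℂ x ⊗ₜ[ℂ] 1 +
    ∑ j : Fin N, 1 ⊗ₜ[ℂ] PiTensorProduct.singleAlgHom j
      (UniversalEnvelopingAlgebra.ι ℂ (x : FreeLie T m))

theorem coprod_add (x y : nbar T m) : coprod T m N (x + y) = coprod T m N x + coprod T m N y := by
  have h : ((x + y : nbar T m) : FreeLie T m) = x + y := rfl
  simp only [coprod, map_add, h, TensorProduct.add_tmul,
    TensorProduct.tmul_add, Finset.sum_add_distrib]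
  abel

theorem coprod_smul (c : ℂ) (x : nbar T m) : coprod T m N (c • x) = c • coprod T m N x := by
  have h : ((c • x : nbar T m) : FreeLie T m) = c • (x : FreeLie T m) := rfl
  simp only [coprod, map_smul, h, TensorProduct.tmul_smul, smul_add,
    Finset.smul_sum, ← TensorProduct.smul_tmul']

theorem commutator_sum {R : Type*} [Ring R] (a a' : R) (b b' : Fin N → R)
    (h₁ : ∀ j, a * b' j = b' j * a) (h₂ : ∀ j, b j * a' = a' * b j)
    (h₃ : ∀ i j, i ≠ j → b i * b' j = b' j * b i) :
    (a + ∑ j, b j) * (a' + ∑ j, b' j) - (a' + ∑ j, b' j) * (a + ∑ j, b j) =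
      (a * a' - a' * a) + ∑ j, (b j * b' j - b' j * b j) := by
  have e₁ : a * ∑ j, b' j = (∑ j, b' j) * a := by
    rw [Finset.mul_sum, Finset.sum_mul]
    exact Finset.sum_congr rfl fun j _ => h₁ j
  have e₂ : (∑ j, b j) * a' = a' * ∑ j, b j := by
    rw [Finset.mul_sum, Finset.sum_mul]
    exact Finset.sum_congr rfl fun j _ => h₂ j
  have e₃ : (∑ j, b j) * (∑ j, b' j) - (∑ j, b' j) * (∑ j, b j) =
      ∑ j, (b j * b' j - b' j * b j) := by
    rw [Finset.sum_mul_sum, Finset.sum_mul_sum, Finset.sum_comm (f := fun i j => b' i * b j),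
      ← Finset.sum_sub_distrib]
    refine Finset.sum_congr rfl fun i _ => ?_
    rw [← Finset.sum_sub_distrib]
    refine Finset.sum_eq_single i (fun j _ hj => ?_) (fun h => absurd (Finset.mem_univ i) h)
    rw [h₃ i j hj.symm, sub_self]
  rw [← e₃, add_mul, mul_add, mul_add, add_mul, mul_add, mul_add, e₁, e₂]
  abel

theorem ι_lie {L : Type*} [LieRing L] [LieAlgebra ℂ L] (a b : L) :
    UniversalEnvelopingAlgebra.ι ℂ ⁅a, b⁆ = UniversalEnvelopingAlgebra.ι ℂ a *
      UniversalEnvelopingAlgebra.ι ℂ b - UniversalEnvelopingAlgebra.ι ℂ b *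
      UniversalEnvelopingAlgebra.ι ℂ a := by
  let _ : LieRing (UniversalEnvelopingAlgebra ℂ L) := LieRing.ofAssociativeRing
  exact LieHom.map_lie (UniversalEnvelopingAlgebra.ι ℂ) a b

theorem coprod_lie (x y : nbar T m) :
    coprod T m N ⁅x, y⁆ =
      coprod T m N x * coprod T m N y - coprod T m N y * coprod T m N x := by
  have hc : ((⁅x, y⁆ : nbar T m) : FreeLie T m) = ⁅(x : FreeLie T m), (y : FreeLie T m)⁆ := rfl
  unfold coprod
  rw [commutator_sum, hc, ι_lie, ι_lie]
  · simp only [Algebra.TensorProduct.tmul_mul_tmul, mul_one, map_sub, map_mul,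
      TensorProduct.tmul_sub, TensorProduct.sub_tmul]
  · intro j
    simp only [Algebra.TensorProduct.tmul_mul_tmul, mul_one, one_mul]
  · intro j
    simp only [Algebra.TensorProduct.tmul_mul_tmul, mul_one, one_mul]
  · intro i j hij
    rw [Algebra.TensorProduct.tmul_mul_tmul, Algebra.TensorProduct.tmul_mul_tmul]
    congr 1
    change PiTensorProduct.tprod ℂ _ * PiTensorProduct.tprod ℂ _ =
      PiTensorProduct.tprod ℂ _ * PiTensorProduct.tprod ℂ _
    rw [PiTensorProduct.tprod_mul_tprod, PiTensorProduct.tprod_mul_tprod]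
    congr 1
    exact Pi.mulSingle_commute
      (f := fun _ : Fin N => UniversalEnvelopingAlgebra ℂ (FreeLie T m)) hij _ _

instance : LieRingModule (nbar T m) (ModM T m N) where
  bracket x u := coprod T m N x * u
  add_lie x y u := by
    change coprod T m N (x + y) * u = _
    rw [coprod_add, add_mul]
  lie_add x u v := mul_add _ _ _
  leibniz_lie x y u := by
    change coprod T m N x * (coprod T m N y * u) =
      coprod T m N ⁅x, y⁆ * u + coprod T m N y * (coprod T m N x * u)
    rw [coprod_lie, sub_mul, mul_assoc, mul_assoc, sub_add_cancel]

theorem lie_def (x : nbar T m) (u : ModM T m N) : ⁅x, u⁆ = coprod T m N x * u := rfl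

instance : LieModule ℂ (nbar T m) (ModM T m N) where
  smul_lie c x u := by rw [lie_def, lie_def, coprod_smul, smul_mul_assoc]
  lie_smul c x u := by rw [lie_def, lie_def, mul_smul_comm]

end Module

/-! ### Commutators, monomials, and the weight decomposition -/

section Commutators

/-- Commutators in the generators `f_i^{(k)}`, as formal expressions. -/
inductive Comm (T m : ℕ) : Type
  | gen (k : ZMod T) (i : Fin m) : Comm T m
  | br (g h : Comm T m) : Comm T m

variable {T m N : ℕ}

namespace Comm

/-- The element of the free Lie algebra `𝔞` given by a commutator. -/
def eval : Comm T m → FreeLie T m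
  | gen k i => FreeLieAlgebra.of ℂ (k, i)
  | br g h => ⁅g.eval, h.eval⁆

/-- The content of a commutator: the labels `(k, i)` of the generators occurring in it. -/
def content : Comm T m → List (ZMod T × Fin m)
  | gen k i => [(k, i)]
  | br g h => g.content ++ h.content

/-- The weight of a commutator: it counts, for every `i`, the occurrences of the `f_i^{(k)}`. -/
def weight : Comm T m → Fin m → ℕ
  | gen _ i => Pi.single i 1
  | br g h => g.weight + h.weight

/-- The commutator `τʲ g`. -/
def shift (j : ZMod T) : Comm T m → Comm T m
  | gen k i => gen (k + j) i
  | br g h => br (g.shift j) (h.shift j)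

theorem eval_shift (j : ZMod T) (g : Comm T m) :
    (g.shift j).eval = CycloArr.shift T m j g.eval := by
  induction g with
  | gen k i => simp [shift, eval]
  | br g h ihg ihh => simp [shift, eval, ihg, ihh]

theorem weight_shift (j : ZMod T) (g : Comm T m) : (g.shift j).weight = g.weight := by
  induction g with
  | gen k i => rfl
  | br g h ihg ihh => simp [shift, weight, ihg, ihh]

end Comm

/-- The data of a monomial `ḡ_p ∧ ⋯ ∧ ḡ_1 ⊗ x_0 ⊗ x_1 ⊗ ⋯ ⊗ x_N`: commutators `g_p, …, g_1` (in this
order), and monomials `x_0 ∈ U(𝔫̄)` and `x_1, …, x_N ∈ U(𝔞)`, given as lists of commutators. -/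
structure Mono (T m N p : ℕ) where
  wedge : Fin p → Comm T m
  zero : List (Comm T m)
  point : Fin N → List (Comm T m)

namespace Mono

variable {p : ℕ}

/-- The total weight of a monomial. -/
def weight (x : Mono T m N p) : Fin m → ℕ :=
  ∑ a, (x.wedge a).weight + (x.zero.map Comm.weight).sum +
    ∑ j, ((x.point j).map Comm.weight).sum

/-- The element of `⋀ᵖ 𝔫̄ ⊗ ℳ_{0,N}` given by a monomial. -/
def eval [NeZero T] (x : Mono T m N p) : Chains (nbar T m) (ModM T m N) p :=
  exteriorPower.ιMulti ℂ p (fun a => bar T m (x.wedge a).eval) ⊗ₜ[ℂ]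
    ((x.zero.map fun g => UniversalEnvelopingAlgebra.ι ℂ (bar T m g.eval)).prod ⊗ₜ[ℂ]
      PiTensorProduct.tprod ℂ fun j =>
        ((x.point j).map fun g => UniversalEnvelopingAlgebra.ι ℂ g.eval).prod)

end Mono

variable (T m N) in
/-- The weight subspace `(⋀ᵖ 𝔫̄ ⊗ ℳ_{0,N})_{[r]}`: since `𝔞_{[s]}` is spanned by the commutators of
weight `s`, and `𝔫̄_{[s]}` by their projections, it is spanned by the monomials of weight `r`. -/
def weightSpace [NeZero T] (p : ℕ) (r : Fin m → ℕ) :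
    Submodule ℂ (Chains (nbar T m) (ModM T m N) p) :=
  Submodule.span ℂ {u | ∃ x : Mono T m N p, x.weight = r ∧ u = x.eval}

theorem eval_mem [NeZero T] {p : ℕ} {r : Fin m → ℕ} (x : Mono T m N p) (hx : x.weight = r) :
    x.eval ∈ weightSpace T m N p r :=
  Submodule.subset_span ⟨x, hx, rfl⟩

theorem lie_monomial [NeZero T] (g : Comm T m) (x₀ : List (Comm T m))
    (x : Fin N → List (Comm T m)) :
    ⁅bar T m g.eval, ((x₀.map fun g => UniversalEnvelopingAlgebra.ι ℂ (bar T m g.eval)).prod ⊗ₜ[ℂ]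
      PiTensorProduct.tprod ℂ fun j =>
        ((x j).map fun g => UniversalEnvelopingAlgebra.ι ℂ g.eval).prod : ModM T m N)⁆ =
    (((g :: x₀).map fun g => UniversalEnvelopingAlgebra.ι ℂ (bar T m g.eval)).prod ⊗ₜ[ℂ]
      PiTensorProduct.tprod ℂ fun j =>
        ((x j).map fun g => UniversalEnvelopingAlgebra.ι ℂ g.eval).prod) +
    ∑ j : Fin N, ∑ k : ZMod T,
      ((x₀.map fun g => UniversalEnvelopingAlgebra.ι ℂ (bar T m g.eval)).prod ⊗ₜ[ℂ]
      PiTensorProduct.tprod ℂ fun i => ((Function.update x j (g.shift k :: x j) i).map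
        fun g => UniversalEnvelopingAlgebra.ι ℂ g.eval).prod) := by
  rw [lie_def, coprod, add_mul, Finset.sum_mul, Algebra.TensorProduct.tmul_mul_tmul, one_mul,
    List.map_cons, List.prod_cons]
  congr 1
  refine Finset.sum_congr rfl fun j _ => ?_
  rw [Algebra.TensorProduct.tmul_mul_tmul, one_mul, coe_bar, map_sum, map_sum, Finset.sum_mul,
    TensorProduct.tmul_sum]
  refine Finset.sum_congr rfl fun k _ => ?_
  congr 1
  change PiTensorProduct.tprod ℂ _ * PiTensorProduct.tprod ℂ _ = _
  rw [PiTensorProduct.tprod_mul_tprod]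
  congr 1
  funext i
  rw [Pi.mul_apply, MonoidHom.mulSingle_apply]
  by_cases h : i = j
  · subst h
    simp [Comm.eval_shift]
  · simp [h]

theorem lie_bar [NeZero T] (g h : Comm T m) :
    ⁅bar T m g.eval, bar T m h.eval⁆ = ∑ k : ZMod T, bar T m (Comm.br g (h.shift k)).eval := by
  apply Subtype.ext
  have e₁ : ((⁅bar T m g.eval, bar T m h.eval⁆ : nbar T m) : FreeLie T m) =
      ⁅(bar T m g.eval : FreeLie T m), (bar T m h.eval : FreeLie T m)⁆ := rfl
  rw [e₁, AddSubmonoidClass.coe_finsetSum]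
  simp only [coe_bar, Comm.eval, Comm.eval_shift, LieHom.map_lie, shift_shift]
  rw [Finset.sum_comm, sum_lie_sum]
  refine Finset.sum_congr rfl fun j _ => ?_
  exact (Fintype.sum_equiv (Equiv.addLeft j) _ _ fun k => rfl).symm

theorem weight_mk {p : ℕ} (w : Fin p → Comm T m) (x₀ : List (Comm T m))
    (x : Fin N → List (Comm T m)) :
    (⟨w, x₀, x⟩ : Mono T m N p).weight = ∑ a, (w a).weight + (x₀.map Comm.weight).sum +
      ∑ j, ((x j).map Comm.weight).sum := rfl

theorem act_mem [NeZero T] {p : ℕ} {r : Fin m → ℕ} (w : Fin p → Comm T m) (g : Comm T m)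
    (x₀ : List (Comm T m)) (x : Fin N → List (Comm T m))
    (hr : g.weight + (⟨w, x₀, x⟩ : Mono T m N p).weight = r) :
    (exteriorPower.ιMulti ℂ p (fun a => bar T m (w a).eval) ⊗ₜ[ℂ] ⁅bar T m g.eval,
      ((x₀.map fun g => UniversalEnvelopingAlgebra.ι ℂ (bar T m g.eval)).prod ⊗ₜ[ℂ]
      PiTensorProduct.tprod ℂ fun j =>
        ((x j).map fun g => UniversalEnvelopingAlgebra.ι ℂ g.eval).prod : ModM T m N)⁆ :
      Chains (nbar T m) (ModM T m N) p) ∈ weightSpace T m N p r := by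
  rw [lie_monomial, TensorProduct.tmul_add, TensorProduct.tmul_sum]
  refine Submodule.add_mem _ ?_ (Submodule.sum_mem _ fun j _ => ?_)
  · refine eval_mem (⟨w, g :: x₀, x⟩ : Mono T m N p) ?_
    rw [← hr, weight_mk, weight_mk, List.map_cons, List.sum_cons]
    abel
  · rw [TensorProduct.tmul_sum]
    refine Submodule.sum_mem _ fun k _ => ?_
    refine eval_mem (⟨w, x₀, Function.update x j (g.shift k :: x j)⟩ : Mono T m N p) ?_
    have : ∑ i, ((Function.update x j (g.shift k :: x j) i).map Comm.weight).sum =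
        g.weight + ∑ i, ((x i).map Comm.weight).sum := by
      rw [← Finset.add_sum_erase _ _ (Finset.mem_univ j),
        ← Finset.add_sum_erase _ (fun i => ((x i).map Comm.weight).sum) (Finset.mem_univ j),
        Function.update_self, List.map_cons, List.sum_cons, Comm.weight_shift, add_assoc]
      congr 2
      refine Finset.sum_congr rfl fun i hi => ?_
      rw [Function.update_of_ne (Finset.ne_of_mem_erase hi)]
    rw [← hr, weight_mk, weight_mk, this]
    abel

theorem bracket_mem [NeZero T] {n : ℕ} {r : Fin m → ℕ} (w : Fin n → Comm T m) (g h : Comm T m)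
    (x₀ : List (Comm T m)) (x : Fin N → List (Comm T m))
    (hr : g.weight + h.weight + (⟨w, x₀, x⟩ : Mono T m N n).weight = r) :
    (exteriorPower.ιMulti ℂ (n + 1) (Fin.snoc (α := fun _ => nbar T m)
        (fun a => bar T m (w a).eval) ⁅bar T m g.eval, bar T m h.eval⁆) ⊗ₜ[ℂ]
      ((x₀.map fun g => UniversalEnvelopingAlgebra.ι ℂ (bar T m g.eval)).prod ⊗ₜ[ℂ]
      PiTensorProduct.tprod ℂ fun j =>
        ((x j).map fun g => UniversalEnvelopingAlgebra.ι ℂ g.eval).prod : ModM T m N) :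
      Chains (nbar T m) (ModM T m N) (n + 1)) ∈ weightSpace T m N (n + 1) r := by
  rw [← ceSnoc_apply, lie_bar, ceSnoc_sum]
  refine Submodule.sum_mem _ fun k _ => ?_
  rw [ceSnoc_apply]
  have e : (Fin.snoc (α := fun _ => nbar T m) (fun a => bar T m (w a).eval)
      (bar T m (Comm.br g (h.shift k)).eval) : Fin (n + 1) → nbar T m) =
      fun a => bar T m ((Fin.snoc (α := fun _ => Comm T m) w (Comm.br g (h.shift k)) :
        Fin (n + 1) → Comm T m) a).eval := by
    funext a
    induction a using Fin.lastCases with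
    | last => simp
    | cast a => simp
  rw [e]
  refine eval_mem (⟨Fin.snoc (α := fun _ => Comm T m) w (Comm.br g (h.shift k)), x₀, x⟩ :
    Mono T m N (n + 1)) ?_
  rw [← hr, weight_mk, weight_mk, Fin.sum_univ_castSucc]
  simp only [Fin.snoc_castSucc, Fin.snoc_last, Comm.weight, Comm.weight_shift]
  abel

theorem ceD_mem [NeZero T] (p : ℕ) (r : Fin m → ℕ) :
    ∀ u ∈ weightSpace T m N (p + 1) r,
      ceD (nbar T m) (ModM T m N) p u ∈ weightSpace T m N p r := by
  intro u hu
  refine (Submodule.span_le (p := (weightSpace T m N p r).comap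
    (ceD (nbar T m) (ModM T m N) p))).2 ?_ hu
  rintro _ ⟨⟨w, x₀, x⟩, hw, rfl⟩
  change ceD (nbar T m) (ModM T m N) p (Mono.eval _) ∈ weightSpace T m N p r
  rw [weight_mk] at hw
  cases p with
  | zero =>
    simp only [Mono.eval]
    rw [ceD_zero_apply]
    refine act_mem (Fin.removeNth 0 w) (w 0) x₀ x ?_
    rw [← hw, weight_mk, Fin.sum_univ_succAbove _ 0]
    simp only [Fin.removeNth]
    abel
  | succ n =>
    simp only [Mono.eval]
    rw [ceD_apply]
    refine Submodule.add_mem _ (Submodule.sum_mem _ fun a _ => Submodule.smul_mem _ _ ?_)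
      (Submodule.sum_mem _ fun a _ => Submodule.sum_mem _ fun b hb => Submodule.smul_mem _ _ ?_)
    · refine act_mem (Fin.removeNth a w) (w a) x₀ x ?_
      rw [← hw, weight_mk, Fin.sum_univ_succAbove _ a]
      simp only [Fin.removeNth]
      abel
    · refine bracket_mem (b.removeNth (a.castSucc.removeNth w)) (w a.castSucc) (w b.succ) x₀ x ?_
      have hab : a.castSucc.succAbove b = b.succ :=
        Fin.succAbove_of_le_castSucc _ _ (by simpa using Finset.mem_Ici.1 hb)
      rw [← hw, weight_mk, Fin.sum_univ_succAbove _ a.castSucc, Fin.sum_univ_succAbove _ b, hab]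
      simp only [Fin.removeNth]
      abel

variable (T m N) in
/-- The Chevalley–Eilenberg differential on a weight subspace. -/
def weightD [NeZero T] (p : ℕ) (r : Fin m → ℕ) :
    weightSpace T m N (p + 1) r →ₗ[ℂ] weightSpace T m N p r :=
  (ceD (nbar T m) (ModM T m N) p).restrict (ceD_mem p r)

namespace Mono

variable {p : ℕ}

/-- From `ḡ_{p+1} ∧ ⋯ ∧ ḡ_2 ∧ ḡ_1 ⊗ x_0 ⊗ ⋯ ⊗ x_N` to
`ḡ_{p+1} ∧ ⋯ ∧ ḡ_2 ⊗ x_0 ⊗ ⋯ ⊗ g_1 x_j ⊗ ⋯ ⊗ x_N`, where `j ∈ {1, …, N}`. -/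
def actPoint (x : Mono T m N (p + 1)) (j : Fin N) : Mono T m N p where
  wedge a := x.wedge a.castSucc
  zero := x.zero
  point := Function.update x.point j (x.wedge (Fin.last p) :: x.point j)

/-- From `ḡ_{p+1} ∧ ⋯ ∧ ḡ_2 ∧ ḡ_1 ⊗ x_0 ⊗ ⋯ ⊗ x_N` to
`ḡ_{p+1} ∧ ⋯ ∧ ḡ_2 ⊗ ḡ_1 x_0 ⊗ x_1 ⊗ ⋯ ⊗ x_N`. -/
def actZero (x : Mono T m N (p + 1)) : Mono T m N p where
  wedge a := x.wedge a.castSucc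
  zero := x.wedge (Fin.last p) :: x.zero
  point := x.point

/-- The commutator `[g_1, g_2]` of the last two entries of
`ḡ_{p+2} ∧ ⋯ ∧ ḡ_3 ∧ ḡ_2 ∧ ḡ_1 ⊗ x_0 ⊗ ⋯ ⊗ x_N`. -/
def lastBracket (x : Mono T m N (p + 2)) : Comm T m :=
  Comm.br (x.wedge (Fin.last (p + 1))) (x.wedge (Fin.last p).castSucc)

/-- From `ḡ_{p+2} ∧ ⋯ ∧ ḡ_3 ∧ ḡ_2 ∧ ḡ_1 ⊗ x_0 ⊗ ⋯ ⊗ x_N`, to the monomial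
`ḡ_{p+2} ∧ ⋯ ∧ ḡ_3 ∧ \overline{[g_1, g_2]} ⊗ x_0 ⊗ ⋯ ⊗ x_N`. -/
def join (x : Mono T m N (p + 2)) : Mono T m N (p + 1) where
  wedge := Fin.snoc (α := fun _ => Comm T m) (fun a : Fin p => x.wedge a.castSucc.castSucc)
    x.lastBracket
  zero := x.zero
  point := x.point

theorem weight_actPoint (x : Mono T m N (p + 1)) (j : Fin N) :
    (x.actPoint j).weight = x.weight := by
  have : ∑ i, (((x.actPoint j).point i).map Comm.weight).sum =
      (x.wedge (Fin.last p)).weight + ∑ i, ((x.point i).map Comm.weight).sum := by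
    rw [← Finset.add_sum_erase _ _ (Finset.mem_univ j),
      ← Finset.add_sum_erase _ (fun i => ((x.point i).map Comm.weight).sum) (Finset.mem_univ j)]
    simp only [actPoint]
    rw [Function.update_self, List.map_cons, List.sum_cons, add_assoc]
    congr 2
    refine Finset.sum_congr rfl fun i hi => ?_
    rw [Function.update_of_ne (Finset.ne_of_mem_erase hi)]
  unfold weight
  rw [this, Fin.sum_univ_castSucc (n := p)]
  simp only [actPoint]
  abel

theorem weight_actZero (x : Mono T m N (p + 1)) : x.actZero.weight = x.weight := by
  unfold weight
  rw [Fin.sum_univ_castSucc (n := p)]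
  simp only [actZero, List.map_cons, List.sum_cons]
  abel

theorem weight_join (x : Mono T m N (p + 2)) : x.join.weight = x.weight := by
  unfold weight
  rw [Fin.sum_univ_castSucc (n := p), Fin.sum_univ_castSucc (n := p + 1),
    Fin.sum_univ_castSucc (n := p)]
  simp only [join, lastBracket, Fin.snoc_castSucc, Fin.snoc_last, Comm.weight]
  abel

variable (T m N) in
/-- The monomial `f̄_1 ∧ ⋯ ∧ f̄_m ⊗ 1 ⊗ ⋯ ⊗ 1`. -/
def base : Mono T m N m where
  wedge i := Comm.gen 0 i
  zero := []
  point _ := []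

theorem weight_base : (base T m N).weight = 1 := by
  funext i
  simp [weight, base, Comm.weight, Finset.sum_apply, Pi.single_apply]

end Mono

variable (T m N) in
/-- The multilinear part `(⋀ᵖ 𝔫̄ ⊗ ℳ_{0,N})_{[1^m]}`, of weight `[1, …, 1]`. -/
abbrev multilinearPart [NeZero T] (p : ℕ) : Submodule ℂ (Chains (nbar T m) (ModM T m N) p) :=
  weightSpace T m N p 1

variable (T m N) in
/-- The differential `(⋀ᵖ⁺¹ 𝔫̄ ⊗ ℳ_{0,N})_{[1^m]} → (⋀ᵖ 𝔫̄ ⊗ ℳ_{0,N})_{[1^m]}`. -/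
abbrev multilinearD [NeZero T] (p : ℕ) : multilinearPart T m N (p + 1) →ₗ[ℂ] multilinearPart T m N p :=
  weightD T m N p 1

/-- A monomial of weight `[1, …, 1]` as an element of the multilinear part. -/
def Mono.vec [NeZero T] {p : ℕ} (x : Mono T m N p) (hx : x.weight = 1) : multilinearPart T m N p :=
  ⟨x.eval, eval_mem x hx⟩

end Commutators

/-! ### The recursive rules for the maps `ψ_p` -/

section FlagMap

variable {T m N : ℕ}

/-- `L_g : ω^{k_1} t_{i_1} = ⋯ = ω^{k_l} t_{i_l}`, for a commutator `g` of content
`(k_1, i_1), …, (k_l, i_l)`. -/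
def swimIsland (ω : ℂ) (g : Comm T m) : AffineSubspace ℂ (Fin m → ℂ) where
  carrier := {t | ∀ a ∈ g.content, ∀ b ∈ g.content, ω ^ a.1.val * t a.2 = ω ^ b.1.val * t b.2}
  smul_vsub_vadd_mem' c t u v ht hu hv := by
    intro a ha b hb
    have h₁ := ht a ha b hb
    have h₂ := hu a ha b hb
    have h₃ := hv a ha b hb
    simp only [vsub_eq_sub, vadd_eq_add, Pi.add_apply, Pi.smul_apply, Pi.sub_apply, smul_eq_mul]
    linear_combination c * (h₁ - h₂) + h₃

/-- `L_g^j : ω^{k_1} t_{i_1} = ⋯ = ω^{k_l} t_{i_l} = z_j`, where `c = z_j`. -/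
def fixedIsland (ω c : ℂ) (g : Comm T m) : AffineSubspace ℂ (Fin m → ℂ) where
  carrier := {t | ∀ a ∈ g.content, ω ^ a.1.val * t a.2 = c}
  smul_vsub_vadd_mem' d t u v ht hu hv := by
    intro a ha
    have h₁ := ht a ha
    have h₂ := hu a ha
    have h₃ := hv a ha
    simp only [vsub_eq_sub, vadd_eq_add, Pi.add_apply, Pi.smul_apply, Pi.sub_apply, smul_eq_mul]
    linear_combination d * (h₁ - h₂) + h₃

/-- `L_g^0 : t_{i_1} = ⋯ = t_{i_l} = 0`. -/
def zeroIsland (g : Comm T m) : AffineSubspace ℂ (Fin m → ℂ) where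
  carrier := {t | ∀ a ∈ g.content, t a.2 = 0}
  smul_vsub_vadd_mem' d t u v ht hu hv := by
    intro a ha
    simp only [vsub_eq_sub, vadd_eq_add, Pi.add_apply, Pi.smul_apply, Pi.sub_apply, smul_eq_mul]
    rw [ht a ha, hu a ha, hv a ha]
    ring

/-- The recursive rules for a family of linear maps
`ψ_p : (⋀ᵖ 𝔫̄ ⊗ ℳ_{0,N})_{[1^m]} → ℱᵏ(𝒞_{0,N;m})`, where `p + k = m`. -/
structure IsFlagMap [NeZero T] (ω : ℂ) (z : Fin N → ℂ)
    (ψ : ∀ p k : ℕ, p + k = m → (multilinearPart T m N p →ₗ[ℂ] FlagSpace (cda T m ω z) k)) :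
    Prop where
  /-- `ψ_m (f̄_1 ∧ ⋯ ∧ f̄_m ⊗ 1 ⊗ ⋯ ⊗ 1)` is the trivial flag `ℂᵐ`. -/
  base : ψ m 0 (Nat.add_zero m) ((Mono.base T m N).vec Mono.weight_base) =
    flagClass (trivialFlag (cda T m ω z))
  /-- Every monomial is mapped to a flag up to sign. -/
  monomial : ∀ (p k : ℕ) (h : p + k = m) (x : Mono T m N p) (hx : x.weight = 1),
    ∃ (ε : ℤˣ) (F : Flag (cda T m ω z) k), ψ p k h (x.vec hx) = (ε : ℤ) • flagClass F
  /-- If `ψ_{p+1} (⋯ ∧ ḡ_2 ∧ ḡ_1 ⊗ x_0 ⊗ ⋯ ⊗ x_N) = ± F`, then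
  `ψ_p (⋯ ∧ ḡ_2 ⊗ x_0 ⊗ ⋯ ⊗ g_1 x_j ⊗ ⋯ ⊗ x_N) = ± (F ⊃ L ∩ L_{g_1}^j)` for `j ∈ {1, …, N}`, where
  `L` is the last edge of `F`. -/
  actPoint : ∀ (p k : ℕ) (h : (p + 1) + k = m) (h' : p + (k + 1) = m) (x : Mono T m N (p + 1))
    (hx : x.weight = 1) (j : Fin N) (ε : ℤˣ) (F : Flag (cda T m ω z) k),
    ψ (p + 1) k h (x.vec hx) = (ε : ℤ) • flagClass F →
    ∃ F' : Flag (cda T m ω z) (k + 1), F'.init = F ∧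
      F'.last = F.last ⊓ fixedIsland ω (z j) (x.wedge (Fin.last p)) ∧
      ψ p (k + 1) h' ((x.actPoint j).vec ((x.weight_actPoint j).trans hx)) =
        (ε : ℤ) • flagClass F'
  /-- If `ψ_{p+1} (⋯ ∧ ḡ_2 ∧ ḡ_1 ⊗ x_0 ⊗ ⋯ ⊗ x_N) = ± F`, then
  `ψ_p (⋯ ∧ ḡ_2 ⊗ ḡ_1 x_0 ⊗ x_1 ⊗ ⋯ ⊗ x_N) = ± (F ⊃ L ∩ L_{g_1}^0)`. -/
  actZero : ∀ (p k : ℕ) (h : (p + 1) + k = m) (h' : p + (k + 1) = m) (x : Mono T m N (p + 1))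
    (hx : x.weight = 1) (ε : ℤˣ) (F : Flag (cda T m ω z) k),
    ψ (p + 1) k h (x.vec hx) = (ε : ℤ) • flagClass F →
    ∃ F' : Flag (cda T m ω z) (k + 1), F'.init = F ∧
      F'.last = F.last ⊓ zeroIsland (x.wedge (Fin.last p)) ∧
      ψ p (k + 1) h' (x.actZero.vec (x.weight_actZero.trans hx)) = (ε : ℤ) • flagClass F'
  /-- If `ψ_{p+2} (⋯ ∧ ḡ_3 ∧ ḡ_2 ∧ ḡ_1 ⊗ x_0 ⊗ ⋯ ⊗ x_N) = ± F`, then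
  `ψ_{p+1} (⋯ ∧ ḡ_3 ∧ \overline{[g_1, g_2]} ⊗ x_0 ⊗ ⋯ ⊗ x_N) = ± (F ⊃ L ∩ L_{[g_1, g_2]})`. -/
  join : ∀ (p k : ℕ) (h : (p + 2) + k = m) (h' : (p + 1) + (k + 1) = m) (x : Mono T m N (p + 2))
    (hx : x.weight = 1) (ε : ℤˣ) (F : Flag (cda T m ω z) k),
    ψ (p + 2) k h (x.vec hx) = (ε : ℤ) • flagClass F →
    ∃ F' : Flag (cda T m ω z) (k + 1), F'.init = F ∧
      F'.last = F.last ⊓ swimIsland ω x.lastBracket ∧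
      ψ (p + 1) (k + 1) h' (x.join.vec (x.weight_join.trans hx)) = (ε : ℤ) • flagClass F'

end FlagMap

end

end CycloArr

/-! The inverse of `ψ` is constructed directly. A multilinear monomial has an edge, the intersection
of its islands: every wedge factor is an island that moves freely, the factors at the points and at
the origin are fixed, so a monomial with `p` wedge factors has an edge of dimension `p`. Each term
of its differential fixes one island or ties two together, so its edge is contained in the old one.
For a subspace `L` there is a linear map `edgeProj` that keeps the monomials whose edge contains `L`
and kills the others. It is a tensor product of maps on the factors, so it needs no basis of
monomials.

To a flag `L⁰ ⊃ ⋯ ⊃ Lᵏ` corresponds the chain `flagVec`, obtained from `f̄_1 ∧ ⋯ ∧ f̄_m` by applying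
`d` and projecting to `L¹`, applying `d` and projecting to `L²`, and so on. Summing over all edges
in a gap removes the projection in the middle and leaves `d ∘ d = 0` (`sum_flagVec_gap_last`), so
the flag relations hold and `flagMap` is defined. It commutes with the differentials because the
projections to all possible next edges add up to the identity (`sum_edgeProj_last`). The identity `d
∘ d = 0` for chains comes from Cartan's formula.

The rules (A), (B), (C) hold because the component of `d x` along the edge of the new monomial is
exactly that monomial, with sign `+1`: suitable points of the new edge, with chosen values at the
islands, lie off the edges of all other terms (`edgeProj_ceD_actPoint`, `edgeProj_ceD_actZero`,
`edgeProj_ceD_join`). Here the points must be nonzero and in different orbits, and `ω` must be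
primitive. Every multilinear monomial arises from the base monomial by these three moves up to sign
(`multilinear_induction`), so every monomial is plus or minus a flag vector. This gives surjectivity
of `flagMap`, and uniqueness of `ψ`. Monomials are nonzero, by an embedding into free associative
algebras, and therefore the last edge of any flag which represents a monomial is the edge of that
monomial.

Injectivity is a dimension count. Forgetting a coordinate makes the arrangement one of fiber type,
which bounds the total dimension of the flag spaces above by `∏ (2 + N T + i T)`, `0 ≤ i < m`. On
the side of chains, families of words that contain each index once are counted by inserting the
letters in increasing order of index, which gives the same product. Each family yields a monomial,
and these monomials are linearly independent because their leading words are triangular. Since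
`flagMap` is surjective in each degree, the two bounds force equal dimensions in each degree.
Finally `d ∘ d = 0` on flags is transported from chains. -/

open scoped TensorProduct

namespace CycloArr

noncomputable section

section

/-! ### Cartan calculus: the Chevalley–Eilenberg differential squares to zero -/

section ChevalleyEilenbergSquare

variable {L M : Type*} [LieRing L] [LieAlgebra ℂ L] [AddCommGroup M] [Module ℂ M]

variable (L M) in
/-- Exterior multiplication `c ⊗ x ↦ c ∧ y ⊗ x` on chains. -/
def ceWedge (n : ℕ) (y : L) : Chains L M n →ₗ[ℂ] Chains L M (n + 1) :=
  TensorProduct.lift (exteriorPower.alternatingMapLinearEquiv (ceSnoc L M n y))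

theorem ceWedge_apply (n : ℕ) (y : L) (v : Fin n → L) (x : M) :
    ceWedge L M n y (exteriorPower.ιMulti ℂ n v ⊗ₜ[ℂ] x) =
      exteriorPower.ιMulti ℂ (n + 1) (Fin.snoc (α := fun _ => L) v y) ⊗ₜ[ℂ] x := by
  simp only [ceWedge, TensorProduct.lift.tmul,
    exteriorPower.alternatingMapLinearEquiv_apply_ιMulti, ceSnoc_apply]

theorem chains_hom_ext {n : ℕ} {P : Type*} [AddCommGroup P] [Module ℂ P]
    {f g : Chains L M n →ₗ[ℂ] P}
    (h : ∀ (v : Fin n → L) (x : M), f (exteriorPower.ιMulti ℂ n v ⊗ₜ[ℂ] x) =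
      g (exteriorPower.ιMulti ℂ n v ⊗ₜ[ℂ] x)) : f = g := by
  refine TensorProduct.ext ?_
  refine exteriorPower.linearMap_ext ?_
  ext v x
  exact h v x

theorem chains_hom_ext_succ {n : ℕ} {P : Type*} [AddCommGroup P] [Module ℂ P]
    {f g : Chains L M (n + 1) →ₗ[ℂ] P}
    (h : ∀ y, f ∘ₗ ceWedge L M n y = g ∘ₗ ceWedge L M n y) : f = g := by
  refine chains_hom_ext fun v x => ?_
  have := LinearMap.congr_fun (h (v (Fin.last n)))
    (exteriorPower.ιMulti ℂ n (Fin.init v) ⊗ₜ[ℂ] x)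
  simpa only [LinearMap.comp_apply, ceWedge_apply, Fin.snoc_init_self] using this

/-- Moving the last factor to position `a` passes the `n - a` factors in between. -/
theorem ιMulti_snoc_removeNth (n : ℕ) (v : Fin (n + 1) → L) (a : Fin (n + 1)) (w : L) :
    exteriorPower.ιMulti ℂ (n + 1) (Fin.snoc (α := fun _ => L) (a.removeNth v) w) =
      ((-1 : ℂ) ^ (n - (a : ℕ))) • exteriorPower.ιMulti ℂ (n + 1) (Function.update v a w) := by
  have h1 := (exteriorPower.ιMulti ℂ (n + 1) (M := L)).map_insertNth (Fin.last n) w (a.removeNth v)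
  have h2 := (exteriorPower.ιMulti ℂ (n + 1) (M := L)).map_insertNth a w (a.removeNth v)
  rw [Fin.insertNth_last'] at h1
  rw [Fin.insertNth_removeNth] at h2
  rw [h1, h2, Fin.val_last]
  have ha : (a : ℕ) ≤ n := by omega
  have key : ∀ u : ⋀[ℂ]^(n + 1) L, ∀ k : ℕ, ((-1 : ℤ) ^ k) • u = ((-1 : ℂ) ^ k) • u := by
    intro u k
    rcases Nat.even_or_odd k with h | h
    · simp [h.neg_one_pow]
    · rw [h.neg_one_pow, h.neg_one_pow, neg_one_smul]
      exact (neg_one_smul ℂ u).symm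
  rw [key, key, smul_smul, ← pow_add, Nat.sub_add_cancel ha]

theorem ιMulti_snoc_snoc (n : ℕ) (v : Fin n → L) (y z : L) :
    exteriorPower.ιMulti ℂ (n + 2) (Fin.snoc (α := fun _ => L)
      (Fin.snoc (α := fun _ => L) v y : Fin (n + 1) → L) z) =
    - exteriorPower.ιMulti ℂ (n + 2) (Fin.snoc (α := fun _ => L)
      (Fin.snoc (α := fun _ => L) v z : Fin (n + 1) → L) y) := by
  have h := (exteriorPower.ιMulti ℂ (n + 2) (M := L)).map_swap
    (Fin.snoc (α := fun _ => L) (Fin.snoc (α := fun _ => L) v z : Fin (n + 1) → L) y)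
    (i := (Fin.last n).castSucc) (j := Fin.last (n + 1)) (Fin.castSucc_lt_last _).ne
  rw [← h]
  congr 1
  funext i
  simp only [Function.comp]
  induction i using Fin.lastCases with
  | last => simp
  | cast i =>
    induction i using Fin.lastCases with
    | last => simp
    | cast i =>
      rw [Equiv.swap_apply_of_ne_of_ne]
      · simp
      · exact fun e => (Fin.castSucc_lt_last i).ne (Fin.castSucc_injective _ e)
      · exact (Fin.castSucc_lt_last _).ne

theorem sum_Ici_eq {n : ℕ} {A : Type*} [AddCommMonoid A] (a : Fin n) (f : Fin n → A) :
    ∑ b ≥ a, f b = ∑ b, if a ≤ b then f b else 0 := by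
  rw [← Finset.sum_filter]
  refine Finset.sum_congr ?_ fun _ _ => rfl
  ext b
  simp

variable [LieRingModule L M] [LieModule ℂ L M]

theorem ceD_ceWedge_zero (y : L) (v : Fin 0 → L) (x : M) :
    ceD L M 0 (ceWedge L M 0 y (exteriorPower.ιMulti ℂ 0 v ⊗ₜ[ℂ] x)) =
      exteriorPower.ιMulti ℂ 0 v ⊗ₜ[ℂ] ⁅y, x⁆ := by
  rw [ceWedge_apply, ceD_zero_apply]
  congr 2
  exact Subsingleton.elim _ _

/-- Cartan's formula. The terms of `d (c ∧ y)` which leave `y` alone cancel against `(d c) ∧ y`; the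
surviving ones let `y` act on the module or bracket it with a factor, and together they form the
derivation given by `y`. -/
theorem ceD_ceWedge_succ (n : ℕ) (y : L) (v : Fin (n + 1) → L) (x : M) :
    ceD L M (n + 1) (ceWedge L M (n + 1) y (exteriorPower.ιMulti ℂ (n + 1) v ⊗ₜ[ℂ] x)) +
      ceWedge L M n y (ceD L M n (exteriorPower.ιMulti ℂ (n + 1) v ⊗ₜ[ℂ] x)) =
      exteriorPower.ιMulti ℂ (n + 1) v ⊗ₜ[ℂ] ⁅y, x⁆ +
      ∑ a, exteriorPower.ιMulti ℂ (n + 1) (Function.update v a ⁅y, v a⁆) ⊗ₜ[ℂ] x := by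
  have hlast : ∀ a : Fin (n + 1), ((-1 : ℂ) ^ ((a : ℕ) + n + 1)) •
      (exteriorPower.ιMulti ℂ (n + 1) (Fin.snoc (α := fun _ => L) (a.removeNth v) ⁅v a, y⁆)
        ⊗ₜ[ℂ] x) =
      exteriorPower.ιMulti ℂ (n + 1) (Function.update v a ⁅y, v a⁆) ⊗ₜ[ℂ] x := by
    intro a
    -- The sign of the differential and that of moving the bracket back to position `a` multiply to
    -- `-1`, which turns `⁅v a, y⁆` into `⁅y, v a⁆`.
    have ha : (a : ℕ) + n + 1 + (n - (a : ℕ)) = 2 * n + 1 := by omega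
    rw [ιMulti_snoc_removeNth, TensorProduct.smul_tmul', smul_smul, ← pow_add, ha,
      ← lie_skew (v a) y, AlternatingMap.map_update_neg]
    simp [pow_succ, pow_mul]
  rw [ceWedge_apply, ceD_apply]
  have hrl : ∀ (k : ℕ) (w : Fin k → L) (z : L),
      (Fin.last k).removeNth (Fin.snoc (α := fun _ => L) w z) = w := by
    intro k w z
    simp
  have hrc : ∀ (k : ℕ) (w : Fin (k + 1) → L) (z : L) (a : Fin (k + 1)),
      (a.castSucc.removeNth (Fin.snoc (α := fun _ => L) w z : Fin (k + 2) → L) : Fin (k + 1) → L) =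
        Fin.snoc (α := fun _ => L) (a.removeNth w) z := by
    intro k w z a
    funext i
    induction i using Fin.lastCases with
    | last => simp [Fin.removeNth]
    | cast i => simp [Fin.removeNth]
  rw [Fin.sum_univ_castSucc (n := n + 1)]
  have hsign : ∀ a : Fin (n + 1), ((-1 : ℂ) ^ (n + 1 - ((a.castSucc : Fin (n + 2)) : ℕ))) =
      - (-1) ^ (n - (a : ℕ)) := by
    intro a
    have : n + 1 - ((a.castSucc : Fin (n + 2)) : ℕ) = (n - (a : ℕ)) + 1 := by
      rw [Fin.val_castSucc]; omega
    rw [this, pow_succ]; ring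
  simp only [hsign, hrc, hrl, Fin.snoc_castSucc, Fin.snoc_last, Fin.val_last, Nat.sub_self,
    pow_zero, one_smul]
  -- The pairs of factors are split according to whether the second one is the last factor `y`.
  have hbr : ∀ B : Fin (n + 1) → Fin (n + 1) → Chains L M (n + 1),
      ∑ a : Fin (n + 1), ∑ b ≥ a, B a b = ∑ a, B a (Fin.last n) +
        ∑ a : Fin n, ∑ b ≥ a, B a.castSucc b.castSucc := by
    intro B
    have : ∀ a : Fin (n + 1), ∑ b ≥ a, B a b = B a (Fin.last n) +
        ∑ b : Fin n, if a ≤ b.castSucc then B a b.castSucc else 0 := by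
      intro a
      rw [sum_Ici_eq, Fin.sum_univ_castSucc, if_pos (Fin.le_last a)]
      exact add_comm _ _
    simp only [this, Finset.sum_add_distrib]
    congr 1
    rw [Fin.sum_univ_castSucc]
    have h0 : ∀ b : Fin n, ¬ Fin.last n ≤ b.castSucc :=
      fun b => not_le.2 (Fin.castSucc_lt_last b)
    simp only [h0, if_false, Finset.sum_const_zero, add_zero, sum_Ici_eq,
      Fin.castSucc_le_castSucc_iff]
  rw [hbr]
  simp only [hrl, Fin.succ_last, Fin.snoc_last, Fin.val_last, hlast]
  rw [add_comm (∑ a : Fin (n + 1), _) (exteriorPower.ιMulti ℂ (n + 1) v ⊗ₜ[ℂ] ⁅y, x⁆)]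
  -- `B` and `C` are the two parts of the derivation; `A` and `D` are the terms of `d (c ∧ y)` that
  -- do not involve `y`, and `E` is `(d c) ∧ y`.
  have hrest : ∀ A B C D E : Chains L M (n + 1), A + D + E = 0 →
      B + A + (C + D) + E = B + C := by
    intro A B C D E h
    rw [show B + A + (C + D) + E = B + C + (A + D + E) by abel, h, add_zero]
  apply hrest
  cases n with
  | zero =>
    rw [ceD_zero_apply, ceWedge_apply]
    simp only [Finset.univ_eq_empty, Finset.sum_empty, add_zero, Fin.sum_univ_succ]
    simp
  | succ n =>
    rw [ceD_apply, map_add, map_sum, map_sum]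
    simp only [map_sum, map_smul, ceWedge_apply]
    have hd : ∀ A B C D : Chains L M (n + 1 + 1), A + C = 0 → B + D = 0 → A + B + (C + D) = 0 := by
      intro A B C D h1 h2
      rw [show A + B + (C + D) = (A + C) + (B + D) by abel, h1, h2, add_zero]
    apply hd
    · rw [← Finset.sum_add_distrib]
      refine Finset.sum_eq_zero fun a _ => ?_
      rw [neg_smul, neg_add_cancel]
    · rw [← Finset.sum_add_distrib]
      refine Finset.sum_eq_zero fun a _ => ?_
      rw [← Finset.sum_add_distrib]
      refine Finset.sum_eq_zero fun b _ => ?_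
      have e1 : (b.castSucc.removeNth (Fin.snoc (α := fun _ => L) (a.castSucc.removeNth v) y :
          Fin (n + 2) → L) : Fin (n + 1) → L) =
          Fin.snoc (α := fun _ => L) (b.removeNth (a.castSucc.removeNth v)) y := hrc _ _ _ _
      -- The differential puts the bracket behind `y`, whereas in `(d c) ∧ y` it stands before `y`.
      -- The transposition supplies the sign which makes the terms cancel.
      rw [e1, ιMulti_snoc_snoc]
      have e2 : b.castSucc.succ = b.succ.castSucc := rfl
      rw [e2, Fin.snoc_castSucc]
      simp only [Fin.val_castSucc, TensorProduct.neg_tmul, smul_neg]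
      exact neg_add_cancel _

variable (L M) in
/-- The Lie derivative on chains, defined by Cartan's formula. -/
def ceLie : ∀ (n : ℕ) (_ : L), Chains L M n →ₗ[ℂ] Chains L M n
  | 0, y => ceD L M 0 ∘ₗ ceWedge L M 0 y
  | n + 1, y => ceD L M (n + 1) ∘ₗ ceWedge L M (n + 1) y + ceWedge L M n y ∘ₗ ceD L M n

theorem ceLie_apply (n : ℕ) (y : L) (v : Fin n → L) (x : M) :
    ceLie L M n y (exteriorPower.ιMulti ℂ n v ⊗ₜ[ℂ] x) =
      exteriorPower.ιMulti ℂ n v ⊗ₜ[ℂ] ⁅y, x⁆ +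
      ∑ a, exteriorPower.ιMulti ℂ n (Function.update v a ⁅y, v a⁆) ⊗ₜ[ℂ] x := by
  cases n with
  | zero => simpa [ceLie] using ceD_ceWedge_zero y v x
  | succ n => exact ceD_ceWedge_succ n y v x

theorem ceLie_ceWedge (n : ℕ) (z y : L) :
    ceLie L M (n + 1) z ∘ₗ ceWedge L M n y =
      ceWedge L M n y ∘ₗ ceLie L M n z + ceWedge L M n ⁅z, y⁆ := by
  refine chains_hom_ext fun v x => ?_
  simp only [LinearMap.comp_apply, LinearMap.add_apply, ceWedge_apply, ceLie_apply, map_add,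
    map_sum, Fin.sum_univ_castSucc, Fin.snoc_castSucc, Fin.snoc_last, Fin.update_snoc_last,
    ← Fin.snoc_update, add_assoc]

/-- On a further wedge factor the commutation relation is the Jacobi identity; on the module it is
the axiom of a Lie action. -/
theorem ceLie_lie (n : ℕ) (z y : L) :
    ceLie L M n z ∘ₗ ceLie L M n y =
      ceLie L M n y ∘ₗ ceLie L M n z + ceLie L M n ⁅z, y⁆ := by
  induction n with
  | zero =>
    refine chains_hom_ext fun v x => ?_
    simp [ceLie_apply, ← TensorProduct.tmul_add, add_comm]
  | succ n ih =>
    refine chains_hom_ext_succ fun w => ?_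
    refine LinearMap.ext fun c => ?_
    have hw : ∀ (u t : L) (c : Chains L M n), ceLie L M (n + 1) u (ceWedge L M n t c) =
        ceWedge L M n t (ceLie L M n u c) + ceWedge L M n ⁅u, t⁆ c :=
      fun u t c => LinearMap.congr_fun (ceLie_ceWedge n u t) c
    have hc : ceLie L M n z (ceLie L M n y c) =
        ceLie L M n y (ceLie L M n z c) + ceLie L M n ⁅z, y⁆ c := LinearMap.congr_fun ih c
    have hj : ceWedge L M n ⁅z, ⁅y, w⁆⁆ c =
        ceWedge L M n ⁅⁅z, y⁆, w⁆ c + ceWedge L M n ⁅y, ⁅z, w⁆⁆ c := by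
      rw [← LinearMap.add_apply, leibniz_lie z y w]
      congr 1
      refine chains_hom_ext fun v x => ?_
      simp only [LinearMap.add_apply, ceWedge_apply, ← ceSnoc_apply, map_add,
        AlternatingMap.add_apply]
    simp only [LinearMap.comp_apply, LinearMap.add_apply, hw, map_add, hc, hj]
    abel

/-- On chains `c ∧ y`, Cartan's formula replaces `d (c ∧ y)` by the Lie derivative along `y` minus
`(d c) ∧ y`, and the claim follows from the commutation rules for Lie derivatives and from the lower
degree. -/
theorem ceD_ceLie (n : ℕ) (z : L) :
    ceD L M n ∘ₗ ceLie L M (n + 1) z = ceLie L M n z ∘ₗ ceD L M n := by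
  induction n with
  | zero =>
    refine chains_hom_ext_succ fun y => LinearMap.ext fun c => ?_
    have h1 := LinearMap.congr_fun (ceLie_ceWedge (M := M) 0 z y) c
    have h2 := LinearMap.congr_fun (ceLie_lie (M := M) 0 z y) c
    simp only [LinearMap.comp_apply, LinearMap.add_apply] at h1 h2 ⊢
    rw [h1, map_add]
    -- In degree `0` the Lie derivative is `d` after exterior multiplication by definition, so the
    -- relation for Lie derivatives is already the claim.
    exact h2.symm
  | succ n ih =>
    refine chains_hom_ext_succ fun y => LinearMap.ext fun c => ?_
    have h1 := LinearMap.congr_fun (ceLie_ceWedge (M := M) (n + 1) z y) c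
    have h2 := LinearMap.congr_fun (ceLie_lie (M := M) (n + 1) z y) c
    have h3 := LinearMap.congr_fun ih c
    have h4 := LinearMap.congr_fun (ceLie_ceWedge (M := M) n z y) (ceD L M n c)
    have hd : ∀ (u : L) (c : Chains L M (n + 1)), ceD L M (n + 1) (ceWedge L M (n + 1) u c) =
        ceLie L M (n + 1) u c - ceWedge L M n u (ceD L M n c) := by
      intro u c
      rw [eq_sub_iff_add_eq]
      rfl
    simp only [LinearMap.comp_apply, LinearMap.add_apply] at h1 h2 h3 h4 ⊢
    rw [h1, map_add, hd, hd, hd, map_sub, h2, h3, h4]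
    abel

/-- By Cartan's formula `d d (c ∧ y) = d (ℒ_y c) - d ((d c) ∧ y) = d (ℒ_y c) - ℒ_y (d c) + (d d c) ∧
y`. The first two terms cancel because `d` commutes with `ℒ_y`, and the last one vanishes by
induction. -/
theorem ceD_ceD (n : ℕ) : ceD L M n ∘ₗ ceD L M (n + 1) = 0 := by
  induction n with
  | zero =>
    refine chains_hom_ext_succ fun y => LinearMap.ext fun c => ?_
    have hd : ∀ (u : L) (c : Chains L M 1), ceD L M 1 (ceWedge L M 1 u c) =
        ceLie L M 1 u c - ceWedge L M 0 u (ceD L M 0 c) := by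
      intro u c
      rw [eq_sub_iff_add_eq]
      rfl
    have h1 := LinearMap.congr_fun (ceD_ceLie (M := M) 0 y) c
    simp only [LinearMap.comp_apply] at h1 ⊢
    rw [hd, map_sub, h1]
    exact sub_self _
  | succ n ih =>
    refine chains_hom_ext_succ fun y => LinearMap.ext fun c => ?_
    have hd : ∀ (k : ℕ) (u : L) (c : Chains L M (k + 1)),
        ceD L M (k + 1) (ceWedge L M (k + 1) u c) =
        ceLie L M (k + 1) u c - ceWedge L M k u (ceD L M k c) := by
      intro k u c
      rw [eq_sub_iff_add_eq]
      rfl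
    have h1 := LinearMap.congr_fun (ceD_ceLie (M := M) (n + 1) y) c
    have h2 := LinearMap.congr_fun ih c
    simp only [LinearMap.comp_apply, LinearMap.zero_apply] at h1 h2 ⊢
    rw [hd, map_sub, h1, hd, h2, map_zero]
    abel

end ChevalleyEilenbergSquare

end

section

/-! ### Powers of a root of unity with exponents modulo `T` -/

section Roots

variable {T : ℕ} [NeZero T] {ω : ℂ}

theorem pow_val_add (hω : ω ^ T = 1) (a b : ZMod T) :
    ω ^ (a + b).val = ω ^ a.val * ω ^ b.val := by
  rw [ZMod.val_add, ← pow_add, ← pow_mod_eq hω]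
where
  pow_mod_eq {n : ℕ} (hω : ω ^ T = 1) : ω ^ n = ω ^ (n % T) := by
    conv_lhs => rw [← Nat.mod_add_div n T, pow_add, pow_mul, hω, one_pow, mul_one]

omit [NeZero T] in
theorem pow_val_zero : ω ^ (0 : ZMod T).val = 1 := by simp

theorem pow_val_neg_mul (hω : ω ^ T = 1) (a : ZMod T) : ω ^ (-a).val * ω ^ a.val = 1 := by
  rw [← pow_val_add hω, neg_add_cancel, pow_val_zero]

theorem pow_val_ne_zero (hω : ω ^ T = 1) (a : ZMod T) : ω ^ a.val ≠ 0 :=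
  right_ne_zero_of_mul_eq_one (pow_val_neg_mul hω a)

theorem pow_val_inj (hω : IsPrimitiveRoot ω T) {a b : ZMod T} (h : ω ^ a.val = ω ^ b.val) :
    a = b :=
  ZMod.val_injective T (hω.pow_inj (ZMod.val_lt a) (ZMod.val_lt b) h)

end Roots

variable {T m N : ℕ}

/-! ### Letters of a monomial -/

theorem Comm.weight_eq_count (g : Comm T m) (i : Fin m) :
    g.weight i = (g.content.map Prod.snd).count i := by
  induction g with
  | gen k j =>
    by_cases h : j = i
    · subst h; simp [Comm.weight, Comm.content]
    · simp [Comm.weight, Comm.content, h, Ne.symm h]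
  | br g h ihg ihh => simp [Comm.weight, Comm.content, ihg, ihh]

theorem Comm.content_ne_nil (g : Comm T m) : g.content ≠ [] := by
  induction g with
  | gen k j => simp [Comm.content]
  | br g h ihg ihh => simp [Comm.content, ihg]

theorem Comm.exists_mem_content (g : Comm T m) : ∃ a, a ∈ g.content :=
  List.exists_mem_of_ne_nil _ g.content_ne_nil

theorem Comm.content_shift (j : ZMod T) (g : Comm T m) :
    (g.shift j).content = g.content.map fun a => (a.1 + j, a.2) := by
  induction g with
  | gen k i => rfl
  | br g h ihg ihh => simp [Comm.shift, Comm.content, ihg, ihh]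

namespace Mono

variable {p : ℕ}

/-- The list of letters of a monomial at a wedge factor, at the origin (`none`) or at a point. -/
def letters (x : Mono T m N p) : Fin p ⊕ Option (Fin N) → List (ZMod T × Fin m)
  | .inl a => (x.wedge a).content
  | .inr none => x.zero.flatMap Comm.content
  | .inr (some j) => (x.point j).flatMap Comm.content

theorem weight_list_eq_count (l : List (Comm T m)) (i : Fin m) :
    (l.map Comm.weight).sum i = ((l.flatMap Comm.content).map Prod.snd).count i := by
  induction l with
  | nil => simp
  | cons g l ih => simp [ih, Comm.weight_eq_count]

theorem weight_eq_sum (x : Mono T m N p) (i : Fin m) :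
    x.weight i = ∑ s, ((x.letters s).map Prod.snd).count i := by
  rw [Fintype.sum_sum_type, Fintype.sum_option]
  simp only [weight, Pi.add_apply, Finset.sum_apply, Comm.weight_eq_count, weight_list_eq_count,
    letters, add_assoc]

theorem label_unique {l : List (ZMod T × Fin m)} {i : Fin m} {k k' : ZMod T}
    (h : (l.map Prod.snd).count i ≤ 1) (hk : (k, i) ∈ l) (hk' : (k', i) ∈ l) : k = k' := by
  induction l with
  | nil => simp at hk
  | cons a l ih =>
    rw [List.map_cons, List.count_cons] at h
    have hpos : ∀ {c}, (c, i) ∈ l → 0 < (l.map Prod.snd).count i := fun hc =>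
      List.count_pos_iff.2 (List.mem_map.2 ⟨_, hc, rfl⟩)
    rcases List.mem_cons.1 hk with e | hk1 <;> rcases List.mem_cons.1 hk' with e' | hk2
    · exact congrArg Prod.fst (e.trans e'.symm)
    · have := hpos hk2
      simp [← e] at h; omega
    · have := hpos hk1
      simp [← e'] at h; omega
    · exact ih (by omega) hk1 hk2

/-- Since every index occurs exactly once, the letters amount to two functions of the coordinate:
its slot, i.e. the island, the origin or the point where it sits, and its label. -/
theorem exists_config (x : Mono T m N p) (hx : x.weight = 1) :
    ∃ (sl : Fin m → Fin p ⊕ Option (Fin N)) (lab : Fin m → ZMod T),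
      ∀ s k i, (k, i) ∈ x.letters s ↔ sl i = s ∧ lab i = k := by
  have h1 : ∀ i, ∑ s, ((x.letters s).map Prod.snd).count i = 1 := fun i => by
    rw [← weight_eq_sum, hx]; rfl
  have h2 : ∀ i, ∃ s k, (k, i) ∈ x.letters s := by
    intro i
    by_contra! h
    have : ∑ s, ((x.letters s).map Prod.snd).count i = 0 := by
      refine Finset.sum_eq_zero fun s _ => List.count_eq_zero.2 fun hm => ?_
      obtain ⟨⟨k, j⟩, hb, rfl⟩ := List.mem_map.1 hm
      exact h s k hb
    rw [h1] at this
    exact one_ne_zero this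
  choose sl lab hsl using h2
  have hc : ∀ s i, ((x.letters s).map Prod.snd).count i ≤ 1 := fun s i =>
    (Finset.single_le_sum (f := fun s => ((x.letters s).map Prod.snd).count i)
      (fun _ _ => Nat.zero_le _) (Finset.mem_univ s)).trans (h1 i).le
  have hp : ∀ {s k i}, (k, i) ∈ x.letters s → 0 < ((x.letters s).map Prod.snd).count i :=
    fun h => List.count_pos_iff.2 (List.mem_map.2 ⟨_, h, rfl⟩)
  refine ⟨sl, lab, fun s k i => ⟨fun h => ?_, ?_⟩⟩
  · have hs : sl i = s := by
      by_contra hne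
      have := Finset.sum_le_sum_of_subset (f := fun s => ((x.letters s).map Prod.snd).count i)
        (Finset.subset_univ {sl i, s})
      rw [Finset.sum_pair hne, h1] at this
      have := hp h
      have := hp (hsl i)
      omega
    subst hs
    exact ⟨rfl, label_unique (hc _ _) (hsl i) h⟩
  · rintro ⟨rfl, rfl⟩
    exact hsl i

variable (ω : ℂ) (z : Fin N → ℂ)

/-- The edge of a monomial, the intersection of its islands. -/
def edge (x : Mono T m N p) : AffineSubspace ℂ (Fin m → ℂ) :=
  (⨅ a, swimIsland ω (x.wedge a)) ⊓ ((⨅ g : {g // g ∈ x.zero}, zeroIsland g.1) ⊓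
    ⨅ j, ⨅ g : {g // g ∈ x.point j}, fixedIsland ω (z j) g.1)

variable {ω z}

theorem mem_edge {x : Mono T m N p} {t : Fin m → ℂ} :
    t ∈ x.edge ω z ↔ (∀ a, t ∈ swimIsland ω (x.wedge a)) ∧ (∀ g ∈ x.zero, t ∈ zeroIsland g) ∧
      ∀ j, ∀ g ∈ x.point j, t ∈ fixedIsland ω (z j) g := by
  simp only [edge, AffineSubspace.mem_inf_iff, AffineSubspace.mem_iInf_iff, Subtype.forall]

theorem edge_actPoint (x : Mono T m N (p + 1)) (j : Fin N) :
    (x.actPoint j).edge ω z = x.edge ω z ⊓ fixedIsland ω (z j) (x.wedge (Fin.last p)) := by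
  ext t
  rw [AffineSubspace.mem_inf_iff, mem_edge, mem_edge, Fin.forall_fin_succ' (n := p)]
  have h1 : (∀ i, ∀ g ∈ (x.actPoint j).point i, t ∈ fixedIsland ω (z i) g) ↔
      t ∈ fixedIsland ω (z j) (x.wedge (Fin.last p)) ∧
      ∀ i, ∀ g ∈ x.point i, t ∈ fixedIsland ω (z i) g := by
    constructor
    · intro h
      have hj := h j
      simp only [actPoint, Function.update_self, List.mem_cons, forall_eq_or_imp] at hj
      refine ⟨hj.1, fun i => ?_⟩
      by_cases hi : i = j
      · subst hi; exact hj.2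
      · have := h i
        simpa only [actPoint, Function.update_of_ne hi] using this
    · rintro ⟨h, h'⟩ i
      by_cases hi : i = j
      · subst hi
        simp only [actPoint, Function.update_self, List.mem_cons, forall_eq_or_imp]
        exact ⟨h, h' i⟩
      · simpa only [actPoint, Function.update_of_ne hi] using h' i
  have h2 : t ∈ fixedIsland ω (z j) (x.wedge (Fin.last p)) →
      t ∈ swimIsland ω (x.wedge (Fin.last p)) := fun h a ha b hb => (h a ha).trans (h b hb).symm
  rw [h1]
  simp only [actPoint]
  tauto

theorem edge_actZero (x : Mono T m N (p + 1)) :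
    x.actZero.edge ω z = x.edge ω z ⊓ zeroIsland (x.wedge (Fin.last p)) := by
  ext t
  rw [AffineSubspace.mem_inf_iff, mem_edge, mem_edge, Fin.forall_fin_succ' (n := p)]
  have h2 : t ∈ zeroIsland (x.wedge (Fin.last p)) →
      t ∈ swimIsland ω (x.wedge (Fin.last p)) := fun h a ha b hb => by
    rw [h a ha, h b hb, mul_zero, mul_zero]
  simp only [actZero, List.mem_cons, forall_eq_or_imp]
  tauto

theorem mem_swimIsland_br {g h : Comm T m} {t : Fin m → ℂ}
    (ht : t ∈ swimIsland ω (Comm.br g h)) : t ∈ swimIsland ω g ∧ t ∈ swimIsland ω h :=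
  ⟨fun a ha b hb => ht a (List.mem_append_left _ ha) b (List.mem_append_left _ hb),
    fun a ha b hb => ht a (List.mem_append_right _ ha) b (List.mem_append_right _ hb)⟩

theorem edge_join (x : Mono T m N (p + 2)) :
    x.join.edge ω z = x.edge ω z ⊓ swimIsland ω x.lastBracket := by
  ext t
  rw [AffineSubspace.mem_inf_iff, mem_edge, mem_edge, Fin.forall_fin_succ' (n := p),
    Fin.forall_fin_succ' (n := p + 1), Fin.forall_fin_succ' (n := p)]
  have h2 : t ∈ swimIsland ω x.lastBracket → _ := fun h => mem_swimIsland_br h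
  simp only [join, Fin.snoc_castSucc, Fin.snoc_last]
  tauto

variable [NeZero T]

/-- The value at a slot, when the value at the swimming islands is given. -/
def slotValue (z : Fin N → ℂ) (s : Fin p → ℂ) : Fin p ⊕ Option (Fin N) → ℂ :=
  Sum.elim s fun o => o.elim 0 z

/-- The edge is parametrized by the values at the swimming islands: `0` at the origin and `z j` at
the points are prescribed, and each coordinate is the value at its slot divided by a power of `ω`.
-/
theorem mem_edge_iff (hω : ω ^ T = 1) {x : Mono T m N p} {sl : Fin m → Fin p ⊕ Option (Fin N)}
    {lab : Fin m → ZMod T} (hc : ∀ s k i, (k, i) ∈ x.letters s ↔ sl i = s ∧ lab i = k)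
    {t : Fin m → ℂ} :
    t ∈ x.edge ω z ↔ ∃ s, ∀ i, ω ^ (lab i).val * t i = slotValue z s (sl i) := by
  rw [mem_edge]
  constructor
  · rintro ⟨h1, h2, h3⟩
    choose b hb using fun a => (x.wedge a).exists_mem_content
    refine ⟨fun a => ω ^ (b a).1.val * t (b a).2, fun i => ?_⟩
    have hi := (hc (sl i) (lab i) i).2 ⟨rfl, rfl⟩
    rcases hs : sl i with a | _ | j
    · rw [hs] at hi
      exact h1 a _ hi _ (hb a)
    · rw [hs] at hi
      obtain ⟨g, hg, hi⟩ := List.mem_flatMap.1 hi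
      have := h2 g hg _ hi
      dsimp only at this
      rw [this, mul_zero]; rfl
    · rw [hs] at hi
      obtain ⟨g, hg, hi⟩ := List.mem_flatMap.1 hi
      exact h3 j g hg _ hi
  · rintro ⟨s, h⟩
    have key : ∀ u k i, (k, i) ∈ x.letters u → ω ^ k.val * t i = slotValue z s u := by
      intro u k i hu
      obtain ⟨rfl, rfl⟩ := (hc u k i).1 hu
      exact h i
    refine ⟨fun a b hb c hc => ?_, fun g hg a ha => ?_, fun j g hg a ha => ?_⟩
    · rw [key (.inl a) _ _ hb, key (.inl a) _ _ hc]
    · have := key (.inr none) _ _ (List.mem_flatMap.2 ⟨g, hg, ha⟩)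
      exact (mul_eq_zero.1 this).resolve_left (pow_val_ne_zero hω _)
    · exact key (.inr (some j)) _ _ (List.mem_flatMap.2 ⟨g, hg, ha⟩)

/-- Every choice of values at the swimming islands is realized by a point of the edge. -/
theorem exists_mem_edge (hω : ω ^ T = 1) (x : Mono T m N p) (hx : x.weight = 1) (s : Fin p → ℂ) :
    ∃ t ∈ x.edge ω z, ∀ a, ∀ b ∈ (x.wedge a).content, ω ^ b.1.val * t b.2 = s a := by
  obtain ⟨sl, lab, hc⟩ := x.exists_config hx
  have h : ∀ i, ω ^ (lab i).val * (ω ^ (-lab i).val * slotValue z s (sl i)) =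
      slotValue z s (sl i) := fun i => by
    rw [← mul_assoc, mul_comm (ω ^ (lab i).val), pow_val_neg_mul hω, one_mul]
  refine ⟨fun i => ω ^ (-lab i).val * slotValue z s (sl i), (mem_edge_iff hω hc).2 ⟨s, h⟩, ?_⟩
  rintro a ⟨k, i⟩ hb
  obtain ⟨h1, rfl⟩ := (hc (.inl a) k i).1 hb
  have := h i
  rw [h1] at this
  dsimp only
  rw [h1]
  exact this

theorem finrank_edge (hω : ω ^ T = 1) (x : Mono T m N p) (hx : x.weight = 1) :
    Module.finrank ℂ (x.edge ω z).direction = p := by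
  obtain ⟨sl, lab, hc⟩ := x.exists_config hx
  -- The linear part of this parametrization by island values. It is injective because every
  -- commutator contains a letter, so every island value can be read off from some coordinate.
  let A : (Fin p → ℂ) →ₗ[ℂ] (Fin m → ℂ) := LinearMap.pi fun i =>
    ω ^ (-lab i).val • (Sum.elim (fun a => LinearMap.proj a) (fun _ => 0) (sl i))
  have hA : ∀ s i, ω ^ (lab i).val * A s i = Sum.elim s (fun _ => 0) (sl i) := by
    intro s i
    have : A s i = ω ^ (-lab i).val * Sum.elim s (fun _ => 0) (sl i) := by
      simp only [A, LinearMap.pi_apply, LinearMap.smul_apply, smul_eq_mul]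
      rcases sl i with a | o <;> rfl
    rw [this, ← mul_assoc, mul_comm (ω ^ (lab i).val), pow_val_neg_mul hω, one_mul]
  obtain ⟨t₀, ht₀, -⟩ := x.exists_mem_edge (z := z) hω hx 0
  have hinj : Function.Injective A := by
    rw [← LinearMap.ker_eq_bot, LinearMap.ker_eq_bot']
    intro s hs
    funext a
    obtain ⟨⟨k, i⟩, hb⟩ := (x.wedge a).exists_mem_content
    obtain ⟨h1, rfl⟩ := (hc (.inl a) k i).1 hb
    have := hA s i
    rw [hs, h1] at this
    simpa using this.symm
  have hd : x.edge ω z = AffineSubspace.mk' t₀ (LinearMap.range A) := by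
    obtain ⟨s₀, hs₀⟩ := (mem_edge_iff hω hc).1 ht₀
    ext t
    rw [AffineSubspace.mem_mk', mem_edge_iff hω hc, vsub_eq_sub]
    constructor
    · rintro ⟨s, hs⟩
      refine ⟨s - s₀, ?_⟩
      funext i
      apply mul_left_cancel₀ (pow_val_ne_zero hω (lab i))
      rw [hA, Pi.sub_apply, mul_sub, hs, hs₀]
      rcases sl i with a | o <;> simp [slotValue]
    · rintro ⟨s, hs⟩
      refine ⟨s + s₀, fun i => ?_⟩
      have : t i = A s i + t₀ i := by rw [hs]; simp
      rw [this, mul_add, hA, hs₀]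
      rcases sl i with a | o <;> simp [slotValue]
  rw [hd, AffineSubspace.direction_mk', LinearMap.finrank_range_of_inj hinj,
    Module.finrank_fin_fun]

end Mono

theorem isEdge_of_forall {V : Type*} [AddCommGroup V] [Module ℂ V]
    {𝒜 : Set (AffineSubspace ℂ V)} {L : AffineSubspace ℂ V} (hL : (L : Set V).Nonempty)
    (h : ∀ t, (∀ H ∈ 𝒜, L ≤ H → t ∈ H) → t ∈ L) : IsEdge 𝒜 L := by
  refine ⟨hL, {H ∈ 𝒜 | L ≤ H}, fun H hH => hH.1, le_antisymm (le_sInf fun H hH => hH.2) ?_⟩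
  intro t ht
  exact h t fun H hH hL => (AffineSubspace.mem_sInf_iff _ _).1 ht H ⟨hH, hL⟩

section

variable [NeZero T] {ω : ℂ} {z : Fin N → ℂ}

/-- A relation between two letters which holds on `L` holds at every point of the intersection
of the hyperplanes which contain `L`. -/
theorem letter_rel_of_forall (hω : IsPrimitiveRoot ω T) {L : AffineSubspace ℂ (Fin m → ℂ)}
    {u : Fin m → ℂ} (hu : ∀ H ∈ cda T m ω z, L ≤ H → u ∈ H) {k l : ZMod T} {i j : Fin m}
    (h : ∀ t ∈ L, ω ^ k.val * t i = ω ^ l.val * t j) : ω ^ k.val * u i = ω ^ l.val * u j := by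
  have hω1 := hω.pow_eq_one
  have hiff : ∀ (k l : ZMod T) (x y : ℂ),
      ω ^ k.val * x = ω ^ l.val * y ↔ x = ω ^ (-k + l).val * y := by
    intro k l x y
    rw [pow_val_add hω1, mul_assoc]
    constructor
    · intro e
      rw [← e, ← mul_assoc, pow_val_neg_mul hω1, one_mul]
    · intro e
      rw [e, ← mul_assoc, mul_comm (ω ^ k.val), pow_val_neg_mul hω1, one_mul]
  rcases lt_trichotomy i j with hij | rfl | hij
  · rw [hiff]
    exact hu (hypDiag ω i j (-k + l)) (Or.inl (Or.inl ⟨i, j, _, hij, rfl⟩))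
      fun t ht => (hiff _ _ _ _).1 (h t ht)
  -- Two different labels of the same coordinate force `t i = 0`, as distinct residues give distinct
  -- powers of a primitive root; this is again the equation of a hyperplane of the arrangement.
  · by_cases hkl : k = l
    · rw [hkl]
    · have : u i = 0 := by
        refine hu (hypPoint 0 i) (Or.inr ⟨i, rfl⟩) fun t ht => ?_
        have := h t ht
        rw [← sub_eq_zero, ← sub_mul] at this
        exact (mul_eq_zero.1 this).resolve_left
          (sub_ne_zero.2 fun e => hkl (pow_val_inj hω e))
      rw [this, mul_zero, mul_zero]
  · symm
    rw [hiff]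
    exact hu (hypDiag ω j i (-l + k)) (Or.inl (Or.inl ⟨j, i, _, hij, rfl⟩))
      fun t ht => (hiff _ _ _ _).1 (h t ht).symm

theorem Mono.isEdge_edge {p : ℕ} (hω : IsPrimitiveRoot ω T) (x : Mono T m N p)
    (hx : x.weight = 1) : IsEdge (cda T m ω z) (x.edge ω z) := by
  have hω1 := hω.pow_eq_one
  obtain ⟨t₀, ht₀, -⟩ := x.exists_mem_edge (z := z) hω1 hx 0
  refine isEdge_of_forall ⟨t₀, ht₀⟩ fun u hu => ?_
  rw [mem_edge]
  refine ⟨fun a b hb c hc => ?_, fun g hg a ha => ?_, fun j g hg a ha => ?_⟩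
  · exact letter_rel_of_forall hω hu fun t ht => (mem_edge.1 ht).1 a b hb c hc
  · exact hu (hypPoint 0 a.2) (Or.inr ⟨_, rfl⟩) fun t ht => (mem_edge.1 ht).2.1 g hg a ha
  · have hiff : ∀ y : ℂ, ω ^ a.1.val * y = z j ↔ y = ω ^ (-a.1).val * z j := by
      intro y
      constructor
      · intro e
        rw [← e, ← mul_assoc, pow_val_neg_mul hω1, one_mul]
      · intro e
        rw [e, ← mul_assoc, mul_comm (ω ^ a.1.val), pow_val_neg_mul hω1, one_mul]
    rw [hiff]
    exact hu (hypPoint (ω ^ (-a.1).val * z j) a.2) (Or.inl (Or.inr ⟨_, _, _, rfl⟩))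
      fun t ht => (hiff _).1 ((mem_edge.1 ht).2.2 j g hg a ha)

end

end

section

variable {T m N : ℕ}

/-! ### Projections onto the monomials whose edge contains a given subspace -/

open scoped Classical in
/-- The endomorphism of `𝔞` which kills the generators outside of `S`. -/
def kill (S : Set (ZMod T × Fin m)) : FreeLie T m →ₗ⁅ℂ⁆ FreeLie T m :=
  FreeLieAlgebra.lift ℂ fun a => if a ∈ S then FreeLieAlgebra.of ℂ a else 0

open scoped Classical in
theorem kill_eval (S : Set (ZMod T × Fin m)) (g : Comm T m) :
    kill S g.eval = if ∀ a ∈ g.content, a ∈ S then g.eval else 0 := by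
  induction g with
  | gen k i => simp [kill, Comm.eval, Comm.content]
  | br g h ihg ihh =>
    simp only [Comm.eval, LieHom.map_lie, ihg, ihh, Comm.content, List.forall_mem_append]
    by_cases h1 : ∀ a ∈ g.content, a ∈ S
    · by_cases h2 : ∀ a ∈ h.content, a ∈ S
      · rw [if_pos h1, if_pos h2, if_pos ⟨h1, h2⟩]
      · rw [if_neg h2, lie_zero, if_neg fun h => h2 h.2]
    · rw [if_neg h1, zero_lie, if_neg fun h => h1 h.1]

/-- Two letters are equivalent if the coordinates which they stand for agree on `L`. -/
def letterSetoid (T : ℕ) (ω : ℂ) (L : AffineSubspace ℂ (Fin m → ℂ)) : Setoid (ZMod T × Fin m) where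
  r a b := ∀ t ∈ L, ω ^ a.1.val * t a.2 = ω ^ b.1.val * t b.2
  iseqv := ⟨fun _ _ _ => rfl, fun h t ht => (h t ht).symm, fun h h' t ht => (h t ht).trans (h' t ht)⟩

variable [NeZero T]

instance finite_letterQuotient (ω : ℂ) (L : AffineSubspace ℂ (Fin m → ℂ)) :
    Fintype (Quotient (letterSetoid T ω L)) := Fintype.ofFinite _

variable (T) in
/-- The projection of `𝔞` onto the commutators in equivalent letters. -/
def classProj (ω : ℂ) (L : AffineSubspace ℂ (Fin m → ℂ)) : FreeLie T m →ₗ[ℂ] FreeLie T m :=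
  ∑ c : Quotient (letterSetoid T ω L),
    (kill {a | (Quotient.mk (letterSetoid T ω L) a) = c} : FreeLie T m →ₗ[ℂ] FreeLie T m)

open scoped Classical in
-- If all letters of a commutator are equivalent, it is fixed by the summand of their class and
-- killed by every other one. Otherwise every summand kills it.
theorem classProj_eval (ω : ℂ) (L : AffineSubspace ℂ (Fin m → ℂ)) (g : Comm T m) :
    classProj T ω L g.eval = if L ≤ swimIsland ω g then g.eval else 0 := by
  have hle : L ≤ swimIsland ω g ↔
      ∀ a ∈ g.content, ∀ b ∈ g.content, letterSetoid T ω L a b :=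
    ⟨fun h a ha b hb t ht => h ht a ha b hb, fun h t ht a ha b hb => h a ha b hb t ht⟩
  simp only [classProj, LinearMap.sum_apply, LieHom.coe_toLinearMap, kill_eval, Set.mem_ofPred_eq]
  obtain ⟨a₀, ha₀⟩ := g.exists_mem_content
  rw [Finset.sum_eq_single (Quotient.mk _ a₀)]
  · by_cases h : L ≤ swimIsland ω g
    · rw [if_pos h, if_pos fun a ha => Quotient.sound (hle.1 h a ha a₀ ha₀)]
    · rw [if_neg h, if_neg fun h' => h (hle.2 fun a ha b hb =>
        Quotient.exact ((h' a ha).trans (h' b hb).symm))]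
  · intro c _ hc
    exact if_neg fun h => hc (h a₀ ha₀).symm
  · exact fun h => absurd (Finset.mem_univ _) h

theorem bar_shift (j : ZMod T) (x : FreeLie T m) : bar T m (shift T m j x) = bar T m x := by
  apply Subtype.ext
  rw [coe_bar, coe_bar]
  simp only [shift_shift]
  exact Fintype.sum_equiv (Equiv.addRight j) _ _ fun k => rfl

theorem bar_eval_shift (j : ZMod T) (g : Comm T m) :
    bar T m (g.shift j).eval = bar T m g.eval := by
  rw [Comm.eval_shift, bar_shift]

theorem mem_swimIsland_shift {ω : ℂ} (hω : ω ^ T = 1) (j : ZMod T) (g : Comm T m)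
    (t : Fin m → ℂ) : t ∈ swimIsland ω (g.shift j) ↔ t ∈ swimIsland ω g := by
  change (∀ a ∈ (g.shift j).content, ∀ b ∈ (g.shift j).content, _) ↔
    ∀ a ∈ g.content, ∀ b ∈ g.content, _
  simp only [Comm.content_shift, List.forall_mem_map, pow_val_add hω]
  refine forall₄_congr fun a ha b hb => ?_
  rw [mul_comm (ω ^ a.1.val), mul_comm (ω ^ b.1.val), mul_assoc, mul_assoc]
  exact mul_right_inj' (pow_val_ne_zero hω j)

variable (T) in
/-- The projection of `𝔫̄` induced by `classProj`. -/
def wedgeProj (ω : ℂ) (L : AffineSubspace ℂ (Fin m → ℂ)) : nbar T m →ₗ[ℂ] nbar T m :=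
  (T : ℂ)⁻¹ • (bar T m ∘ₗ classProj T ω L ∘ₗ (nbar T m).toSubmodule.subtype)

open scoped Classical in
-- The projection of `𝔞` treats all translates of a commutator alike, since multiplying an island by
-- a power of `ω` does not change its equations. Applying `bar` to a sum of `T` translates counts
-- each `T` times, hence the factor `T⁻¹`.
theorem wedgeProj_bar {ω : ℂ} (hω : ω ^ T = 1) (L : AffineSubspace ℂ (Fin m → ℂ)) (g : Comm T m) :
    wedgeProj T ω L (bar T m g.eval) = if L ≤ swimIsland ω g then bar T m g.eval else 0 := by
  have hT : (T : ℂ) ≠ 0 := Nat.cast_ne_zero.2 (NeZero.ne T)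
  have hle : ∀ j, L ≤ swimIsland ω (g.shift j) ↔ L ≤ swimIsland ω g := fun j =>
    ⟨fun h t ht => (mem_swimIsland_shift hω j g t).1 (h ht),
      fun h t ht => (mem_swimIsland_shift hω j g t).2 (h ht)⟩
  have e : (nbar T m).toSubmodule.subtype (bar T m g.eval) = ∑ j : ZMod T, (g.shift j).eval := by
    simp only [Comm.eval_shift]
    exact coe_bar _
  rw [wedgeProj, LinearMap.smul_apply, LinearMap.comp_apply, LinearMap.comp_apply, e]
  simp only [map_sum, classProj_eval, hle]
  split_ifs
  · simp only [bar_eval_shift, Finset.sum_const, Finset.card_univ, ZMod.card]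
    rw [← Nat.cast_smul_eq_nsmul ℂ, smul_smul, inv_mul_cancel₀ hT, one_smul]
  · simp

/-- The endomorphism of `𝔫̄` which kills the generators with index outside of `I`. -/
def killBar (I : Set (Fin m)) : nbar T m →ₗ⁅ℂ⁆ nbar T m where
  toFun x := ⟨kill {a | a.2 ∈ I} x, by
    have : (shift T m 1).comp (kill {a | a.2 ∈ I}) = (kill {a | a.2 ∈ I}).comp (shift T m 1) := by
      refine FreeLieAlgebra.hom_ext fun a => ?_
      by_cases h : a.2 ∈ I <;> simp [kill, h]
    have h2 := congrArg (fun f : FreeLie T m →ₗ⁅ℂ⁆ FreeLie T m => f x) this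
    change shift T m 1 _ = _
    refine h2.trans ?_
    exact congrArg (kill {a | a.2 ∈ I}) x.2⟩
  map_add' x y := Subtype.ext (map_add (kill {a | a.2 ∈ I}) _ _)
  map_smul' c x := Subtype.ext (map_smul (kill {a | a.2 ∈ I}) _ _)
  map_lie' {x y} := Subtype.ext (LieHom.map_lie (kill {a | a.2 ∈ I}) _ _)

open scoped Classical in
theorem killBar_bar (I : Set (Fin m)) (g : Comm T m) :
    killBar I (bar T m g.eval) = if ∀ a ∈ g.content, a.2 ∈ I then bar T m g.eval else 0 := by
  apply Subtype.ext
  change kill {a | a.2 ∈ I} (bar T m g.eval : FreeLie T m) = _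
  have : ∀ j : ZMod T, (∀ a ∈ (g.shift j).content, a.2 ∈ I) ↔ ∀ a ∈ g.content, a.2 ∈ I := by
    intro j
    simp only [Comm.content_shift, List.forall_mem_map]
  simp only [coe_bar, map_sum, ← Comm.eval_shift, kill_eval, Set.mem_ofPred_eq, this]
  split_ifs
  · simp only [coe_bar, ← Comm.eval_shift]
  · simp

section Enveloping

attribute [local instance] LieRing.ofAssociativeRing

variable {L L' : Type*} [LieRing L] [LieAlgebra ℂ L] [LieRing L'] [LieAlgebra ℂ L']

/-- The homomorphism of enveloping algebras induced by a homomorphism of Lie algebras. -/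
def envMap (f : L →ₗ⁅ℂ⁆ L') :
    UniversalEnvelopingAlgebra ℂ L →ₐ[ℂ] UniversalEnvelopingAlgebra ℂ L' :=
  UniversalEnvelopingAlgebra.lift ℂ ((UniversalEnvelopingAlgebra.ι ℂ).comp f)

theorem envMap_ι (f : L →ₗ⁅ℂ⁆ L') (x : L) :
    envMap f (UniversalEnvelopingAlgebra.ι ℂ x) = UniversalEnvelopingAlgebra.ι ℂ (f x) := by
  simp [envMap]

theorem envMap_prod_of_forall {α : Type*} (f : L →ₗ⁅ℂ⁆ L) (e : α → L) (l : List α)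
    (h : ∀ g ∈ l, f (e g) = e g) :
    envMap f (l.map fun g => UniversalEnvelopingAlgebra.ι ℂ (e g)).prod =
      (l.map fun g => UniversalEnvelopingAlgebra.ι ℂ (e g)).prod := by
  rw [map_list_prod, List.map_map]
  congr 1
  refine List.map_congr_left fun g hg => ?_
  rw [Function.comp_apply, envMap_ι, h g hg]

theorem envMap_prod_eq_zero {α : Type*} (f : L →ₗ⁅ℂ⁆ L) (e : α → L) (l : List α)
    {g : α} (hg : g ∈ l) (h : f (e g) = 0) :
    envMap f (l.map fun g => UniversalEnvelopingAlgebra.ι ℂ (e g)).prod = 0 := by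
  rw [map_list_prod, List.map_map]
  induction l with
  | nil => simp at hg
  | cons a l ih =>
    rw [List.map_cons, List.prod_cons]
    rcases List.mem_cons.1 hg with rfl | hg
    · rw [Function.comp_apply, envMap_ι, h, map_zero, zero_mul]
    · rw [ih hg, mul_zero]

end Enveloping

variable (T) in
/-- The projection of chains onto the monomials whose edge contains `L`. -/
def edgeProj (ω : ℂ) (z : Fin N → ℂ) (p : ℕ) (L : AffineSubspace ℂ (Fin m → ℂ)) :
    Chains (nbar T m) (ModM T m N) p →ₗ[ℂ] Chains (nbar T m) (ModM T m N) p :=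
  TensorProduct.map (exteriorPower.map p (wedgeProj T ω L))
    (TensorProduct.map (envMap (killBar {i | ∀ t ∈ L, t i = 0})).toLinearMap
      (PiTensorProduct.map fun j =>
        (envMap (kill {a | ∀ t ∈ L, ω ^ a.1.val * t a.2 = z j})).toLinearMap))

open scoped Classical in
-- Whether an edge contains `L` is decided factor by factor: on a wedge factor by equality of its
-- letters along `L`, at the origin by their vanishing on `L`, at the point `j` by the value `z j`
-- on `L`. Therefore a tensor product of linear maps and algebra homomorphisms tests all the
-- conditions at once, and it is well defined although monomials satisfy linear relations.
theorem edgeProj_eval {ω : ℂ} (hω : ω ^ T = 1) (z : Fin N → ℂ) {p : ℕ}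
    (L : AffineSubspace ℂ (Fin m → ℂ)) (x : Mono T m N p) :
    edgeProj T ω z p L x.eval = if L ≤ x.edge ω z then x.eval else 0 := by
  have hle : L ≤ x.edge ω z ↔ (∀ a, L ≤ swimIsland ω (x.wedge a)) ∧
      (∀ g ∈ x.zero, ∀ a ∈ g.content, a.2 ∈ {i | ∀ t ∈ L, t i = 0}) ∧
      ∀ j, ∀ g ∈ x.point j, ∀ a ∈ g.content, a ∈
        {a : ZMod T × Fin m | ∀ t ∈ L, ω ^ a.1.val * t a.2 = z j} := by
    constructor
    · intro h
      exact ⟨fun a t ht => (Mono.mem_edge.1 (h ht)).1 a,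
        fun g hg a ha t ht => (Mono.mem_edge.1 (h ht)).2.1 g hg a ha,
        fun j g hg a ha t ht => (Mono.mem_edge.1 (h ht)).2.2 j g hg a ha⟩
    · rintro ⟨h1, h2, h3⟩ t ht
      exact Mono.mem_edge.2 ⟨fun a => h1 a ht, fun g hg a ha => h2 g hg a ha t ht,
        fun j g hg a ha => h3 j g hg a ha t ht⟩
  rw [edgeProj, Mono.eval, TensorProduct.map_tmul, TensorProduct.map_tmul,
    exteriorPower.map_apply_ιMulti, PiTensorProduct.map_tprod]
  simp only [AlgHom.toLinearMap_apply]
  by_cases h1 : ∀ a, L ≤ swimIsland ω (x.wedge a)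
  · have e1 : (wedgeProj T ω L ∘ fun a => bar T m (x.wedge a).eval) =
        fun a => bar T m (x.wedge a).eval := by
      funext a
      rw [Function.comp_apply, wedgeProj_bar hω, if_pos (h1 a)]
    rw [e1]
    by_cases h2 : ∀ g ∈ x.zero, ∀ a ∈ g.content, a.2 ∈ {i | ∀ t ∈ L, t i = 0}
    · rw [envMap_prod_of_forall _ _ _ fun g hg => (killBar_bar _ g).trans (if_pos (h2 g hg))]
      by_cases h3 : ∀ j, ∀ g ∈ x.point j, ∀ a ∈ g.content, a ∈
        {a : ZMod T × Fin m | ∀ t ∈ L, ω ^ a.1.val * t a.2 = z j}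
      · rw [if_pos (hle.2 ⟨h1, h2, h3⟩)]
        congr 3
        funext j
        exact envMap_prod_of_forall _ _ _ fun g hg => (kill_eval _ g).trans (if_pos (h3 j g hg))
      · rw [if_neg fun h => h3 (hle.1 h).2.2]
        push Not at h3
        obtain ⟨j, g, hg, a, ha, h3⟩ := h3
        rw [(PiTensorProduct.tprod ℂ).map_coord_zero j (envMap_prod_eq_zero _ _ _ hg
          ((kill_eval _ g).trans (if_neg fun h => h3 (h a ha)))),
          TensorProduct.tmul_zero, TensorProduct.tmul_zero]
    · rw [if_neg fun h => h2 (hle.1 h).2.1]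
      push Not at h2
      obtain ⟨g, hg, a, ha, h2⟩ := h2
      rw [envMap_prod_eq_zero _ _ _ hg
        ((killBar_bar _ g).trans (if_neg fun h => h2 (h a ha))), TensorProduct.zero_tmul,
        TensorProduct.tmul_zero]
  · rw [if_neg fun h => h1 (hle.1 h).1]
    push Not at h1
    obtain ⟨a, ha⟩ := h1
    rw [(exteriorPower.ιMulti ℂ p).map_coord_zero a (by
      rw [Function.comp_apply, wedgeProj_bar hω, if_neg ha]), TensorProduct.zero_tmul]

end

section

variable {T m N : ℕ}

/-! ### The terms of the differential of a monomial -/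

theorem Comm.shift_zero (g : Comm T m) : g.shift 0 = g := by
  induction g with
  | gen k i => simp [Comm.shift]
  | br g h ihg ihh => simp [Comm.shift, ihg, ihh]

namespace Mono

/-- The term of the differential where a wedge factor acts at the origin. -/
def termZero {p : ℕ} (x : Mono T m N (p + 1)) (a : Fin (p + 1)) : Mono T m N p :=
  ⟨a.removeNth x.wedge, x.wedge a :: x.zero, x.point⟩

/-- The terms of the differential where a wedge factor acts at a point. -/
def termPoint {p : ℕ} (x : Mono T m N (p + 1)) (a : Fin (p + 1)) (j : Fin N) (k : ZMod T) :
    Mono T m N p :=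
  ⟨a.removeNth x.wedge, x.zero, Function.update x.point j ((x.wedge a).shift k :: x.point j)⟩

/-- The terms of the differential where the wedge factors `a` and `b + 1` are joined. -/
def termBracket {n : ℕ} (x : Mono T m N (n + 2)) (a b : Fin (n + 1)) (k : ZMod T) :
    Mono T m N (n + 1) :=
  ⟨Fin.snoc (α := fun _ => Comm T m) (b.removeNth (a.castSucc.removeNth x.wedge))
    (Comm.br (x.wedge a.castSucc) ((x.wedge b.succ).shift k)), x.zero, x.point⟩

variable [NeZero T]

/-- The part of the differential of a monomial which comes from brackets. -/
def bracketTerms : ∀ {p : ℕ}, Mono T m N (p + 1) → Chains (nbar T m) (ModM T m N) p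
  | 0, _ => 0
  | n + 1, x => ∑ a : Fin (n + 1), ∑ b ≥ a, (-1 : ℂ) ^ ((a : ℕ) + b + 1) •
      ∑ k : ZMod T, (x.termBracket a b k).eval

/-- A bracket of two elements of `𝔫̄` involves two sums over translates; `bar` absorbs the common
translation, so one relative translation `k` remains. An action at a point unfolds the sum in `ḡ`,
which also gives one term for each `k`. -/
theorem ceD_eval {p : ℕ} (x : Mono T m N (p + 1)) :
    ceD (nbar T m) (ModM T m N) p x.eval =
      ∑ a : Fin (p + 1), (-1 : ℂ) ^ (p - (a : ℕ)) •
        ((x.termZero a).eval + ∑ j, ∑ k, (x.termPoint a j k).eval) + x.bracketTerms := by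
  have h1 : ∀ a : Fin (p + 1), exteriorPower.ιMulti ℂ p
      (a.removeNth fun a => bar T m (x.wedge a).eval) ⊗ₜ[ℂ] ⁅bar T m (x.wedge a).eval,
      ((x.zero.map fun g => UniversalEnvelopingAlgebra.ι ℂ (bar T m g.eval)).prod ⊗ₜ[ℂ]
      PiTensorProduct.tprod ℂ fun j =>
        ((x.point j).map fun g => UniversalEnvelopingAlgebra.ι ℂ g.eval).prod : ModM T m N)⁆ =
      (x.termZero a).eval + ∑ j, ∑ k, (x.termPoint a j k).eval := by
    intro a
    rw [lie_monomial, TensorProduct.tmul_add, TensorProduct.tmul_sum]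
    simp only [TensorProduct.tmul_sum]
    rfl
  cases p with
  | zero =>
    conv_lhs => rw [eval, ceD_zero_apply, h1]
    simp [bracketTerms]
  | succ n =>
    conv_lhs => rw [eval, ceD_apply]
    simp only [h1]
    congr 1
    refine Finset.sum_congr rfl fun a _ => Finset.sum_congr rfl fun b _ => ?_
    congr 1
    rw [lie_bar, ← ceSnoc_apply, ceSnoc_sum]
    refine Finset.sum_congr rfl fun k _ => ?_
    rw [ceSnoc_apply, eval]
    congr 2
    funext c
    induction c using Fin.lastCases with
    | last => simp [termBracket]
    | cast c => simp [termBracket, Fin.removeNth]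

omit [NeZero T] in
theorem weight_termZero {p : ℕ} (x : Mono T m N (p + 1)) (a : Fin (p + 1)) :
    (x.termZero a).weight = x.weight := by
  unfold weight
  rw [Fin.sum_univ_succAbove _ a]
  simp only [termZero, List.map_cons, List.sum_cons, Fin.removeNth]
  abel

omit [NeZero T] in
theorem weight_termPoint {p : ℕ} (x : Mono T m N (p + 1)) (a : Fin (p + 1)) (j : Fin N)
    (k : ZMod T) : (x.termPoint a j k).weight = x.weight := by
  have : ∑ i, (((x.termPoint a j k).point i).map Comm.weight).sum =
      (x.wedge a).weight + ∑ i, ((x.point i).map Comm.weight).sum := by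
    rw [← Finset.add_sum_erase _ _ (Finset.mem_univ j),
      ← Finset.add_sum_erase _ (fun i => ((x.point i).map Comm.weight).sum) (Finset.mem_univ j)]
    simp only [termPoint]
    rw [Function.update_self, List.map_cons, List.sum_cons, add_assoc, Comm.weight_shift]
    congr 2
    refine Finset.sum_congr rfl fun i hi => ?_
    rw [Function.update_of_ne (Finset.ne_of_mem_erase hi)]
  unfold weight
  rw [this, Fin.sum_univ_succAbove _ a]
  simp only [termPoint, Fin.removeNth]
  abel

omit [NeZero T] in
theorem succAbove_eq_succ {n : ℕ} {a b : Fin (n + 1)} (hab : a ≤ b) :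
    a.castSucc.succAbove b = b.succ :=
  Fin.succAbove_of_le_castSucc _ _ (by simpa using hab)

omit [NeZero T] in
theorem weight_termBracket {n : ℕ} (x : Mono T m N (n + 2)) {a b : Fin (n + 1)} (hab : a ≤ b)
    (k : ZMod T) : (x.termBracket a b k).weight = x.weight := by
  unfold weight
  rw [Fin.sum_univ_castSucc (n := n), Fin.sum_univ_succAbove _ a.castSucc,
    Fin.sum_univ_succAbove _ b, succAbove_eq_succ hab]
  simp only [termBracket, Fin.snoc_castSucc, Fin.snoc_last, Comm.weight, Comm.weight_shift,
    Fin.removeNth]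
  abel

variable {ω : ℂ} {z : Fin N → ℂ}

omit [NeZero T] in
theorem mem_edge_termZero {p : ℕ} {x : Mono T m N (p + 1)} {a : Fin (p + 1)} {t : Fin m → ℂ}
    (h : t ∈ (x.termZero a).edge ω z) : t ∈ x.edge ω z ∧ t ∈ zeroIsland (x.wedge a) := by
  obtain ⟨h1, h2, h3⟩ := mem_edge.1 h
  have h4 := h2 _ List.mem_cons_self
  refine ⟨mem_edge.2 ⟨fun c => ?_, fun g hg => h2 g (List.mem_cons_of_mem _ hg), h3⟩, h4⟩
  rcases Fin.eq_self_or_eq_succAbove a c with rfl | ⟨c, rfl⟩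
  · intro b hb c hc
    rw [h4 b hb, h4 c hc, mul_zero, mul_zero]
  · exact h1 c

theorem mem_edge_termPoint (hω : ω ^ T = 1) {p : ℕ} {x : Mono T m N (p + 1)} {a : Fin (p + 1)}
    {j : Fin N} {k : ZMod T} {t : Fin m → ℂ} (h : t ∈ (x.termPoint a j k).edge ω z) :
    t ∈ x.edge ω z ∧ t ∈ fixedIsland ω (z j) ((x.wedge a).shift k) := by
  obtain ⟨h1, h2, h3⟩ := mem_edge.1 h
  have h4 : t ∈ fixedIsland ω (z j) ((x.wedge a).shift k) := by
    refine h3 j _ ?_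
    simp only [termPoint, Function.update_self]
    exact List.mem_cons_self
  refine ⟨mem_edge.2 ⟨fun c => ?_, h2, fun i g hg => h3 i g ?_⟩, h4⟩
  · rcases Fin.eq_self_or_eq_succAbove a c with rfl | ⟨c, rfl⟩
    · rw [← mem_swimIsland_shift hω k]
      exact fun b hb c hc => (h4 b hb).trans (h4 c hc).symm
    · exact h1 c
  · by_cases hij : i = j
    · subst hij
      simp only [termPoint, Function.update_self]
      exact List.mem_cons_of_mem _ hg
    · simpa only [termPoint, Function.update_of_ne hij] using hg

theorem mem_edge_termBracket (hω : ω ^ T = 1) {n : ℕ} {x : Mono T m N (n + 2)}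
    {a b : Fin (n + 1)} (hab : a ≤ b) {k : ZMod T} {t : Fin m → ℂ}
    (h : t ∈ (x.termBracket a b k).edge ω z) : t ∈ x.edge ω z ∧
      t ∈ swimIsland ω (Comm.br (x.wedge a.castSucc) ((x.wedge b.succ).shift k)) := by
  obtain ⟨h1, h2, h3⟩ := mem_edge.1 h
  have h4 := h1 (Fin.last n)
  simp only [termBracket, Fin.snoc_last] at h4
  refine ⟨mem_edge.2 ⟨fun c => ?_, h2, h3⟩, h4⟩
  rcases Fin.eq_self_or_eq_succAbove a.castSucc c with rfl | ⟨c, rfl⟩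
  · exact (mem_swimIsland_br h4).1
  · rcases Fin.eq_self_or_eq_succAbove b c with rfl | ⟨c, rfl⟩
    · rw [succAbove_eq_succ hab]
      exact (mem_swimIsland_shift hω k _ _).1 (mem_swimIsland_br h4).2
    · have := h1 c.castSucc
      simp only [termBracket, Fin.snoc_castSucc] at this
      exact this

/-! ### Components of the differential along the three elementary moves -/

theorem edgeProj_eval_of_le (hω : ω ^ T = 1) {p : ℕ} {L : AffineSubspace ℂ (Fin m → ℂ)}
    {x : Mono T m N p} (h : L ≤ x.edge ω z) : edgeProj T ω z p L x.eval = x.eval := by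
  classical rw [edgeProj_eval hω, if_pos h]

theorem edgeProj_eval_of_notMem (hω : ω ^ T = 1) {p : ℕ} {L : AffineSubspace ℂ (Fin m → ℂ)}
    {x : Mono T m N p} {t : Fin m → ℂ} (ht : t ∈ L) (h : t ∉ x.edge ω z) :
    edgeProj T ω z p L x.eval = 0 := by
  classical rw [edgeProj_eval hω, if_neg fun h' => h (h' ht)]

section Points

variable {t : Fin m → ℂ} {g h : Comm T m} {c c' : ℂ}

omit [NeZero T] in
theorem eq_zero_of_mem_zeroIsland (hg : ∀ b ∈ g.content, ω ^ b.1.val * t b.2 = c)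
    (ht : t ∈ zeroIsland g) : c = 0 := by
  obtain ⟨b, hb⟩ := g.exists_mem_content
  rw [← hg b hb, ht b hb, mul_zero]

theorem mul_eq_of_mem_fixedIsland (hω : ω ^ T = 1) {k : ZMod T}
    (hg : ∀ b ∈ g.content, ω ^ b.1.val * t b.2 = c)
    (ht : t ∈ fixedIsland ω c' (g.shift k)) : ω ^ k.val * c = c' := by
  obtain ⟨b, hb⟩ := g.exists_mem_content
  rw [← hg b hb, ← mul_assoc, ← pow_val_add hω, add_comm]
  refine ht (b.1 + k, b.2) ?_
  rw [Comm.content_shift]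
  exact List.mem_map.2 ⟨b, hb, rfl⟩

theorem eq_mul_of_mem_swimIsland (hω : ω ^ T = 1) {k : ZMod T}
    (hg : ∀ b ∈ g.content, ω ^ b.1.val * t b.2 = c)
    (hh : ∀ b ∈ h.content, ω ^ b.1.val * t b.2 = c')
    (ht : t ∈ swimIsland ω (Comm.br g (h.shift k))) : c = ω ^ k.val * c' := by
  obtain ⟨b, hb⟩ := g.exists_mem_content
  obtain ⟨d, hd⟩ := h.exists_mem_content
  have hd' : (d.1 + k, d.2) ∈ (h.shift k).content := by
    rw [Comm.content_shift]
    exact List.mem_map.2 ⟨d, hd, rfl⟩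
  have := ht b (List.mem_append_left _ hb) _ (List.mem_append_right _ hd')
  rw [← hg b hb, ← hh d hd, this, pow_val_add hω]
  ring

omit [NeZero T] in
theorem mem_zeroIsland_of (hω : ω ≠ 0) (hg : ∀ b ∈ g.content, ω ^ b.1.val * t b.2 = 0) :
    t ∈ zeroIsland g :=
  fun b hb => (mul_eq_zero.1 (hg b hb)).resolve_left (pow_ne_zero _ hω)

omit [NeZero T] in
theorem mem_swimIsland_br_of (hg : ∀ b ∈ g.content, ω ^ b.1.val * t b.2 = c)
    (hh : ∀ b ∈ h.content, ω ^ b.1.val * t b.2 = c) : t ∈ swimIsland ω (Comm.br g h) := by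
  have : ∀ b ∈ (Comm.br g h).content, ω ^ b.1.val * t b.2 = c := by
    intro b hb
    rcases List.mem_append.1 hb with hb | hb
    · exact hg b hb
    · exact hh b hb
  exact fun b hb d hd => (this b hb).trans (this d hd).symm

end Points

/-- A sufficient condition for the projection of the differential of a monomial to consist of the
terms which act at the origin or at a point. -/
theorem edgeProj_bracketTerms_eq_zero (hω : ω ^ T = 1) {p : ℕ} (x : Mono T m N (p + 1))
    (L : AffineSubspace ℂ (Fin m → ℂ))
    (h : ∀ (a b : Fin (p + 1)) (k : ZMod T), a ≠ b → ∃ t ∈ L,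
      t ∉ swimIsland ω (Comm.br (x.wedge a) ((x.wedge b).shift k))) :
    edgeProj T ω z p L x.bracketTerms = 0 := by
  cases p with
  | zero => exact LinearMap.map_zero _
  | succ n =>
    simp only [bracketTerms, map_sum, map_smul]
    refine Finset.sum_eq_zero fun a _ => Finset.sum_eq_zero fun b hb => ?_
    have hab : a ≤ b := Finset.mem_Ici.1 hb
    rw [Finset.sum_eq_zero, smul_zero]
    intro k _
    have hne : a.castSucc ≠ b.succ := by
      intro e
      have := congrArg Fin.val e
      simp only [Fin.val_castSucc, Fin.val_succ] at this
      have : (a : ℕ) ≤ b := hab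
      omega
    obtain ⟨t, ht, hn⟩ := h _ _ k hne
    exact edgeProj_eval_of_notMem hω ht fun h => hn (mem_edge_termBracket hω hab h).2

/-- Each unwanted term is excluded by a point of the new edge that is off the edge of the term.
Since the values at the islands other than the last can be chosen freely, it suffices to violate one
equation of the term by a choice of values `0` and `1`. -/
theorem edgeProj_ceD_actZero (hω : ω ^ T = 1) (hz : ∀ j, z j ≠ 0) {p : ℕ}
    (x : Mono T m N (p + 1)) (hx : x.weight = 1) :
    edgeProj T ω z p (x.actZero.edge ω z) (ceD (nbar T m) (ModM T m N) p x.eval) =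
      x.actZero.eval := by
  have hω0 : ω ≠ 0 := by
    rintro rfl
    rw [zero_pow (NeZero.ne T)] at hω
    exact zero_ne_one hω
  -- The island values are arbitrary except that the island sent to the origin has value `0`.
  have hpt : ∀ s : Fin (p + 1) → ℂ, s (Fin.last p) = 0 → ∃ t ∈ x.actZero.edge ω z,
      ∀ a, ∀ b ∈ (x.wedge a).content, ω ^ b.1.val * t b.2 = s a := by
    intro s hs
    obtain ⟨t, ht, h⟩ := x.exists_mem_edge (z := z) hω hx s
    refine ⟨t, ?_, h⟩
    rw [edge_actZero, AffineSubspace.mem_inf_iff]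
    exact ⟨ht, mem_zeroIsland_of hω0 fun b hb => (h _ b hb).trans hs⟩
  rw [ceD_eval, map_add, edgeProj_bracketTerms_eq_zero hω, add_zero]
  · simp only [map_sum, map_smul, map_add]
    rw [Finset.sum_eq_single (Fin.last p)]
    · rw [Fin.val_last, Nat.sub_self, pow_zero, one_smul]
      have e : x.termZero (Fin.last p) = x.actZero := by
        unfold termZero actZero
        congr 1
        funext a
        simp [Fin.removeNth]
      rw [e, edgeProj_eval_of_le hω le_rfl, add_eq_left]
      refine Finset.sum_eq_zero fun j _ => Finset.sum_eq_zero fun k _ => ?_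
      -- With all islands at the origin no nonzero point `z j` is reached.
      obtain ⟨t, ht, h⟩ := hpt 0 rfl
      refine edgeProj_eval_of_notMem hω ht fun h' => hz j ?_
      rw [← mul_eq_of_mem_fixedIsland hω (h _) (mem_edge_termPoint hω h').2, Pi.zero_apply,
        mul_zero]
    · intro a _ ha
      have h1 : edgeProj T ω z p (x.actZero.edge ω z) (x.termZero a).eval = 0 := by
        -- Another island, placed at `1`, is not at the origin.
        obtain ⟨t, ht, h⟩ := hpt (Pi.single a 1) (Pi.single_eq_of_ne ha.symm _)
        refine edgeProj_eval_of_notMem hω ht fun h' => ?_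
        have := eq_zero_of_mem_zeroIsland (h a) (mem_edge_termZero h').2
        rw [Pi.single_eq_same] at this
        exact one_ne_zero this
      rw [h1, zero_add, Finset.sum_eq_zero, smul_zero]
      intro j _
      refine Finset.sum_eq_zero fun k _ => ?_
      obtain ⟨t, ht, h⟩ := hpt 0 rfl
      refine edgeProj_eval_of_notMem hω ht fun h' => hz j ?_
      rw [← mul_eq_of_mem_fixedIsland hω (h _) (mem_edge_termPoint hω h').2, Pi.zero_apply,
        mul_zero]
    · exact fun h => absurd (Finset.mem_univ _) h
  · intro a b k hab
    -- Two islands are not joined when one is at `1` and the other at `0`; the island placed at `1`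
    -- must not be the one sent to the origin.
    by_cases ha : a = Fin.last p
    · have hb : Fin.last p ≠ b := ha ▸ hab
      obtain ⟨t, ht, h⟩ := hpt (Pi.single b 1) (Pi.single_eq_of_ne hb _)
      refine ⟨t, ht, fun h' => ?_⟩
      have := eq_mul_of_mem_swimIsland hω (h a) (h b) h'
      rw [Pi.single_eq_same, Pi.single_eq_of_ne hab, mul_one] at this
      exact pow_val_ne_zero hω k this.symm
    · obtain ⟨t, ht, h⟩ := hpt (Pi.single a 1) (Pi.single_eq_of_ne (Ne.symm ha) _)
      refine ⟨t, ht, fun h' => ?_⟩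
      have := eq_mul_of_mem_swimIsland hω (h a) (h b) h'
      rw [Pi.single_eq_same, Pi.single_eq_of_ne hab.symm, mul_zero] at this
      exact one_ne_zero this

/-- The argument is the one for the origin, with the last island now at `z j`. Among the terms where
this island is fixed at a point, different orbits exclude the other points and primitivity of `ω`
excludes the nonzero translates. -/
theorem edgeProj_ceD_actPoint (hω : IsPrimitiveRoot ω T) (hz : ∀ j, z j ≠ 0)
    (hzorb : ∀ i j, i ≠ j → ∀ k : ℕ, z i ≠ ω ^ k * z j) {p : ℕ}
    (x : Mono T m N (p + 1)) (hx : x.weight = 1) (j : Fin N) :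
    edgeProj T ω z p ((x.actPoint j).edge ω z) (ceD (nbar T m) (ModM T m N) p x.eval) =
      (x.actPoint j).eval := by
  have hω1 := hω.pow_eq_one
  have hpt : ∀ s : Fin (p + 1) → ℂ, s (Fin.last p) = z j → ∃ t ∈ (x.actPoint j).edge ω z,
      ∀ a, ∀ b ∈ (x.wedge a).content, ω ^ b.1.val * t b.2 = s a := by
    intro s hs
    obtain ⟨t, ht, h⟩ := x.exists_mem_edge (z := z) hω1 hx s
    refine ⟨t, ?_, h⟩
    rw [edge_actPoint, AffineSubspace.mem_inf_iff]
    exact ⟨ht, fun b hb => (h _ b hb).trans hs⟩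
  have hzero : ∀ a, edgeProj T ω z p ((x.actPoint j).edge ω z) (x.termZero a).eval = 0 := by
    intro a
    obtain ⟨t, ht, h⟩ := hpt (fun _ => z j) rfl
    exact edgeProj_eval_of_notMem hω1 ht fun h' =>
      hz j (eq_zero_of_mem_zeroIsland (h a) (mem_edge_termZero h').2)
  rw [ceD_eval, map_add, edgeProj_bracketTerms_eq_zero hω1, add_zero]
  · simp only [map_sum, map_smul, map_add, hzero, zero_add]
    rw [Finset.sum_eq_single (Fin.last p)]
    -- The last wedge factor acts with sign `(-1)^(p - p) = 1`; this is why the rule carries no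
    -- sign.
    · rw [Fin.val_last, Nat.sub_self, pow_zero, one_smul]
      have e : x.termPoint (Fin.last p) j 0 = x.actPoint j := by
        unfold termPoint actPoint
        rw [Comm.shift_zero]
        congr 1
        funext a
        simp [Fin.removeNth]
      have hne : ∀ (j' : Fin N) (k : ZMod T), (j' = j → k ≠ 0) →
          edgeProj T ω z p ((x.actPoint j).edge ω z) (x.termPoint (Fin.last p) j' k).eval = 0 := by
        intro j' k hk
        obtain ⟨t, ht, h⟩ := hpt (fun _ => z j) rfl
        refine edgeProj_eval_of_notMem hω1 ht fun h' => ?_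
        have := mul_eq_of_mem_fixedIsland hω1 (h _) (mem_edge_termPoint hω1 h').2
        by_cases hj : j' = j
        · subst hj
          refine hk rfl (pow_val_inj hω ?_)
          rw [pow_val_zero]
          exact mul_right_cancel₀ (hz j') (this.trans (one_mul _).symm)
        · exact hzorb j' j hj _ this.symm
      rw [Finset.sum_eq_single j, Finset.sum_eq_single 0]
      · rw [e, edgeProj_eval_of_le hω1 le_rfl]
      · exact fun k _ hk => hne j k fun _ => hk
      · exact fun h => absurd (Finset.mem_univ _) h
      · exact fun j' _ hj => Finset.sum_eq_zero fun k _ => hne j' k fun e => absurd e hj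
      · exact fun h => absurd (Finset.mem_univ _) h
    · intro a _ ha
      rw [Finset.sum_eq_zero, smul_zero]
      intro j' _
      refine Finset.sum_eq_zero fun k _ => ?_
      -- All islands but the last are at the origin, so none of them is at a nonzero point.
      obtain ⟨t, ht, h⟩ := hpt (Pi.single (Fin.last p) (z j)) (Pi.single_eq_same _ _)
      refine edgeProj_eval_of_notMem hω1 ht fun h' => hz j' ?_
      rw [← mul_eq_of_mem_fixedIsland hω1 (h _) (mem_edge_termPoint hω1 h').2,
        Pi.single_eq_of_ne ha, mul_zero]
    · exact fun h => absurd (Finset.mem_univ _) h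
  · intro a b k hab
    -- Of two islands, one that is not tied to `z j` is placed at `0` and all the others at `z j`;
    -- the values are then not related by a power of `ω`.
    have key : ∀ c d : Fin (p + 1), c ≠ Fin.last p → d ≠ c → ∃ t ∈ (x.actPoint j).edge ω z,
        (∀ b ∈ (x.wedge c).content, ω ^ b.1.val * t b.2 = 0) ∧
        ∀ b ∈ (x.wedge d).content, ω ^ b.1.val * t b.2 = z j := by
      intro c d hc hd
      obtain ⟨t, ht, h⟩ := hpt (Function.update (fun _ => z j) c 0)
        (Function.update_of_ne hc.symm _ _)
      refine ⟨t, ht, fun b hb => ?_, fun b hb => ?_⟩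
      · rw [h c b hb, Function.update_self]
      · rw [h d b hb, Function.update_of_ne hd]
    by_cases ha : a = Fin.last p
    · have hb : b ≠ Fin.last p := fun e => hab (ha.trans e.symm)
      obtain ⟨t, ht, h0, h1⟩ := key b a hb hab
      refine ⟨t, ht, fun h' => hz j ?_⟩
      rw [eq_mul_of_mem_swimIsland hω1 h1 h0 h', mul_zero]
    · obtain ⟨t, ht, h0, h1⟩ := key a b ha hab.symm
      refine ⟨t, ht, fun h' => ?_⟩
      have := eq_mul_of_mem_swimIsland hω1 h0 h1 h'
      exact (mul_ne_zero (pow_val_ne_zero hω1 k) (hz j)) this.symm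

/-- The differential produces `[g_2, g_1]`, whereas the rule uses `[g_1, g_2]`. This sign cancels
the sign `(-1)^(n + n + 1)` of the term in the differential. -/
theorem eval_termBracket_last {n : ℕ} (x : Mono T m N (n + 2)) :
    (x.termBracket (Fin.last n) (Fin.last n) 0).eval = - x.join.eval := by
  have hb : bar T m (Comm.br (x.wedge (Fin.last n).castSucc)
      ((x.wedge (Fin.last n).succ).shift 0)).eval = -bar T m x.lastBracket.eval := by
    rw [lastBracket, Comm.eval, Comm.eval, ← lie_skew, map_neg, Comm.shift_zero, Fin.succ_last]
  have h1 : (fun c => bar T m ((x.termBracket (Fin.last n) (Fin.last n) 0).wedge c).eval) =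
      Fin.snoc (α := fun _ => nbar T m) (fun c : Fin n => bar T m (x.wedge c.castSucc.castSucc).eval)
        (-bar T m x.lastBracket.eval) := by
    rw [← hb]
    funext c
    induction c using Fin.lastCases with
    | last => simp only [termBracket, Fin.snoc_last]
    | cast c =>
      have : (Fin.last n).castSucc.succAbove c.castSucc = c.castSucc.castSucc :=
        Fin.succAbove_of_castSucc_lt _ _ (Fin.castSucc_lt_castSucc_iff.2 (Fin.castSucc_lt_last c))
      simp [termBracket, Fin.init, Fin.removeNth, this]
  have h2 : (fun c => bar T m (x.join.wedge c).eval) =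
      Fin.snoc (α := fun _ => nbar T m) (fun c : Fin n => bar T m (x.wedge c.castSucc.castSucc).eval)
        (bar T m x.lastBracket.eval) := by
    funext c
    induction c using Fin.lastCases with
    | last => simp only [join, Fin.snoc_last]
    | cast c => simp only [join, Fin.snoc_castSucc]
  rw [eval, eval, h1, h2, ← ceSnoc_apply, ← ceSnoc_apply, map_neg, AlternatingMap.neg_apply,
    LinearMap.neg_apply]
  rfl

/-- On the new edge the last two islands have a common value and all values are otherwise free.
Placing all islands at `1` excludes the terms at the origin, and placing all of them at `0` excludes
those at points. What remains are joins of two islands. -/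
theorem edgeProj_ceD_join (hω : IsPrimitiveRoot ω T) (hz : ∀ j, z j ≠ 0) {n : ℕ}
    (x : Mono T m N (n + 2)) (hx : x.weight = 1) :
    edgeProj T ω z (n + 1) (x.join.edge ω z) (ceD (nbar T m) (ModM T m N) (n + 1) x.eval) =
      x.join.eval := by
  have hω1 := hω.pow_eq_one
  have hpt : ∀ s : Fin (n + 2) → ℂ, s (Fin.last (n + 1)) = s (Fin.last n).castSucc →
      ∃ t ∈ x.join.edge ω z,
      ∀ a, ∀ b ∈ (x.wedge a).content, ω ^ b.1.val * t b.2 = s a := by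
    intro s hs
    obtain ⟨t, ht, h⟩ := x.exists_mem_edge (z := z) hω1 hx s
    refine ⟨t, ?_, h⟩
    rw [edge_join, AffineSubspace.mem_inf_iff]
    exact ⟨ht, mem_swimIsland_br_of (h _) fun b hb => (h _ b hb).trans hs.symm⟩
  have hzero : ∀ a, edgeProj T ω z (n + 1) (x.join.edge ω z) (x.termZero a).eval = 0 := by
    intro a
    obtain ⟨t, ht, h⟩ := hpt (fun _ => 1) rfl
    exact edgeProj_eval_of_notMem hω1 ht fun h' =>
      one_ne_zero (eq_zero_of_mem_zeroIsland (h a) (mem_edge_termZero h').2)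
  have hpoint : ∀ a j k,
      edgeProj T ω z (n + 1) (x.join.edge ω z) (x.termPoint a j k).eval = 0 := by
    intro a j k
    obtain ⟨t, ht, h⟩ := hpt 0 rfl
    refine edgeProj_eval_of_notMem hω1 ht fun h' => hz j ?_
    rw [← mul_eq_of_mem_fixedIsland hω1 (h _) (mem_edge_termPoint hω1 h').2, Pi.zero_apply,
      mul_zero]
  rw [ceD_eval, map_add]
  simp only [map_sum, map_smul, map_add, hzero, hpoint, Finset.sum_const_zero, add_zero, smul_zero,
    zero_add, bracketTerms]
  -- For a pair other than the last two, one of its islands is not tied to any other; it is placed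
  -- at `1` and the rest at `0`.
  have hother : ∀ (c d : Fin (n + 2)) (k : ZMod T), c ≠ d →
      (c ≠ (Fin.last n).castSucc ∨ d ≠ Fin.last (n + 1)) → c ≠ Fin.last (n + 1) →
      ∃ t ∈ x.join.edge ω z, t ∉ swimIsland ω (Comm.br (x.wedge c) ((x.wedge d).shift k)) := by
    intro c d k hcd h hc
    rcases eq_or_ne c (Fin.last n).castSucc with rfl | hc'
    · have hd : d ≠ Fin.last (n + 1) := h.resolve_left fun h => h rfl
      obtain ⟨t, ht, h⟩ := hpt (Pi.single d 1)
        (by rw [Pi.single_eq_of_ne hd.symm, Pi.single_eq_of_ne hcd])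
      refine ⟨t, ht, fun h' => ?_⟩
      have := eq_mul_of_mem_swimIsland hω1 (h _) (h d) h'
      rw [Pi.single_eq_same, Pi.single_eq_of_ne hcd, mul_one] at this
      exact pow_val_ne_zero hω1 k this.symm
    · obtain ⟨t, ht, h⟩ := hpt (Pi.single c 1)
        (by rw [Pi.single_eq_of_ne hc.symm, Pi.single_eq_of_ne hc'.symm])
      refine ⟨t, ht, fun h' => ?_⟩
      have := eq_mul_of_mem_swimIsland hω1 (h c) (h d) h'
      rw [Pi.single_eq_same, Pi.single_eq_of_ne hcd.symm, mul_zero] at this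
      exact one_ne_zero this
  have hkill : ∀ (a b : Fin (n + 1)) (k : ZMod T), a ≤ b → (a ≠ Fin.last n ∨ b ≠ Fin.last n) →
      edgeProj T ω z (n + 1) (x.join.edge ω z) (x.termBracket a b k).eval = 0 := by
    intro a b k hab h
    have hne : a.castSucc ≠ b.succ := by
      intro e
      have := congrArg Fin.val e
      simp only [Fin.val_castSucc, Fin.val_succ] at this
      have : (a : ℕ) ≤ b := hab
      omega
    obtain ⟨t, ht, hn⟩ := hother a.castSucc b.succ k hne
      (h.imp (fun h e => h (Fin.castSucc_injective _ e))
        (fun h e => h (Fin.succ_injective _ (e.trans (Fin.succ_last n).symm))))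
      (Fin.castSucc_lt_last a).ne
    exact edgeProj_eval_of_notMem hω1 ht fun h => hn (mem_edge_termBracket hω1 hab h).2
  rw [Finset.sum_eq_single (Fin.last n), Finset.sum_eq_single (Fin.last n),
    Finset.sum_eq_single 0]
  · have hsign : (-1 : ℂ) ^ (((Fin.last n : Fin (n + 1)) : ℕ) + (Fin.last n : Fin (n + 1)) + 1) =
        -1 := by
      rw [Fin.val_last, pow_succ, ← two_mul, pow_mul]
      simp
    have e := x.eval_termBracket_last
    rw [hsign, e, neg_one_smul]
    have := edgeProj_eval_of_le (x := x.join) (z := z) hω1 le_rfl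
    rw [map_neg, this]
    exact neg_neg _
  · intro k _ hk
    -- For the right pair but a nonzero translate, equal values `1` would give `1 = ω ^ k`.
    obtain ⟨t, ht, h⟩ := hpt (fun _ => 1) rfl
    refine edgeProj_eval_of_notMem hω1 ht fun h' => hk ?_
    have := eq_mul_of_mem_swimIsland hω1 (h _) (h _) (mem_edge_termBracket hω1 le_rfl h').2
    refine pow_val_inj hω ?_
    rw [pow_val_zero, this, mul_one]
  · exact fun h => absurd (Finset.mem_univ _) h
  · intro b hb hne
    rw [Finset.sum_eq_zero, smul_zero]
    exact fun k _ => hkill _ _ k (Finset.mem_Ici.1 hb) (Or.inr hne)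
  · exact fun h => absurd (Finset.mem_Ici.2 le_rfl) h
  · intro a _ hne
    refine Finset.sum_eq_zero fun b hb => ?_
    rw [Finset.sum_eq_zero, smul_zero]
    exact fun k _ => hkill _ _ k (Finset.mem_Ici.1 hb) (Or.inl hne)
  · exact fun h => absurd (Finset.mem_univ _) h

end Mono

end

section

/-! ### Flags and their extensions -/

section Flags

variable {V : Type*} [AddCommGroup V] [Module ℂ V] {𝒜 : Set (AffineSubspace ℂ V)} {k : ℕ}

theorem affine_eq_of_le_of_finrank [FiniteDimensional ℂ V] {K L : AffineSubspace ℂ V}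
    (hK : (K : Set V).Nonempty) (h : K ≤ L)
    (hd : Module.finrank ℂ L.direction ≤ Module.finrank ℂ K.direction) : K = L :=
  AffineSubspace.eq_of_direction_eq_of_nonempty_of_le
    (Submodule.eq_of_le_of_finrank_le (AffineSubspace.direction_le h) hd) hK h

theorem Flag.finrank_last (F : Flag 𝒜 k) :
    Module.finrank ℂ F.last.direction + k = Module.finrank ℂ V := F.codim (Fin.last k)

theorem Flag.isEdge_last (F : Flag 𝒜 k) : IsEdge 𝒜 F.last := F.isEdge (Fin.last k)

theorem Flag.last_le (F : Flag 𝒜 (k + 1)) : F.last ≤ F.init.last := F.anti (Fin.last k)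

theorem Flag.ext_init_last {F G : Flag 𝒜 (k + 1)} (h : F.init = G.init) (h' : F.last = G.last) :
    F = G := by
  ext1
  funext j
  induction j using Fin.lastCases with
  | last => exact h'
  | cast j => exact congrFun (congrArg Flag.edge h) j

theorem Flag.eq_trivialFlag [FiniteDimensional ℂ V] (F : Flag 𝒜 0) : F = trivialFlag 𝒜 := by
  ext1
  funext j
  have hj : (j : ℕ) = 0 := by omega
  refine affine_eq_of_le_of_finrank (F.isEdge j).1 le_top ?_
  have := F.codim j
  rw [hj, add_zero] at this
  rw [this]
  exact Submodule.finrank_le _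

/-- The extension of a flag by an edge. -/
def Flag.extend (F : Flag 𝒜 k) (L : AffineSubspace ℂ V) (hL : IsEdge 𝒜 L)
    (hc : Module.finrank ℂ L.direction + (k + 1) = Module.finrank ℂ V) (hle : L ≤ F.last) :
    Flag 𝒜 (k + 1) where
  edge := Fin.snoc (α := fun _ => AffineSubspace ℂ V) F.edge L
  isEdge j := by
    induction j using Fin.lastCases with
    | last => rwa [Fin.snoc_last]
    | cast j => rw [Fin.snoc_castSucc]; exact F.isEdge j
  codim j := by
    induction j using Fin.lastCases with
    | last => rwa [Fin.snoc_last]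
    | cast j => rw [Fin.snoc_castSucc]; exact F.codim j
  anti j := by
    rw [Fin.snoc_castSucc]
    induction j using Fin.lastCases with
    | last => rw [Fin.succ_last, Fin.snoc_last]; exact hle
    | cast j => rw [← Fin.castSucc_succ, Fin.snoc_castSucc]; exact F.anti j

section

variable (F : Flag 𝒜 k) (L : AffineSubspace ℂ V) (hL : IsEdge 𝒜 L)
    (hc : Module.finrank ℂ L.direction + (k + 1) = Module.finrank ℂ V) (hle : L ≤ F.last)

theorem Flag.extend_init : (F.extend L hL hc hle).init = F := by
  ext1
  funext j
  exact Fin.snoc_castSucc (α := fun _ => AffineSubspace ℂ V) _ _ _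

theorem Flag.extend_last : (F.extend L hL hc hle).last = L :=
  Fin.snoc_last (α := fun _ => AffineSubspace ℂ V) _ _

end

/-- Two flags agree away from position `i < k`, in terms of their initial parts. -/
theorem Flag.agree_castSucc_iff {F G : Flag 𝒜 (k + 1)} {i : Fin (k + 1)} :
    (∀ j, j ≠ i.castSucc → G.edge j = F.edge j) ↔
      (∀ j, j ≠ i → G.init.edge j = F.init.edge j) ∧ G.last = F.last := by
  constructor
  · intro h
    exact ⟨fun j hj => h _ fun e => hj (Fin.castSucc_injective _ e),
      h _ (Fin.castSucc_lt_last i).ne'⟩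
  · rintro ⟨h, h'⟩ j hj
    induction j using Fin.lastCases with
    | last => exact h'
    | cast j => exact h j fun e => hj (by rw [e])

theorem Flag.agree_last_iff {F G : Flag 𝒜 (k + 1)} :
    (∀ j, j ≠ Fin.last (k + 1) → G.edge j = F.edge j) ↔ G.init = F.init := by
  constructor
  · intro h
    ext1
    funext j
    exact h _ (Fin.castSucc_lt_last j).ne
  · intro h j hj
    induction j using Fin.lastCases with
    | last => exact absurd rfl hj
    | cast j => exact congrFun (congrArg Flag.edge h) j

end Flags

/-! ### Chains carried by an edge, and the chain of a flag -/

variable {T m N : ℕ} [NeZero T]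

/-- The span of the multilinear monomials whose edge is contained in `L`. -/
def edgeSpan (T : ℕ) [NeZero T] {m N : ℕ} (ω : ℂ) (z : Fin N → ℂ) (p : ℕ)
    (L : AffineSubspace ℂ (Fin m → ℂ)) : Submodule ℂ (Chains (nbar T m) (ModM T m N) p) :=
  Submodule.span ℂ {u | ∃ y : Mono T m N p, y.weight = 1 ∧ y.edge ω z ≤ L ∧ u = y.eval}

variable {ω : ℂ} {z : Fin N → ℂ}

theorem eval_mem_edgeSpan {p : ℕ} {L : AffineSubspace ℂ (Fin m → ℂ)} (y : Mono T m N p)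
    (hy : y.weight = 1) (hL : y.edge ω z ≤ L) : y.eval ∈ edgeSpan T ω z p L :=
  Submodule.subset_span ⟨y, hy, hL, rfl⟩

theorem edgeSpan_le_weightSpace (p : ℕ) (L : AffineSubspace ℂ (Fin m → ℂ)) :
    edgeSpan T ω z p L ≤ weightSpace T m N p 1 :=
  Submodule.span_mono fun _ ⟨y, hy, _, h⟩ => ⟨y, hy, h⟩

theorem linearMap_eq_on_edgeSpan {p : ℕ} {L : AffineSubspace ℂ (Fin m → ℂ)} {P : Type*}
    [AddCommGroup P] [Module ℂ P] {f g : Chains (nbar T m) (ModM T m N) p →ₗ[ℂ] P}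
    (h : ∀ y : Mono T m N p, y.weight = 1 → y.edge ω z ≤ L → f y.eval = g y.eval)
    {u : Chains (nbar T m) (ModM T m N) p} (hu : u ∈ edgeSpan T ω z p L) : f u = g u := by
  have : edgeSpan T ω z p L ≤ LinearMap.eqLocus f g := by
    unfold edgeSpan
    rw [Submodule.span_le]
    rintro _ ⟨y, hy, hL, rfl⟩
    exact h y hy hL
  exact this hu

/-- Every term of the differential of a monomial imposes further equations on its islands and drops
none. -/
theorem ceD_mem_edgeSpan (hω : ω ^ T = 1) {p : ℕ} {L : AffineSubspace ℂ (Fin m → ℂ)}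
    {u : Chains (nbar T m) (ModM T m N) (p + 1)} (hu : u ∈ edgeSpan T ω z (p + 1) L) :
    ceD (nbar T m) (ModM T m N) p u ∈ edgeSpan T ω z p L := by
  refine (Submodule.span_le (p := (edgeSpan T ω z p L).comap
    (ceD (nbar T m) (ModM T m N) p))).2 ?_ hu
  rintro _ ⟨y, hy, hL, rfl⟩
  change ceD (nbar T m) (ModM T m N) p y.eval ∈ edgeSpan T ω z p L
  rw [Mono.ceD_eval]
  refine Submodule.add_mem _ (Submodule.sum_mem _ fun a _ => Submodule.smul_mem _ _
    (Submodule.add_mem _ ?_ (Submodule.sum_mem _ fun j _ => Submodule.sum_mem _ fun k _ => ?_))) ?_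
  · exact eval_mem_edgeSpan _ ((y.weight_termZero a).trans hy)
      fun t ht => hL (Mono.mem_edge_termZero ht).1
  · exact eval_mem_edgeSpan _ ((y.weight_termPoint a j k).trans hy)
      fun t ht => hL (Mono.mem_edge_termPoint hω ht).1
  · cases p with
    | zero => exact Submodule.zero_mem _
    | succ n =>
      refine Submodule.sum_mem _ fun a _ => Submodule.sum_mem _ fun b hb =>
        Submodule.smul_mem _ _ (Submodule.sum_mem _ fun k _ => ?_)
      exact eval_mem_edgeSpan _ ((y.weight_termBracket (Finset.mem_Ici.1 hb) k).trans hy)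
        fun t ht => hL (Mono.mem_edge_termBracket hω (Finset.mem_Ici.1 hb) ht).1

/-- All edges of monomials with `p` wedge factors have dimension `p`. For `L` of this dimension the
projection `edgeProj` therefore keeps exactly the monomials with edge `L`. -/
theorem Mono.eq_edge_of_le (hω : ω ^ T = 1) {p : ℕ} {L : AffineSubspace ℂ (Fin m → ℂ)}
    (hL : (L : Set (Fin m → ℂ)).Nonempty) (hd : Module.finrank ℂ L.direction = p)
    {y : Mono T m N p} (hy : y.weight = 1) (h : L ≤ y.edge ω z) : L = y.edge ω z :=
  affine_eq_of_le_of_finrank hL h (by rw [hd, y.finrank_edge hω hy])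

theorem Mono.edgeProj_eval_of_not_le (hω : ω ^ T = 1) {p : ℕ} {L : AffineSubspace ℂ (Fin m → ℂ)}
    {x : Mono T m N p} (h : ¬ L ≤ x.edge ω z) : edgeProj T ω z p L x.eval = 0 := by
  classical rw [edgeProj_eval hω, if_neg h]

theorem edgeProj_mem_edgeSpan (hω : ω ^ T = 1) {p : ℕ} {K L : AffineSubspace ℂ (Fin m → ℂ)}
    (hL : (L : Set (Fin m → ℂ)).Nonempty) (hd : Module.finrank ℂ L.direction = p)
    {u : Chains (nbar T m) (ModM T m N) p} (hu : u ∈ edgeSpan T ω z p K) :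
    edgeProj T ω z p L u ∈ edgeSpan T ω z p L := by
  refine (Submodule.span_le (p := (edgeSpan T ω z p L).comap (edgeProj T ω z p L))).2 ?_ hu
  rintro _ ⟨y, hy, hK, rfl⟩
  change edgeProj T ω z p L y.eval ∈ edgeSpan T ω z p L
  by_cases h : L ≤ y.edge ω z
  · rw [Mono.edgeProj_eval_of_le hω h]
    exact eval_mem_edgeSpan y hy (Mono.eq_edge_of_le hω hL hd hy h).ge
  · rw [Mono.edgeProj_eval_of_not_le hω h]
    exact Submodule.zero_mem _

theorem edgeProj_of_mem_edgeSpan (hω : ω ^ T = 1) {p : ℕ} {L : AffineSubspace ℂ (Fin m → ℂ)}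
    (hd : Module.finrank ℂ L.direction = p)
    {u : Chains (nbar T m) (ModM T m N) p} (hu : u ∈ edgeSpan T ω z p L) :
    edgeProj T ω z p L u = u := by
  refine linearMap_eq_on_edgeSpan (g := LinearMap.id) (fun y hy h => ?_) hu
  have : y.edge ω z = L := by
    obtain ⟨t, ht, -⟩ := y.exists_mem_edge (z := z) hω hy 0
    exact affine_eq_of_le_of_finrank ⟨t, ht⟩ h (by rw [hd, y.finrank_edge hω hy])
  rw [Mono.edgeProj_eval_of_le hω this.ge, LinearMap.id_apply]

/-- A monomial whose edge does not contain `L` is sent by `d` to monomials with smaller edges, which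
do not contain `L` either. Discarding it before applying `d` makes no difference. -/
theorem edgeProj_ceD_edgeProj (hω : ω ^ T = 1) {p : ℕ} {K L : AffineSubspace ℂ (Fin m → ℂ)}
    {u : Chains (nbar T m) (ModM T m N) (p + 1)} (hu : u ∈ edgeSpan T ω z (p + 1) K) :
    edgeProj T ω z p L (ceD (nbar T m) (ModM T m N) p (edgeProj T ω z (p + 1) L u)) =
      edgeProj T ω z p L (ceD (nbar T m) (ModM T m N) p u) := by
  refine linearMap_eq_on_edgeSpan
    (f := edgeProj T ω z p L ∘ₗ ceD (nbar T m) (ModM T m N) p ∘ₗ edgeProj T ω z (p + 1) L)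
    (g := edgeProj T ω z p L ∘ₗ ceD (nbar T m) (ModM T m N) p) (fun y hy _ => ?_) hu
  simp only [LinearMap.comp_apply]
  by_cases h : L ≤ y.edge ω z
  · rw [Mono.edgeProj_eval_of_le hω h]
  · rw [Mono.edgeProj_eval_of_not_le hω h, map_zero, map_zero]
    have h1 := ceD_mem_edgeSpan (p := p) hω (eval_mem_edgeSpan y hy (le_refl (y.edge ω z)))
    symm
    refine linearMap_eq_on_edgeSpan (g := 0) (fun y' _ h' => ?_) h1
    rw [Mono.edgeProj_eval_of_not_le hω fun h'' => h (h''.trans h'), LinearMap.zero_apply]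

/-- The monomial `f̄_1 ∧ ⋯ ∧ f̄_m`, where `m` is given in a different form. -/
def Mono.baseOf (T : ℕ) {m : ℕ} (N : ℕ) {p : ℕ} (h : p = m) : Mono T m N p where
  wedge a := Comm.gen 0 (Fin.cast h a)
  zero := []
  point _ := []

omit [NeZero T] in
theorem Mono.weight_baseOf {p : ℕ} (h : p = m) : (Mono.baseOf T N h).weight = 1 := by
  subst h
  exact Mono.weight_base

/-- The chain which corresponds to a flag, the component of the iterated differential along
the edges of the flag. -/
def flagVec : ∀ (k p : ℕ) (_ : p + k = m) (_ : Flag (cda T m ω z) k),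
    Chains (nbar T m) (ModM T m N) p
  | 0, _, h, _ => (Mono.baseOf T N h).eval
  | k + 1, p, h, F => edgeProj T ω z p F.last
      (ceD (nbar T m) (ModM T m N) p (flagVec k (p + 1) (by omega) F.init))

omit [NeZero T] in
theorem Flag.finrank_last_eq {k p : ℕ} (h : p + k = m) (F : Flag (cda T m ω z) k) :
    Module.finrank ℂ F.last.direction = p := by
  have := F.finrank_last
  rw [Module.finrank_fin_fun] at this
  omega

theorem flagVec_mem (hω : ω ^ T = 1) : ∀ (k p : ℕ) (h : p + k = m) (F : Flag (cda T m ω z) k),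
    flagVec k p h F ∈ edgeSpan T ω z p F.last
  | 0, p, h, F => by
    refine eval_mem_edgeSpan _ (Mono.weight_baseOf _) ?_
    rw [F.eq_trivialFlag]
    exact le_top
  | k + 1, p, h, F => edgeProj_mem_edgeSpan hω F.isEdge_last.1 (F.finrank_last_eq h)
      (ceD_mem_edgeSpan hω (flagVec_mem hω k (p + 1) (by omega) F.init))

/-- The extension of a flag by the edge of a monomial. -/
def Flag.extendMono (hω : IsPrimitiveRoot ω T) {k p : ℕ} (h : p + (k + 1) = m)
    (F : Flag (cda T m ω z) k) (y : Mono T m N p) (hy : y.weight = 1) (hF : y.edge ω z ≤ F.last) :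
    Flag (cda T m ω z) (k + 1) :=
  F.extend (y.edge ω z) (y.isEdge_edge hω hy)
    (by rw [y.finrank_edge hω.pow_eq_one hy, Module.finrank_fin_fun, h]) hF

open scoped Classical in
-- The edge of a monomial inside `F.last` extends `F` in exactly one way, and only the projection of
-- that extension keeps the monomial.
theorem sum_edgeProj_last (hω : IsPrimitiveRoot ω T) {k p : ℕ} (h : p + (k + 1) = m)
    (F : Flag (cda T m ω z) k) {u : Chains (nbar T m) (ModM T m N) p}
    (hu : u ∈ edgeSpan T ω z p F.last) :
    ∑ G : Flag (cda T m ω z) (k + 1) with G.init = F, edgeProj T ω z p G.last u = u := by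
  rw [← LinearMap.sum_apply]
  refine linearMap_eq_on_edgeSpan (g := LinearMap.id) (fun y hy hF => ?_) hu
  rw [LinearMap.sum_apply, LinearMap.id_apply,
    Finset.sum_eq_single (F.extendMono hω h y hy hF)]
  · exact Mono.edgeProj_eval_of_le hω.pow_eq_one (Flag.extend_last ..).le
  · intro G hG hne
    refine Mono.edgeProj_eval_of_not_le hω.pow_eq_one fun hle => hne ?_
    refine Flag.ext_init_last ((Finset.mem_filter.1 hG).2.trans (Flag.extend_init ..).symm) ?_
    rw [Mono.eq_edge_of_le hω.pow_eq_one G.isEdge_last.1 (G.finrank_last_eq h) hy hle]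
    exact (Flag.extend_last ..).symm
  · intro hn
    have := Flag.extend_init F (y.edge ω z) (y.isEdge_edge hω hy)
      (by rw [y.finrank_edge hω.pow_eq_one hy, Module.finrank_fin_fun, h]) hF
    exact absurd (Finset.mem_filter (p := fun G : Flag (cda T m ω z) (k + 1) => G.init = F).2
      ⟨Finset.mem_univ (F.extendMono hω h y hy hF), this⟩) hn

open scoped Classical in
theorem sum_flagVec_init (hω : IsPrimitiveRoot ω T) {k p : ℕ} (h : p + (k + 1) = m)
    (h' : p + 1 + k = m) (F : Flag (cda T m ω z) k) :
    ∑ G : Flag (cda T m ω z) (k + 1) with G.init = F, flagVec (k + 1) p h G =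
      ceD (nbar T m) (ModM T m N) p (flagVec k (p + 1) h' F) := by
  rw [← sum_edgeProj_last hω h F
    (ceD_mem_edgeSpan hω.pow_eq_one (flagVec_mem hω.pow_eq_one k (p + 1) h' F))]
  refine Finset.sum_congr rfl fun G hG => ?_
  obtain rfl := (Finset.mem_filter.1 hG).2
  rfl

open scoped Classical in
-- The completions of the gap run over the edges between the two neighbouring ones. The projections
-- onto these edges add up to the projection onto all monomials whose edge contains `L`, and the
-- latter can be omitted in front of `d` and the projection to `L`. The result is a projection of `d
-- (d u)`, which is zero.
theorem sum_flagVec_gap_last (hω : IsPrimitiveRoot ω T) {k p : ℕ} (h : p + (k + 2) = m)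
    (F : Flag (cda T m ω z) (k + 2)) :
    ∑ G : Flag (cda T m ω z) (k + 2) with
      ∀ j, j ≠ (Fin.last (k + 1)).castSucc → G.edge j = F.edge j, flagVec (k + 2) p h G = 0 := by
  have hω1 := hω.pow_eq_one
  set L := F.last with hL
  set u := ceD (nbar T m) (ModM T m N) (p + 1)
    (flagVec k (p + 2) (by omega) F.init.init) with hu
  have hum : u ∈ edgeSpan T ω z (p + 1) F.init.init.last :=
    ceD_mem_edgeSpan hω1 (flagVec_mem hω1 _ _ _ _)
  have hagree : ∀ G : Flag (cda T m ω z) (k + 2),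
      (∀ j, j ≠ (Fin.last (k + 1)).castSucc → G.edge j = F.edge j) ↔
        G.init.init = F.init.init ∧ G.last = L := fun G => by
    rw [Flag.agree_castSucc_iff, Flag.agree_last_iff]
  have h1 : ∑ G : Flag (cda T m ω z) (k + 2) with
      ∀ j, j ≠ (Fin.last (k + 1)).castSucc → G.edge j = F.edge j, flagVec (k + 2) p h G =
      edgeProj T ω z p L (ceD (nbar T m) (ModM T m N) p
        (∑ G : Flag (cda T m ω z) (k + 2) with
          ∀ j, j ≠ (Fin.last (k + 1)).castSucc → G.edge j = F.edge j,
          edgeProj T ω z (p + 1) G.init.last u)) := by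
    rw [map_sum, map_sum]
    refine Finset.sum_congr rfl fun G hG => ?_
    obtain ⟨hi, hl⟩ := (hagree G).1 (Finset.mem_filter.1 hG).2
    simp only [flagVec]
    rw [hi, hl]
  -- A monomial whose edge contains `L` determines one completion of the gap; a monomial whose edge
  -- does not contain `L` is killed on both sides.
  have h2 : edgeProj T ω z p L (ceD (nbar T m) (ModM T m N) p
        (∑ G : Flag (cda T m ω z) (k + 2) with
          ∀ j, j ≠ (Fin.last (k + 1)).castSucc → G.edge j = F.edge j,
          edgeProj T ω z (p + 1) G.init.last u)) =
      edgeProj T ω z p L (ceD (nbar T m) (ModM T m N) p (edgeProj T ω z (p + 1) L u)) := by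
    rw [← LinearMap.sum_apply]
    refine linearMap_eq_on_edgeSpan
      (f := edgeProj T ω z p L ∘ₗ ceD (nbar T m) (ModM T m N) p ∘ₗ _)
      (g := edgeProj T ω z p L ∘ₗ ceD (nbar T m) (ModM T m N) p ∘ₗ edgeProj T ω z (p + 1) L)
      (fun y hy hF => ?_) hum
    simp only [LinearMap.comp_apply, LinearMap.sum_apply]
    by_cases hle : L ≤ y.edge ω z
    · rw [Mono.edgeProj_eval_of_le hω1 hle]
      set G₁ := F.init.init.extendMono hω (by omega) y hy hF with hG₁
      have hl₁ : G₁.last = y.edge ω z := Flag.extend_last ..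
      have hi₁ : G₁.init = F.init.init := Flag.extend_init ..
      set G₂ := G₁.extend L F.isEdge_last F.finrank_last (hl₁.symm ▸ hle) with hG₂
      have hl₂ : G₂.last = L := Flag.extend_last ..
      have hi₂ : G₂.init = G₁ := Flag.extend_init ..
      rw [Finset.sum_eq_single G₂]
      · rw [Mono.edgeProj_eval_of_le hω1]
        rw [hi₂, hl₁]
      · intro G hG hne
        obtain ⟨hi, hl⟩ := (hagree G).1 (Finset.mem_filter.1 hG).2
        refine Mono.edgeProj_eval_of_not_le hω1 fun hle' => hne ?_
        refine Flag.ext_init_last (hi₂.symm ▸ Flag.ext_init_last ?_ ?_) (hl.trans hl₂.symm)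
        · rw [hi, hi₁]
        · rw [hl₁, Mono.eq_edge_of_le hω1 G.init.isEdge_last.1
            (G.init.finrank_last_eq (by omega)) hy hle']
      · intro hn
        refine absurd (Finset.mem_filter.2 ⟨Finset.mem_univ _, (hagree G₂).2 ⟨?_, hl₂⟩⟩) hn
        rw [hi₂, hi₁]
    · rw [Mono.edgeProj_eval_of_not_le hω1 hle, Finset.sum_eq_zero]
      intro G hG
      obtain ⟨hi, hl⟩ := (hagree G).1 (Finset.mem_filter.1 hG).2
      refine Mono.edgeProj_eval_of_not_le hω1 fun hle' => hle ?_
      rw [← hl]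
      exact G.last_le.trans hle'
  rw [h1, h2, edgeProj_ceD_edgeProj hω1 hum, hu]
  have := LinearMap.congr_fun (ceD_ceD (L := nbar T m) (M := ModM T m N) p)
    (flagVec k (p + 2) (by omega) F.init.init)
  rw [LinearMap.comp_apply, LinearMap.zero_apply] at this
  rw [this, map_zero]

open scoped Classical in
-- For a gap further up, the edges below it are shared by all completions, so the same linear map is
-- applied to all the terms of a sum which vanishes by induction.
theorem sum_flagVec_gap (hω : IsPrimitiveRoot ω T) : ∀ {k p : ℕ} (h : p + k = m)
    (F : Flag (cda T m ω z) k) (i : Fin (k + 1)) (_ : 0 < (i : ℕ)) (_ : (i : ℕ) < k),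
    ∑ G : Flag (cda T m ω z) k with ∀ j, j ≠ i → G.edge j = F.edge j, flagVec k p h G = 0
  | 0, _, _, _, _, _, hi => absurd hi (Nat.not_lt_zero _)
  | k + 1, p, h, F, i, h0, hi => by
    induction i using Fin.lastCases with
    | last => exact absurd hi (lt_irrefl _)
    | cast i =>
      induction i using Fin.lastCases with
      | last =>
        cases k with
        | zero => exact absurd h0 (lt_irrefl _)
        | succ k => exact sum_flagVec_gap_last hω h F
      | cast i =>
        have ih := sum_flagVec_gap hω (k := k) (p := p + 1) (by omega) F.init i.castSucc h0
          i.is_lt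
        have : ∑ G : Flag (cda T m ω z) (k + 1) with
            ∀ j, j ≠ i.castSucc.castSucc → G.edge j = F.edge j, flagVec (k + 1) p h G =
            edgeProj T ω z p F.last (ceD (nbar T m) (ModM T m N) p
              (∑ G : Flag (cda T m ω z) k with ∀ j, j ≠ i.castSucc → G.edge j = F.init.edge j,
                flagVec k (p + 1) (by omega) G)) := by
          rw [map_sum, map_sum]
          have hlast : ∀ G : Flag (cda T m ω z) k,
              (∀ j, j ≠ i.castSucc → G.edge j = F.init.edge j) → F.last ≤ G.last := by
            intro G hG
            have : G.last = F.init.last := hG _ (Fin.castSucc_lt_last i).ne'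
            rw [this]
            exact F.last_le
          -- Completions of `F` correspond to those of its initial part by removing or adding the
          -- common last edge.
          refine Finset.sum_bij' (fun G _ => G.init)
            (fun G hG => G.extend F.last F.isEdge_last F.finrank_last
              (hlast G (Finset.mem_filter.1 hG).2)) ?_ ?_ ?_ ?_ ?_
          · intro G hG
            exact Finset.mem_filter.2 ⟨Finset.mem_univ _,
              (Flag.agree_castSucc_iff.1 (Finset.mem_filter.1 hG).2).1⟩
          · intro G hG
            refine Finset.mem_filter.2 ⟨Finset.mem_univ _, Flag.agree_castSucc_iff.2 ⟨?_, ?_⟩⟩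
            · rw [Flag.extend_init]
              exact (Finset.mem_filter.1 hG).2
            · rw [Flag.extend_last]
          · intro G hG
            refine Flag.ext_init_last ?_ ?_
            · rw [Flag.extend_init]
            · rw [Flag.extend_last]
              exact (Flag.agree_castSucc_iff.1 (Finset.mem_filter.1 hG).2).2.symm
          · intro G hG
            rw [Flag.extend_init]
          · intro G hG
            simp only [flagVec]
            rw [(Flag.agree_castSucc_iff.1 (Finset.mem_filter.1 hG).2).2]
        rw [this, ih, map_zero, map_zero]

/-- The linear map from flags to multilinear chains. -/
def flagLin {k p : ℕ} (h : p + k = m) : (Flag (cda T m ω z) k →₀ ℂ) →ₗ[ℂ]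
    Chains (nbar T m) (ModM T m N) p :=
  Finsupp.linearCombination ℂ (flagVec k p h)

theorem flagLin_single {k p : ℕ} (h : p + k = m) (F : Flag (cda T m ω z) k) :
    flagLin h (Finsupp.single F 1) = flagVec k p h F := by
  rw [flagLin, Finsupp.linearCombination_single, one_smul]

theorem flagLin_mem (hω : ω ^ T = 1) {k p : ℕ} (h : p + k = m) (u : Flag (cda T m ω z) k →₀ ℂ) :
    flagLin h u ∈ multilinearPart T m N p := by
  rw [flagLin, Finsupp.linearCombination_apply]
  exact Submodule.sum_mem _ fun F _ => Submodule.smul_mem _ _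
    (edgeSpan_le_weightSpace _ _ (flagVec_mem hω k p h F))

theorem flagRelations_le_ker (hω : IsPrimitiveRoot ω T) {k p : ℕ} (h : p + k = m) :
    flagRelations (cda T m ω z) k ≤
      LinearMap.ker ((flagLin h).codRestrict (multilinearPart T m N p)
        (flagLin_mem hω.pow_eq_one h)) := by
  unfold flagRelations
  rw [Submodule.span_le]
  rintro _ ⟨F, i, h0, hi, rfl⟩
  rw [SetLike.mem_coe, LinearMap.mem_ker]
  apply Subtype.ext
  rw [LinearMap.codRestrict_apply, gapSum, map_sum]
  simp only [flagLin_single]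
  exact sum_flagVec_gap hω h F i h0 hi

/-- The linear map from the flag space to multilinear chains. -/
def flagMap (hω : IsPrimitiveRoot ω T) (z : Fin N → ℂ) {k p : ℕ} (h : p + k = m) :
    FlagSpace (cda T m ω z) k →ₗ[ℂ] multilinearPart T m N p :=
  Submodule.liftQ _ ((flagLin h).codRestrict (multilinearPart T m N p)
    (flagLin_mem hω.pow_eq_one h)) (flagRelations_le_ker hω h)

theorem coe_flagMap_flagClass (hω : IsPrimitiveRoot ω T) {k p : ℕ} (h : p + k = m)
    (F : Flag (cda T m ω z) k) :
    (flagMap hω z h (flagClass F) : Chains (nbar T m) (ModM T m N) p) = flagVec k p h F := by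
  rw [← flagLin_single]
  rfl

theorem flagSpace_hom_ext {V : Type*} [AddCommGroup V] [Module ℂ V]
    {𝒜 : Set (AffineSubspace ℂ V)} [Finite 𝒜] {k : ℕ} {P : Type*} [AddCommGroup P] [Module ℂ P]
    {f g : FlagSpace 𝒜 k →ₗ[ℂ] P} (h : ∀ F, f (flagClass F) = g (flagClass F)) : f = g := by
  refine Submodule.linearMap_qext _ (Finsupp.lhom_ext' fun F => LinearMap.ext_ring ?_)
  exact h F

/-- On the class of a flag this says that the components of the differential over all possible next
edges sum to the whole differential. -/
theorem multilinearD_flagMap (hω : IsPrimitiveRoot ω T) {k p : ℕ} (h : p + 1 + k = m)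
    (h' : p + (k + 1) = m) (u : FlagSpace (cda T m ω z) k) :
    multilinearD T m N p (flagMap hω z h u) = flagMap hω z h' (flagD (cda T m ω z) k u) := by
  refine LinearMap.congr_fun (f := multilinearD T m N p ∘ₗ flagMap hω z h)
    (g := flagMap hω z h' ∘ₗ flagD (cda T m ω z) k) (flagSpace_hom_ext fun F => ?_) u
  apply Subtype.ext
  rw [LinearMap.comp_apply, LinearMap.comp_apply, flagD_flagClass, map_sum,
    AddSubmonoidClass.coe_finsetSum]
  simp only [coe_flagMap_flagClass]
  rw [sum_flagVec_init hω h' h, ← coe_flagMap_flagClass hω h]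
  rfl

end

section

/-! ### Words -/

section Words

variable {X : Type*}

/-- The elements of the free algebra all of whose words lie in `P`. -/
def wordSpan (P : Set (FreeMonoid X)) : Submodule ℂ (MonoidAlgebra ℂ (FreeMonoid X)) where
  carrier := {x | ∀ w, x.coeff w ≠ 0 → w ∈ P}
  zero_mem' w h := absurd rfl h
  add_mem' {x y} hx hy w h := by
    by_cases h' : x.coeff w = 0
    · refine hy w fun h'' => h ?_
      rw [MonoidAlgebra.coeff_add, Finsupp.add_apply, h', h'', add_zero]
    · exact hx w h'
  smul_mem' c x hx w h := hx w fun h' => h (by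
    rw [MonoidAlgebra.coeff_smul, Finsupp.smul_apply, h', smul_zero])

variable {P Q R : Set (FreeMonoid X)} {x y : MonoidAlgebra ℂ (FreeMonoid X)}

theorem exists_mul_of_coeff_mul_ne_zero {w : FreeMonoid X} (h : (x * y).coeff w ≠ 0) :
    ∃ u v, u * v = w ∧ x.coeff u ≠ 0 ∧ y.coeff v ≠ 0 := by
  classical
  rw [MonoidAlgebra.coeff_mul] at h
  obtain ⟨u, hu, h⟩ := Finset.exists_ne_zero_of_sum_ne_zero h
  obtain ⟨v, hv, h⟩ := Finset.exists_ne_zero_of_sum_ne_zero h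
  refine ⟨u, v, ?_, Finsupp.mem_support_iff.1 hu, Finsupp.mem_support_iff.1 hv⟩
  by_contra hne
  exact h (if_neg hne)

theorem mul_mem_wordSpan (hx : x ∈ wordSpan P) (hy : y ∈ wordSpan Q)
    (h : ∀ u ∈ P, ∀ v ∈ Q, u * v ∈ R) : x * y ∈ wordSpan R := by
  intro w hw
  obtain ⟨u, v, rfl, hu, hv⟩ := exists_mul_of_coeff_mul_ne_zero hw
  exact h u (hx u hu) v (hy v hv)

theorem of_mem_wordSpan {w : FreeMonoid X} (h : w ∈ P) :
    MonoidAlgebra.of ℂ (FreeMonoid X) w ∈ wordSpan P := by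
  classical
  intro v hv
  rw [MonoidAlgebra.of_apply, MonoidAlgebra.coeff_single, Finsupp.single_apply] at hv
  by_cases hvw : w = v
  · exact hvw ▸ h
  · exact absurd (if_neg hvw) hv

theorem eq_zero_of_mem_wordSpan (hx : x ∈ wordSpan P) (hx' : x ∈ wordSpan Q)
    (h : Disjoint P Q) : x = 0 := by
  by_contra hne
  have : x.coeff ≠ 0 := fun e => hne (MonoidAlgebra.coeff_eq_zero.1 e)
  obtain ⟨w, hw⟩ := Finsupp.ne_iff.1 this
  exact Set.disjoint_left.1 h (hx w hw) (hx' w hw)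

/-- The words whose first letter is in `S`. -/
def headIn (S : Set X) : Set (FreeMonoid X) := {w | ∃ a ∈ S, ∃ v, w = FreeMonoid.of a * v}

theorem headIn_disjoint {S S' : Set X} (h : Disjoint S S') : Disjoint (headIn S) (headIn S') := by
  refine Set.disjoint_left.2 ?_
  rintro _ ⟨a, ha, v, rfl⟩ ⟨b, hb, v', e⟩
  have e' := congrArg FreeMonoid.toList e
  simp only [FreeMonoid.toList_mul, FreeMonoid.toList_of, List.singleton_append,
    List.cons.injEq] at e'
  exact Set.disjoint_left.1 h ha (e'.1 ▸ hb)

theorem mul_mem_headIn {S : Set X} (hx : x ∈ wordSpan (headIn S)) :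
    x * y ∈ wordSpan (headIn S) := by
  refine mul_mem_wordSpan hx (Q := Set.univ) (fun _ _ => trivial) ?_
  rintro _ ⟨a, ha, v, rfl⟩ u -
  exact ⟨a, ha, v * u, mul_assoc _ _ _⟩

end Words

-- Free associative algebras detect that monomials do not vanish

attribute [local instance] LieRing.ofAssociativeRing

variable {T m N : ℕ}

/-- The free algebra on the letters `(k, i)`, with its basis of words. -/
abbrev WordAlg (T m : ℕ) : Type := MonoidAlgebra ℂ (FreeMonoid (ZMod T × Fin m))

variable (T m) in
/-- The embedding of the free Lie algebra into the free associative algebra. -/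
def wordHom : FreeLie T m →ₗ⁅ℂ⁆ WordAlg T m :=
  FreeLieAlgebra.lift ℂ fun a => MonoidAlgebra.of ℂ _ (FreeMonoid.of a)

theorem wordHom_gen (k : ZMod T) (i : Fin m) :
    wordHom T m (Comm.gen k i).eval = MonoidAlgebra.of ℂ _ (FreeMonoid.of (k, i)) := by
  simp [wordHom, Comm.eval]

theorem wordHom_br (g h : Comm T m) :
    wordHom T m (Comm.br g h).eval = wordHom T m g.eval * wordHom T m h.eval -
      wordHom T m h.eval * wordHom T m g.eval := by
  rw [Comm.eval, LieHom.map_lie, LieRing.of_associative_ring_bracket]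

theorem wordHom_eval_mem (g : Comm T m) :
    wordHom T m g.eval ∈ wordSpan (headIn {a | a ∈ g.content}) := by
  have mono : ∀ {S S' : Set (ZMod T × Fin m)} {x : WordAlg T m}, S ⊆ S' →
      x ∈ wordSpan (headIn S) → x ∈ wordSpan (headIn S') := fun hS hx w hw =>
    let ⟨a, ha, h⟩ := hx w hw; ⟨a, hS ha, h⟩
  induction g with
  | gen k i =>
    rw [wordHom_gen]
    exact of_mem_wordSpan ⟨(k, i), by simp [Comm.content], 1, (mul_one _).symm⟩
  | br g h ihg ihh =>
    rw [wordHom_br]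
    refine Submodule.sub_mem _ (mono ?_ (mul_mem_headIn ihg)) (mono ?_ (mul_mem_headIn ihh))
    · exact fun a ha => List.mem_append_left _ ha
    · exact fun a ha => List.mem_append_right _ ha

/-- In `[g, h] = g h - h g` the words of the two products start with letters of `g` and of `h`
respectively. When the letters are distinct nothing cancels, and the free algebra has no zero
divisors. -/
theorem wordHom_eval_ne_zero (g : Comm T m) (hg : g.content.Nodup) :
    wordHom T m g.eval ≠ 0 := by
  induction g with
  | gen k i =>
    rw [wordHom_gen, MonoidAlgebra.of_apply]
    exact MonoidAlgebra.single_ne_zero.2 one_ne_zero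
  | br g h ihg ihh =>
    rw [Comm.content, List.nodup_append'] at hg
    rw [wordHom_br, sub_ne_zero]
    intro e
    have h1 : wordHom T m g.eval * wordHom T m h.eval ∈ wordSpan (headIn {a | a ∈ h.content}) := by
      rw [e]
      exact mul_mem_headIn (wordHom_eval_mem h)
    exact mul_ne_zero (ihg hg.1) (ihh hg.2.1) (eq_zero_of_mem_wordSpan
      (mul_mem_headIn (wordHom_eval_mem g)) h1
      (headIn_disjoint (Set.disjoint_left.2 fun a ha hb => hg.2.2 ha hb)))

variable [NeZero T]

/-- Each index occurs once, with one label, so the letters of a proper translate `τʲ g` differ from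
all letters of `g`. Its words start differently and cannot cancel those of `g`. -/
theorem wordHom_bar_ne_zero (g : Comm T m) (hg : (g.content.map Prod.snd).Nodup) :
    wordHom T m (bar T m g.eval : FreeLie T m) ≠ 0 := by
  intro h
  rw [coe_bar, map_sum, ← Finset.add_sum_erase _ _ (Finset.mem_univ 0), ← Comm.eval_shift,
    Comm.shift_zero, add_eq_zero_iff_eq_neg] at h
  refine wordHom_eval_ne_zero g (List.Nodup.of_map _ hg) (eq_zero_of_mem_wordSpan
    (wordHom_eval_mem g) (Q := headIn {a | a ∉ g.content}) ?_ (headIn_disjoint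
      (Set.disjoint_left.2 fun a ha hb => hb ha)))
  rw [h]
  refine Submodule.neg_mem _ (Submodule.sum_mem _ fun j hj => ?_)
  rw [← Comm.eval_shift]
  intro w hw
  obtain ⟨a, ha, h'⟩ := wordHom_eval_mem _ w hw
  refine ⟨a, fun ha' => Finset.ne_of_mem_erase hj ?_, h'⟩
  rw [Set.mem_ofPred_eq, Comm.content_shift] at ha
  obtain ⟨b, hb, rfl⟩ := List.mem_map.1 ha
  have : b = (b.1 + j, b.2) := List.inj_on_of_nodup_map hg hb ha' rfl
  simpa using (congrArg Prod.fst this)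

/-- The homomorphism from `U(𝔞)` to the free associative algebra. -/
def envWord (T m : ℕ) : UniversalEnvelopingAlgebra ℂ (FreeLie T m) →ₐ[ℂ] WordAlg T m :=
  UniversalEnvelopingAlgebra.lift ℂ (wordHom T m)

/-- The homomorphism from `U(𝔫̄)` to the free associative algebra. -/
def envWordBar (T m : ℕ) : UniversalEnvelopingAlgebra ℂ (nbar T m) →ₐ[ℂ] WordAlg T m :=
  UniversalEnvelopingAlgebra.lift ℂ ((wordHom T m).comp (nbar T m).incl)

omit [NeZero T] in
theorem envWord_prod (l : List (Comm T m)) :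
    envWord T m (l.map fun g => UniversalEnvelopingAlgebra.ι ℂ g.eval).prod =
      (l.map fun g => wordHom T m g.eval).prod := by
  rw [map_list_prod, List.map_map]
  congr 2
  funext g
  simp [envWord]

theorem envWordBar_prod (l : List (Comm T m)) :
    envWordBar T m (l.map fun g => UniversalEnvelopingAlgebra.ι ℂ (bar T m g.eval)).prod =
      (l.map fun g => wordHom T m (bar T m g.eval : FreeLie T m)).prod := by
  rw [map_list_prod, List.map_map]
  congr 2
  funext g
  simp [envWordBar]

/-- The linear form on chains which is the product of linear forms on the factors. -/
def chainForm {p : ℕ} (φ : (⋀[ℂ]^p (nbar T m)) →ₗ[ℂ] ℂ) (f : WordAlg T m →ₗ[ℂ] ℂ)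
    (fp : Fin N → WordAlg T m →ₗ[ℂ] ℂ) : Chains (nbar T m) (ModM T m N) p →ₗ[ℂ] ℂ :=
  TensorProduct.lift ((LinearMap.mul ℂ ℂ).compl₁₂ φ
    (TensorProduct.lift ((LinearMap.mul ℂ ℂ).compl₁₂ (f ∘ₗ (envWordBar T m).toLinearMap)
      (PiTensorProduct.lift ((MultilinearMap.mkPiAlgebra ℂ (Fin N) ℂ).compLinearMap
        fun j => fp j ∘ₗ (envWord T m).toLinearMap)))))

theorem chainForm_eval {p : ℕ} (φ : (⋀[ℂ]^p (nbar T m)) →ₗ[ℂ] ℂ) (f : WordAlg T m →ₗ[ℂ] ℂ)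
    (fp : Fin N → WordAlg T m →ₗ[ℂ] ℂ) (x : Mono T m N p) :
    chainForm φ f fp x.eval =
      φ (exteriorPower.ιMulti ℂ p (fun a => bar T m (x.wedge a).eval)) *
        (f (x.zero.map fun g => wordHom T m (bar T m g.eval : FreeLie T m)).prod *
          ∏ j, fp j ((x.point j).map fun g => wordHom T m g.eval).prod) := by
  simp only [chainForm, Mono.eval, TensorProduct.lift.tmul, LinearMap.compl₁₂_apply,
    LinearMap.mul_apply', PiTensorProduct.lift.tprod, MultilinearMap.compLinearMap_apply,
    MultilinearMap.mkPiAlgebra_apply, LinearMap.comp_apply, AlgHom.toLinearMap_apply,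
    envWord_prod, envWordBar_prod]

omit [NeZero T] in
theorem Mono.nodup_content {p : ℕ} {x : Mono T m N p} (hx : x.weight = 1) {g : Comm T m}
    (h : g.weight ≤ x.weight) : (g.content.map Prod.snd).Nodup := by
  rw [List.nodup_iff_count_le_one]
  intro i
  rw [← Comm.weight_eq_count]
  exact (h i).trans (congrFun hx i).le

omit [NeZero T] in
theorem list_weight_le {l : List (Comm T m)} {g : Comm T m} (h : g ∈ l) :
    g.weight ≤ (l.map Comm.weight).sum :=
  List.single_le_sum (fun _ _ => bot_le) _ (List.mem_map.2 ⟨g, h, rfl⟩)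

theorem list_prod_ne_zero {R α : Type*} [Ring R] [NoZeroDivisors R] [Nontrivial R] (f : α → R)
    (l : List α) (h : ∀ a ∈ l, f a ≠ 0) : (l.map f).prod ≠ 0 := by
  refine List.prod_ne_zero fun h0 => ?_
  obtain ⟨a, ha, h0⟩ := List.mem_map.1 h0
  exact h a ha h0

/-- Without wedge factors a monomial is a pure tensor of products. Each product has nonzero image in
the free algebra, so linear forms that do not vanish on these images give a form that does not
vanish on the tensor. -/
theorem Mono.eval_ne_zero_of_zero (x : Mono T m N 0) (hx : x.weight = 1) : x.eval ≠ 0 := by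
  have h0 : (x.zero.map fun g => wordHom T m (bar T m g.eval : FreeLie T m)).prod ≠ 0 :=
    list_prod_ne_zero _ _ fun g hg => wordHom_bar_ne_zero g (Mono.nodup_content hx
      ((list_weight_le hg).trans (le_add_self.trans le_self_add)))
  have h1 : ∀ j, ((x.point j).map fun g => wordHom T m g.eval).prod ≠ 0 := fun j =>
    list_prod_ne_zero _ _ fun g hg => wordHom_eval_ne_zero g (List.Nodup.of_map _
      (Mono.nodup_content hx ((list_weight_le hg).trans ((Finset.single_le_sum
        (f := fun j => ((x.point j).map Comm.weight).sum) (fun _ _ => bot_le)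
          (Finset.mem_univ j)).trans le_add_self))))
  obtain ⟨f, hf⟩ := Module.Projective.exists_dual_ne_zero ℂ h0
  choose fp hfp using fun j => Module.Projective.exists_dual_ne_zero ℂ (h1 j)
  intro h
  have := chainForm_eval (exteriorPower.zeroEquiv ℂ (nbar T m)).toLinearMap f fp x
  rw [h, LinearMap.map_zero] at this
  refine mul_ne_zero ?_ (mul_ne_zero hf (Finset.prod_ne_zero_iff.2 fun j _ => hfp j)) this.symm
  rw [LinearEquiv.coe_coe, exteriorPower.zeroEquiv_ιMulti]
  exact one_ne_zero

/-- Sending the last island to the origin gives a component of the differential which is a monomial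
with one wedge factor less, and the induction ends with no wedge factors. -/
theorem Mono.eval_ne_zero {p : ℕ} (x : Mono T m N p) (hx : x.weight = 1)
    {ω : ℂ} (hω : ω ^ T = 1) {z : Fin N → ℂ} (hz : ∀ j, z j ≠ 0) : x.eval ≠ 0 := by
  induction p with
  | zero => exact x.eval_ne_zero_of_zero hx
  | succ p ih =>
    intro h
    refine ih x.actZero (x.weight_actZero.trans hx) ?_
    rw [← x.edgeProj_ceD_actZero hω hz hx, h, map_zero, map_zero]

end

section

variable {T m N : ℕ} [NeZero T]

/-! ### Induction on monomials -/

theorem Mono.le_of_weight {p : ℕ} (x : Mono T m N p) (hx : x.weight = 1) : p ≤ m := by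
  -- The number of wedge factors is the dimension of the edge, a subspace of `ℂᵐ`. For this any
  -- `T`-th root of unity and any points will do.
  have h := (Complex.isPrimitiveRoot_exp T (NeZero.ne T)).pow_eq_one
  have := Submodule.finrank_le
    (x.edge (Complex.exp (2 * Real.pi * Complex.I / T)) (0 : Fin N → ℂ)).direction
  rwa [x.finrank_edge h hx, Module.finrank_fin_fun] at this

theorem multilinearPart_eq_bot {p : ℕ} (h : m < p) : multilinearPart T m N p = ⊥ := by
  rw [multilinearPart, weightSpace, Submodule.span_eq_bot]
  rintro _ ⟨x, hx, rfl⟩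
  exact absurd (x.le_of_weight hx) (not_le.2 h)

/-- Labels of single generators disappear under `bar`, and multilinearity makes the indices a
permutation of `1, …, m`, whose sign is the sign sought. -/
theorem Mono.eval_eq_or_neg_base {p : ℕ} (w : Fin p → ZMod T × Fin m)
    (hx : (⟨fun a => Comm.gen (w a).1 (w a).2, [], fun _ => []⟩ : Mono T m N p).weight = 1) :
    ∃ (h : p = m) (ε : ℤˣ),
      (⟨fun a => Comm.gen (w a).1 (w a).2, [], fun _ => []⟩ : Mono T m N p).eval =
        (ε : ℤ) • (Mono.baseOf T N h).eval := by
  have hcard : ∀ i, (Finset.univ.filter fun a => (w a).2 = i).card = 1 := by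
    intro i
    have := congrFun hx i
    simp only [weight, Comm.weight, List.map_nil, List.sum_nil, Pi.add_apply, Finset.sum_apply,
      Pi.one_apply, Pi.single_apply, Pi.zero_apply, Finset.sum_const_zero, add_zero] at this
    rw [Finset.card_filter]
    simpa only [eq_comm] using this
  have hbij : Function.Bijective fun a => (w a).2 := by
    constructor
    · intro a b hab
      exact (Finset.card_le_one.1 (hcard (w b).2).le) a (by simpa using hab) b (by simp)
    · intro i
      obtain ⟨a, ha⟩ := Finset.card_pos.1 (by rw [hcard i]; exact one_pos)
      exact ⟨a, by simpa using ha⟩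
  have hp : p = m := by simpa using Fintype.card_of_bijective hbij
  subst hp
  refine ⟨rfl, Equiv.Perm.sign (Equiv.ofBijective _ hbij), ?_⟩
  have hv : (fun a => bar T p (Comm.gen (w a).1 (w a).2).eval) =
      (fun a => bar T p (Comm.gen 0 a).eval) ∘ Equiv.ofBijective _ hbij := by
    funext a
    have : Comm.gen (w a).1 (w a).2 = (Comm.gen 0 (w a).2).shift (w a).1 := by simp [Comm.shift]
    rw [this, bar_eval_shift]
    rfl
  simp only [eval, hv]
  rw [AlternatingMap.map_perm, Units.smul_def, ← TensorProduct.smul_tmul']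
  rfl

theorem Mono.eval_swap {p : ℕ} (x : Mono T m N p) (a b : Fin p) :
    ∃ ε : ℤˣ, (⟨x.wedge ∘ Equiv.swap a b, x.zero, x.point⟩ : Mono T m N p).eval =
      (ε : ℤ) • x.eval := by
  refine ⟨Equiv.Perm.sign (Equiv.swap a b), ?_⟩
  have : (fun c => bar T m ((x.wedge ∘ Equiv.swap a b) c).eval) =
    (fun c => bar T m (x.wedge c).eval) ∘ Equiv.swap a b := rfl
  rw [eval, this, AlternatingMap.map_perm, Units.smul_def, ← TensorProduct.smul_tmul']
  rfl

omit [NeZero T] in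
theorem Mono.weight_swap {p : ℕ} (x : Mono T m N p) (a b : Fin p) :
    (⟨x.wedge ∘ Equiv.swap a b, x.zero, x.point⟩ : Mono T m N p).weight = x.weight := by
  simp only [weight, Function.comp_apply]
  rw [Equiv.sum_comp (Equiv.swap a b) fun c => (x.wedge c).weight]

/-- The moves are undone one at a time: a first factor at some point, then a first factor at the
origin, is put back as the last wedge factor. When there are none left, a wedge factor that is a
bracket is moved to the last place and split. Otherwise all wedge factors are generators, and the
monomial is the base one up to sign. -/
theorem Mono.multilinear_induction {motive : ∀ p, Mono T m N p → Prop}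
    (base : ∀ {p} (h : p = m), motive p (Mono.baseOf T N h))
    (congr : ∀ {p} (x y : Mono T m N p) (ε : ℤˣ), x.weight = 1 → y.weight = 1 →
      y.eval = (ε : ℤ) • x.eval → motive p x → motive p y)
    (actPoint : ∀ {p} (x : Mono T m N (p + 1)) (j : Fin N), x.weight = 1 → motive (p + 1) x →
      motive p (x.actPoint j))
    (actZero : ∀ {p} (x : Mono T m N (p + 1)), x.weight = 1 → motive (p + 1) x →
      motive p x.actZero)
    (join : ∀ {p} (x : Mono T m N (p + 2)), x.weight = 1 → motive (p + 2) x →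
      motive (p + 1) x.join)
    {p : ℕ} (x : Mono T m N p) (hx : x.weight = 1) : motive p x := by
  -- Undoing a move increases the number `p` of wedge factors, which is at most `m`.
  induction hn : m - p using Nat.strong_induction_on generalizing p with
  | _ n ih =>
  have ih' : ∀ y : Mono T m N (p + 1), y.weight = 1 → motive (p + 1) y := fun y hy =>
    ih (m - (p + 1)) (by have := y.le_of_weight hy; omega) y hy rfl
  obtain ⟨w, x₀, xp⟩ := x
  by_cases hj : ∃ j, xp j ≠ []
  · obtain ⟨j, hj⟩ := hj
    obtain ⟨g, l, hgl⟩ := List.exists_cons_of_ne_nil hj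
    have e : (⟨w, x₀, xp⟩ : Mono T m N p) = Mono.actPoint
        ⟨Fin.snoc (α := fun _ => Comm T m) w g, x₀, Function.update xp j l⟩ j := by
      simp [Mono.actPoint, ← hgl]
    rw [e] at hx ⊢
    rw [weight_actPoint] at hx
    exact actPoint _ j hx (ih' _ hx)
  push Not at hj
  obtain rfl : xp = fun _ => [] := funext hj
  rcases x₀ with _ | ⟨g, l⟩
  · by_cases hw : ∃ a g h, w a = Comm.br g h
    · obtain ⟨a, g, h, hab⟩ := hw
      cases p with
      | zero => exact a.elim0
      | succ q =>
        set x : Mono T m N (q + 1) := ⟨w, [], fun _ => []⟩ with hxdef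
        -- The bracket has to be the last wedge factor for `join`; the transposition costs a sign.
        have hs := x.weight_swap a (Fin.last q)
        obtain ⟨ε, hε⟩ := x.eval_swap a (Fin.last q)
        set x' : Mono T m N (q + 1) := ⟨x.wedge ∘ Equiv.swap a (Fin.last q), x.zero, x.point⟩
        have hx' : x'.weight = 1 := hs.trans hx
        have hε' : x.eval = ((ε⁻¹ : ℤˣ) : ℤ) • x'.eval := by
          rw [hε, smul_smul, ← Units.val_mul, inv_mul_cancel, Units.val_one, one_smul]
        refine congr x' x ε⁻¹ hx' hx hε' ?_
        have e : x' = Mono.join ⟨Fin.snoc (α := fun _ => Comm T m) (Fin.snoc (α := fun _ => Comm T m)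
            (fun b : Fin q => x'.wedge b.castSucc) h) g, x.zero, x.point⟩ := by
          have : x'.wedge (Fin.last q) = Comm.br g h := by
            simp only [x', Function.comp_apply, Equiv.swap_apply_right]
            exact hab
          simp only [Mono.join, lastBracket, Fin.snoc_castSucc, Fin.snoc_last, ← this]
          have h2 := Fin.snoc_init_self (α := fun _ => Comm T m) x'.wedge
          unfold Fin.init at h2
          rw [h2]
        rw [e] at hx' ⊢
        rw [weight_join] at hx'
        exact join _ hx' (ih' _ hx')
    · push Not at hw
      have hgen : ∀ a, ∃ b : ZMod T × Fin m, w a = Comm.gen b.1 b.2 := fun a => by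
        rcases h : w a with ⟨k, i⟩ | ⟨g, h'⟩
        · exact ⟨(k, i), rfl⟩
        · exact absurd h (hw a g h')
      choose v hv using hgen
      obtain rfl : w = fun a => Comm.gen (v a).1 (v a).2 := funext hv
      obtain ⟨h, ε, he⟩ := Mono.eval_eq_or_neg_base v hx
      exact congr _ _ ε (weight_baseOf h) hx he (base h)
  · have e : (⟨w, g :: l, fun _ => []⟩ : Mono T m N p) = Mono.actZero
        ⟨Fin.snoc (α := fun _ => Comm T m) w g, l, fun _ => []⟩ := by
      simp [Mono.actZero]
    rw [e] at hx ⊢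
    rw [weight_actZero] at hx
    exact actZero _ hx (ih' _ hx)

/-! ### Monomials are flag vectors up to sign -/

variable {ω : ℂ} {z : Fin N → ℂ}

theorem flagVec_extendMono (hω : IsPrimitiveRoot ω T) {k p : ℕ} (h : p + (k + 1) = m)
    (h' : p + 1 + k = m) (F : Flag (cda T m ω z) k) (y : Mono T m N p) (hy : y.weight = 1)
    (hF : y.edge ω z ≤ F.last) :
    flagVec (k + 1) p h (F.extendMono hω h y hy hF) =
      edgeProj T ω z p (y.edge ω z) (ceD (nbar T m) (ModM T m N) p (flagVec k (p + 1) h' F)) := by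
  simp only [flagVec]
  rw [Flag.extendMono, Flag.extend_init, Flag.extend_last]

/-- If the last edge of the flag were not contained in the edge of the monomial, projecting to it
would kill the monomial, which is not zero. Hence the last edge does not depend on the flag chosen
to represent the class. -/
theorem Mono.last_eq_edge (hω : ω ^ T = 1) (hz : ∀ j, z j ≠ 0) {k p : ℕ} {h : p + k = m}
    {x : Mono T m N p} (hx : x.weight = 1) {ε : ℤˣ} {F : Flag (cda T m ω z) k}
    (hF : x.eval = (ε : ℤ) • flagVec k p h F) : F.last = x.edge ω z := by
  refine Mono.eq_edge_of_le hω F.isEdge_last.1 (F.finrank_last_eq h) hx ?_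
  by_contra hle
  refine x.eval_ne_zero hx hω hz ?_
  rw [hF, ← edgeProj_of_mem_edgeSpan hω (F.finrank_last_eq h) (flagVec_mem hω k p h F),
    ← map_zsmul, ← hF, Mono.edgeProj_eval_of_not_le hω hle]

/-- The differential of `x` along the edge of `y`, on the level of flags. -/
theorem flagVec_step (hω : IsPrimitiveRoot ω T) (hz : ∀ j, z j ≠ 0) {k p : ℕ}
    (h : p + (k + 1) = m) (h' : p + 1 + k = m) {x : Mono T m N (p + 1)} {y : Mono T m N p}
    (hxw : x.weight = 1) (hy : y.weight = 1)
    {ε : ℤˣ} {F : Flag (cda T m ω z) k} (hx : x.eval = (ε : ℤ) • flagVec k (p + 1) h' F)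
    {I : AffineSubspace ℂ (Fin m → ℂ)} (he : y.edge ω z = x.edge ω z ⊓ I)
    (hyx : edgeProj T ω z p (y.edge ω z) (ceD (nbar T m) (ModM T m N) p x.eval) = y.eval) :
    ∃ F' : Flag (cda T m ω z) (k + 1), F'.init = F ∧ F'.last = F.last ⊓ I ∧
      y.eval = (ε : ℤ) • flagVec (k + 1) p h F' := by
  have hl := Mono.last_eq_edge hω.pow_eq_one hz hxw hx
  have hF : y.edge ω z ≤ F.last := by
    rw [hl, he]
    exact inf_le_left
  have e : (F.extendMono hω h y hy hF).last = y.edge ω z := Flag.extend_last ..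
  refine ⟨F.extendMono hω h y hy hF, Flag.extend_init .., ?_, ?_⟩
  · rw [e, he, hl]
  · rw [flagVec_extendMono hω h h', ← hyx, hx, map_zsmul, map_zsmul]

theorem Mono.exists_flagVec (hω : IsPrimitiveRoot ω T) (hz : ∀ j, z j ≠ 0)
    (hzorb : ∀ i j, i ≠ j → ∀ k : ℕ, z i ≠ ω ^ k * z j) {p : ℕ} (x : Mono T m N p)
    (hx : x.weight = 1) : ∀ (k : ℕ) (h : p + k = m), ∃ (ε : ℤˣ) (F : Flag (cda T m ω z) k),
      x.eval = (ε : ℤ) • flagVec k p h F := by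
  have hω1 := hω.pow_eq_one
  have key : ∀ {p : ℕ} {x : Mono T m N (p + 1)} {y : Mono T m N p}
      {I : AffineSubspace ℂ (Fin m → ℂ)}, x.weight = 1 → y.weight = 1 →
      y.edge ω z = x.edge ω z ⊓ I →
      edgeProj T ω z p (y.edge ω z) (ceD (nbar T m) (ModM T m N) p x.eval) = y.eval →
      (∀ (k : ℕ) (h : p + 1 + k = m), ∃ (ε : ℤˣ) (F : Flag (cda T m ω z) k),
        x.eval = (ε : ℤ) • flagVec k (p + 1) h F) →
      ∀ (k : ℕ) (h : p + k = m), ∃ (ε : ℤˣ) (F : Flag (cda T m ω z) k),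
        y.eval = (ε : ℤ) • flagVec k p h F := by
    intro p x y I hx hy he hyx ih k h
    obtain _ | k := k
    · have := x.le_of_weight hx
      omega
    -- The component of the differential along the new edge transfers the flag and its sign from `x`
    -- to `y`.
    · obtain ⟨ε, F, hF⟩ := ih k (by omega)
      obtain ⟨F', -, -, h3⟩ := flagVec_step hω hz h (by omega) hx hy hF he hyx
      exact ⟨ε, F', h3⟩
  refine Mono.multilinear_induction (motive := fun p x => ∀ (k : ℕ) (h : p + k = m),
    ∃ (ε : ℤˣ) (F : Flag (cda T m ω z) k), x.eval = (ε : ℤ) • flagVec k p h F) ?_ ?_ ?_ ?_ ?_ x hx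
  · intro p hp k h
    obtain rfl : k = 0 := by omega
    exact ⟨1, trivialFlag _, by rw [Units.val_one, one_smul, flagVec]⟩
  · intro p x y ε hx hy he ih k h
    obtain ⟨δ, F, hF⟩ := ih k h
    exact ⟨ε * δ, F, by rw [he, hF, smul_smul, Units.val_mul]⟩
  · intro p x j hx ih
    exact key hx ((x.weight_actPoint j).trans hx) (x.edge_actPoint j)
      (x.edgeProj_ceD_actPoint hω hz hzorb hx j) ih
  · intro p x hx ih
    exact key hx (x.weight_actZero.trans hx) x.edge_actZero
      (x.edgeProj_ceD_actZero hω1 hz hx) ih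
  · intro p x hx ih
    exact key hx (x.weight_join.trans hx) x.edge_join
      (x.edgeProj_ceD_join hω hz hx) ih

/-! ### Surjectivity, uniqueness and the recursive rules -/

theorem multilinear_span_vec (p : ℕ) :
    Submodule.span ℂ {u | ∃ (x : Mono T m N p) (hx : x.weight = 1), u = x.vec hx} = ⊤ := by
  have h : Submodule.map (multilinearPart T m N p).subtype
      (Submodule.span ℂ {u | ∃ (x : Mono T m N p) (hx : x.weight = 1), u = x.vec hx}) =
      Submodule.map (multilinearPart T m N p).subtype ⊤ := by
    rw [Submodule.map_span, Submodule.map_top, Submodule.range_subtype]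
    change _ = Submodule.span ℂ _
    congr 1
    ext u
    constructor
    · rintro ⟨_, ⟨x, hx, rfl⟩, rfl⟩
      exact ⟨x, hx, rfl⟩
    · rintro ⟨x, hx, rfl⟩
      exact ⟨_, ⟨x, hx, rfl⟩, rfl⟩
  exact Submodule.map_injective_of_injective (Submodule.subtype_injective _) h

theorem flagMap_surjective (hω : IsPrimitiveRoot ω T) (hz : ∀ j, z j ≠ 0)
    (hzorb : ∀ i j, i ≠ j → ∀ k : ℕ, z i ≠ ω ^ k * z j) {k p : ℕ} (h : p + k = m) :
    Function.Surjective (flagMap hω z h) := by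
  rw [← LinearMap.range_eq_top, eq_top_iff, ← multilinear_span_vec, Submodule.span_le]
  rintro _ ⟨x, hx, rfl⟩
  obtain ⟨ε, F, hF⟩ := x.exists_flagVec hω hz hzorb hx k h
  refine ⟨(ε : ℤ) • flagClass F, Subtype.ext ?_⟩
  rw [map_zsmul]
  change (ε : ℤ) • (flagMap hω z h (flagClass F) : Chains (nbar T m) (ModM T m N) p) = x.eval
  rw [coe_flagMap_flagClass, hF]

set_option maxHeartbeats 1000000 in
/-- Two families of maps which satisfy the recursive rules agree. -/
theorem IsFlagMap.unique
    {ψ φ : ∀ p k : ℕ, p + k = m → (multilinearPart T m N p →ₗ[ℂ] FlagSpace (cda T m ω z) k)}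
    (hψ : IsFlagMap ω z ψ) (hφ : IsFlagMap ω z φ) : φ = ψ := by
  -- The induction needs the two values represented by the same sign and the same flag, not merely
  -- equal, since the rules are stated for a given representation.
  have key : ∀ {p : ℕ} (x : Mono T m N p), x.weight = 1 → ∀ (hx : x.weight = 1) (k : ℕ)
      (h : p + k = m), ∃ (ε : ℤˣ) (F : Flag (cda T m ω z) k),
        ψ p k h (x.vec hx) = (ε : ℤ) • flagClass F ∧ φ p k h (x.vec hx) = (ε : ℤ) • flagClass F := by
    intro p x hx
    refine Mono.multilinear_induction (motive := fun p x => ∀ (hx : x.weight = 1) (k : ℕ)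
      (h : p + k = m), ∃ (ε : ℤˣ) (F : Flag (cda T m ω z) k),
        ψ p k h (x.vec hx) = (ε : ℤ) • flagClass F ∧
        φ p k h (x.vec hx) = (ε : ℤ) • flagClass F) ?_ ?_ ?_ ?_ ?_ x hx
    · intro p hp
      have hp' := hp.symm
      subst hp'
      intro hx k h
      obtain rfl : k = 0 := by omega
      refine ⟨1, trivialFlag _, ?_, ?_⟩
      · rw [Units.val_one, one_smul]
        exact hψ.base
      · rw [Units.val_one, one_smul]
        exact hφ.base
    · intro p x y ε hx hy he ih hy' k h
      obtain ⟨δ, F, h1, h2⟩ := ih hx k h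
      have hv : y.vec hy' = (ε : ℤ) • x.vec hx := Subtype.ext he
      refine ⟨ε * δ, F, ?_, ?_⟩
      · rw [hv, map_zsmul, h1, smul_smul, Units.val_mul]
      · rw [hv, map_zsmul, h2, smul_smul, Units.val_mul]
    · intro p x j hx ih hy k h
      obtain _ | k := k
      · have := x.le_of_weight hx
        omega
      obtain ⟨ε, F, h1, h2⟩ := ih hx k (by omega)
      obtain ⟨G, g1, g2, g3⟩ := hψ.actPoint p k (by omega) h x hx j ε F h1
      obtain ⟨G', g1', g2', g3'⟩ := hφ.actPoint p k (by omega) h x hx j ε F h2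
      -- Both rules prescribe the initial part and the last edge of the new flag, and these
      -- determine it.
      obtain rfl : G = G' := Flag.ext_init_last (g1.trans g1'.symm) (g2.trans g2'.symm)
      exact ⟨ε, G, g3, g3'⟩
    · intro p x hx ih hy k h
      obtain _ | k := k
      · have := x.le_of_weight hx
        omega
      obtain ⟨ε, F, h1, h2⟩ := ih hx k (by omega)
      obtain ⟨G, g1, g2, g3⟩ := hψ.actZero p k (by omega) h x hx ε F h1
      obtain ⟨G', g1', g2', g3'⟩ := hφ.actZero p k (by omega) h x hx ε F h2
      obtain rfl : G = G' := Flag.ext_init_last (g1.trans g1'.symm) (g2.trans g2'.symm)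
      exact ⟨ε, G, g3, g3'⟩
    · intro p x hx ih hy k h
      obtain _ | k := k
      · have := x.le_of_weight hx
        omega
      obtain ⟨ε, F, h1, h2⟩ := ih hx k (by omega)
      obtain ⟨G, g1, g2, g3⟩ := hψ.join p k (by omega) h x hx ε F h1
      obtain ⟨G', g1', g2', g3'⟩ := hφ.join p k (by omega) h x hx ε F h2
      obtain rfl : G = G' := Flag.ext_init_last (g1.trans g1'.symm) (g2.trans g2'.symm)
      exact ⟨ε, G, g3, g3'⟩
  funext p k h
  refine LinearMap.ext_on (multilinear_span_vec p) ?_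
  rintro _ ⟨x, hx, rfl⟩
  obtain ⟨ε, F, h1, h2⟩ := key x hx hx k h
  exact h2.trans h1.symm

/-- The inverses of the maps `flagMap` satisfy the recursive rules. -/
theorem isFlagMap_symm (hω : IsPrimitiveRoot ω T) (hz : ∀ j, z j ≠ 0)
    (hzorb : ∀ i j, i ≠ j → ∀ k : ℕ, z i ≠ ω ^ k * z j)
    {e : ∀ p k : ℕ, p + k = m → (FlagSpace (cda T m ω z) k ≃ₗ[ℂ] multilinearPart T m N p)}
    (he : ∀ p k h, (e p k h).toLinearMap = flagMap hω z h) :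
    IsFlagMap ω z fun p k h => (e p k h).symm.toLinearMap := by
  have hω1 := hω.pow_eq_one
  -- The rules for the inverse are translated into equations between monomials and flag vectors.
  have hiff : ∀ {p k : ℕ} (h : p + k = m) (x : Mono T m N p) (hx : x.weight = 1) (ε : ℤˣ)
      (F : Flag (cda T m ω z) k), (e p k h).symm.toLinearMap (x.vec hx) = (ε : ℤ) • flagClass F ↔
        x.eval = (ε : ℤ) • flagVec k p h F := by
    intro p k h x hx ε F
    rw [LinearEquiv.coe_coe, LinearEquiv.symm_apply_eq, map_zsmul, ← LinearEquiv.coe_coe, he,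
      Subtype.ext_iff, ← coe_flagMap_flagClass hω h F]
    rfl
  have step : ∀ {p k : ℕ} (h : p + 1 + k = m) (h' : p + (k + 1) = m) {x : Mono T m N (p + 1)}
      {y : Mono T m N p} (hx : x.weight = 1) (hy : y.weight = 1) {ε : ℤˣ}
      {F : Flag (cda T m ω z) k} {I : AffineSubspace ℂ (Fin m → ℂ)},
      (e (p + 1) k h).symm.toLinearMap (x.vec hx) = (ε : ℤ) • flagClass F →
      y.edge ω z = x.edge ω z ⊓ I →
      edgeProj T ω z p (y.edge ω z) (ceD (nbar T m) (ModM T m N) p x.eval) = y.eval →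
      ∃ F' : Flag (cda T m ω z) (k + 1), F'.init = F ∧ F'.last = F.last ⊓ I ∧
        (e p (k + 1) h').symm.toLinearMap (y.vec hy) = (ε : ℤ) • flagClass F' := by
    intro p k h h' x y hx hy ε F I hF hI hyx
    obtain ⟨F', h1, h2, h3⟩ := flagVec_step hω hz h' h hx hy ((hiff h x hx ε F).1 hF) hI hyx
    exact ⟨F', h1, h2, (hiff h' y hy ε F').2 h3⟩
  refine ⟨?_, ?_, ?_, ?_, ?_⟩
  · have := (hiff (Nat.add_zero m) (Mono.base T m N) Mono.weight_base 1
      (trivialFlag (cda T m ω z))).2 (by rw [Units.val_one, one_smul, flagVec]; rfl)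
    rwa [Units.val_one, one_smul] at this
  · intro p k h x hx
    obtain ⟨ε, F, hF⟩ := x.exists_flagVec hω hz hzorb hx k h
    exact ⟨ε, F, (hiff h x hx ε F).2 hF⟩
  · intro p k h h' x hx j ε F hF
    exact step h h' hx _ hF (x.edge_actPoint j) (x.edgeProj_ceD_actPoint hω hz hzorb hx j)
  · intro p k h h' x hx ε F hF
    exact step h h' hx _ hF x.edge_actZero (x.edgeProj_ceD_actZero hω1 hz hx)
  · intro p k h h' x hx ε F hF
    exact step h h' hx _ hF x.edge_join (x.edgeProj_ceD_join hω hz hx)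

end

section

/-! ### Arrangements of fiber type -/

section FiberType

variable {m k : ℕ}

/-- The projection forgetting the first coordinate. -/
def tailMap (m : ℕ) : (Fin (m + 1) → ℂ) →ₗ[ℂ] (Fin m → ℂ) := LinearMap.funLeft ℂ ℂ Fin.succ

theorem tailMap_cons (c : ℂ) (u : Fin m → ℂ) :
    tailMap m (Fin.cons (α := fun _ => ℂ) c u) = u := by
  funext i
  simp [tailMap, LinearMap.funLeft_apply]

theorem cons_tailMap (t : Fin (m + 1) → ℂ) :
    Fin.cons (α := fun _ => ℂ) (t 0) (tailMap m t) = t := Fin.cons_self_tail t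

/-- The cylinder over a subspace. -/
def cyl (M : AffineSubspace ℂ (Fin m → ℂ)) : AffineSubspace ℂ (Fin (m + 1) → ℂ) :=
  M.comap (tailMap m).toAffineMap

/-- The projection of a subspace. -/
def shadow (L : AffineSubspace ℂ (Fin (m + 1) → ℂ)) : AffineSubspace ℂ (Fin m → ℂ) :=
  L.map (tailMap m).toAffineMap

/-- The graph of a section over a subspace. -/
def graph (s : (Fin m → ℂ) →ᵃ[ℂ] ℂ) (M : AffineSubspace ℂ (Fin m → ℂ)) :
    AffineSubspace ℂ (Fin (m + 1) → ℂ) where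
  carrier := {t | tailMap m t ∈ M ∧ t 0 = s (tailMap m t)}
  smul_vsub_vadd_mem' c p q r hp hq hr := by
    have h1 : tailMap m (c • (p -ᵥ q) +ᵥ r) =
        c • (tailMap m p -ᵥ tailMap m q) +ᵥ tailMap m r := by
      simp only [vsub_eq_sub, vadd_eq_add, map_add, map_smul, map_sub]
    refine ⟨?_, ?_⟩
    · rw [h1]
      exact M.smul_vsub_vadd_mem c hp.1 hq.1 hr.1
    · rw [h1, AffineMap.map_vadd, map_smul, AffineMap.linearMap_vsub, ← hp.2, ← hq.2, ← hr.2]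
      rfl

variable {M M' : AffineSubspace ℂ (Fin m → ℂ)} {L K : AffineSubspace ℂ (Fin (m + 1) → ℂ)}
  {s s' : (Fin m → ℂ) →ᵃ[ℂ] ℂ} {t : Fin (m + 1) → ℂ}

theorem mem_cyl : t ∈ cyl M ↔ tailMap m t ∈ M := Iff.rfl

theorem mem_graph : t ∈ graph s M ↔ tailMap m t ∈ M ∧ t 0 = s (tailMap m t) := Iff.rfl

theorem mem_shadow {u : Fin m → ℂ} : u ∈ shadow L ↔ ∃ t ∈ L, tailMap m t = u := Iff.rfl

theorem cons_mem_cyl {c : ℂ} {u : Fin m → ℂ} :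
    (Fin.cons (α := fun _ => ℂ) c u : Fin (m + 1) → ℂ) ∈ cyl M ↔ u ∈ M := by
  rw [mem_cyl, tailMap_cons]

theorem cons_mem_graph {c : ℂ} {u : Fin m → ℂ} :
    (Fin.cons (α := fun _ => ℂ) c u : Fin (m + 1) → ℂ) ∈ graph s M ↔ u ∈ M ∧ c = s u := by
  rw [mem_graph, tailMap_cons, Fin.cons_zero]

theorem shadow_cyl (M : AffineSubspace ℂ (Fin m → ℂ)) : shadow (cyl M) = M := by
  ext u
  rw [mem_shadow]
  constructor
  · rintro ⟨t, ht, rfl⟩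
    exact ht
  · intro hu
    exact ⟨Fin.cons 0 u, cons_mem_cyl.2 hu, tailMap_cons _ _⟩

theorem shadow_graph (s : (Fin m → ℂ) →ᵃ[ℂ] ℂ) (M : AffineSubspace ℂ (Fin m → ℂ)) :
    shadow (graph s M) = M := by
  ext u
  rw [mem_shadow]
  constructor
  · rintro ⟨t, ht, rfl⟩
    exact ht.1
  · intro hu
    exact ⟨Fin.cons (s u) u, cons_mem_graph.2 ⟨hu, rfl⟩, tailMap_cons _ _⟩

theorem shadow_mono (h : L ≤ K) : shadow L ≤ shadow K := fun _ ⟨t, ht, e⟩ => ⟨t, h ht, e⟩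

theorem cyl_mono (h : M ≤ M') : cyl M ≤ cyl M' := fun _ ht => h ht

theorem graph_mono (h : M ≤ M') : graph s M ≤ graph s M' := fun _ ht => ⟨h ht.1, ht.2⟩

theorem cyl_nonempty (h : (M : Set (Fin m → ℂ)).Nonempty) :
    (cyl M : Set (Fin (m + 1) → ℂ)).Nonempty :=
  let ⟨u, hu⟩ := h; ⟨Fin.cons 0 u, cons_mem_cyl.2 hu⟩

theorem graph_nonempty (h : (M : Set (Fin m → ℂ)).Nonempty) :
    (graph s M : Set (Fin (m + 1) → ℂ)).Nonempty :=
  let ⟨u, hu⟩ := h; ⟨Fin.cons (s u) u, cons_mem_graph.2 ⟨hu, rfl⟩⟩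

theorem eq_graph_shadow (h : L ≤ graph s ⊤) : L = graph s (shadow L) := by
  ext t
  constructor
  · intro ht
    exact ⟨⟨t, ht, rfl⟩, (h ht).2⟩
  · rintro ⟨⟨t', ht', e⟩, h0⟩
    have e : tailMap m t' = tailMap m t := e
    rw [← cons_tailMap t, h0, ← e, ← (h ht').2, cons_tailMap]
    exact ht'

theorem finrank_cyl (h : (M : Set (Fin m → ℂ)).Nonempty) :
    Module.finrank ℂ (cyl M).direction = Module.finrank ℂ M.direction + 1 := by
  obtain ⟨u₀, hu₀⟩ := h
  let A : (ℂ × M.direction) →ₗ[ℂ] (Fin (m + 1) → ℂ) :=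
    (Fin.consLinearEquiv ℂ (fun _ : Fin (m + 1) => ℂ)).toLinearMap ∘ₗ
      LinearMap.prodMap LinearMap.id M.direction.subtype
  have hA : ∀ c v, A (c, v) = Fin.cons (α := fun _ => ℂ) c (v : Fin m → ℂ) := fun c v => rfl
  have hinj : Function.Injective A := by
    rintro ⟨c, v⟩ ⟨c', v'⟩ e
    rw [hA, hA, Fin.cons_inj] at e
    exact Prod.ext e.1 (Subtype.ext e.2)
  have e : cyl M = AffineSubspace.mk' (Fin.cons (α := fun _ => ℂ) 0 u₀) (LinearMap.range A) := by
    ext t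
    rw [AffineSubspace.mem_mk', mem_cyl, vsub_eq_sub]
    constructor
    · intro ht
      refine ⟨(t 0, ⟨tailMap m t - u₀, AffineSubspace.vsub_mem_direction ht hu₀⟩), ?_⟩
      rw [hA]
      funext i
      induction i using Fin.cases with
      | zero => simp
      | succ i => simp [tailMap, LinearMap.funLeft_apply]
    · rintro ⟨⟨c, v⟩, hv⟩
      have : tailMap m t = (v : Fin m → ℂ) +ᵥ u₀ := by
        have h1 := congrArg (tailMap m) hv
        rw [hA, tailMap_cons, map_sub, tailMap_cons] at h1
        rw [h1, vadd_eq_add, sub_add_cancel]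
      rw [this]
      exact AffineSubspace.vadd_mem_of_mem_direction v.2 hu₀
  rw [e, AffineSubspace.direction_mk', LinearMap.finrank_range_of_inj hinj,
    Module.finrank_prod, Module.finrank_self, add_comm]

theorem finrank_graph (h : (M : Set (Fin m → ℂ)).Nonempty) :
    Module.finrank ℂ (graph s M).direction = Module.finrank ℂ M.direction := by
  obtain ⟨u₀, hu₀⟩ := h
  let A : M.direction →ₗ[ℂ] (Fin (m + 1) → ℂ) :=
    (Fin.consLinearEquiv ℂ (fun _ : Fin (m + 1) => ℂ)).toLinearMap ∘ₗ
      LinearMap.prod (s.linear ∘ₗ M.direction.subtype) M.direction.subtype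
  have hA : ∀ v, A v = Fin.cons (α := fun _ => ℂ) (s.linear v) (v : Fin m → ℂ) := fun v => rfl
  have hinj : Function.Injective A := by
    intro v v' e
    rw [hA, hA, Fin.cons_inj] at e
    exact Subtype.ext e.2
  have e : graph s M =
      AffineSubspace.mk' (Fin.cons (α := fun _ => ℂ) (s u₀) u₀) (LinearMap.range A) := by
    ext t
    rw [AffineSubspace.mem_mk', mem_graph, vsub_eq_sub]
    constructor
    · rintro ⟨ht, h0⟩
      refine ⟨⟨tailMap m t - u₀, AffineSubspace.vsub_mem_direction ht hu₀⟩, ?_⟩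
      rw [hA]
      have h2 : s.linear (tailMap m t - u₀) = s (tailMap m t) - s u₀ :=
        s.linearMap_vsub (tailMap m t) u₀
      dsimp only
      rw [h2, ← h0]
      funext i
      induction i using Fin.cases with
      | zero => simp
      | succ i => simp [tailMap, LinearMap.funLeft_apply]
    · rintro ⟨v, hv⟩
      have : tailMap m t = (v : Fin m → ℂ) +ᵥ u₀ := by
        have h1 := congrArg (tailMap m) hv
        rw [hA, tailMap_cons, map_sub, tailMap_cons] at h1
        rw [h1, vadd_eq_add, sub_add_cancel]
      rw [this]
      refine ⟨AffineSubspace.vadd_mem_of_mem_direction v.2 hu₀, ?_⟩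
      have h1 := congrFun hv 0
      rw [hA, Fin.cons_zero, Pi.sub_apply, Fin.cons_zero] at h1
      rw [s.map_vadd, h1, vadd_eq_add, sub_add_cancel]
  rw [e, AffineSubspace.direction_mk', LinearMap.finrank_range_of_inj hinj]

/-- The arrangement `𝒜` is fibered over `𝒜'`, where the fibers are lines without the values of the
sections `s i`. -/
structure IsFiberType (𝒜' : Set (AffineSubspace ℂ (Fin m → ℂ)))
    (𝒜 : Set (AffineSubspace ℂ (Fin (m + 1) → ℂ))) {ι : Type*}
    (s : ι → (Fin m → ℂ) →ᵃ[ℂ] ℂ) : Prop where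
  mem_iff : ∀ H, H ∈ 𝒜 ↔ (∃ K ∈ 𝒜', H = cyl K) ∨ ∃ i, H = graph (s i) ⊤
  locus : ∀ i j, (∀ u, s i u ≠ s j u) ∨ (∀ u, s i u = s j u) ∨
    ∃ K ∈ 𝒜', ∀ u, u ∈ K ↔ s i u = s j u

variable {𝒜' : Set (AffineSubspace ℂ (Fin m → ℂ))} {𝒜 : Set (AffineSubspace ℂ (Fin (m + 1) → ℂ))}
  {ι : Type*} {σ : ι → (Fin m → ℂ) →ᵃ[ℂ] ℂ}

theorem IsFiberType.isEdge_cyl (h : IsFiberType 𝒜' 𝒜 σ) (hM : IsEdge 𝒜' M) :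
    IsEdge 𝒜 (cyl M) := by
  obtain ⟨hne, S, hS, rfl⟩ := hM
  refine isEdge_of_forall (cyl_nonempty hne) fun t ht => ?_
  rw [mem_cyl, AffineSubspace.mem_sInf_iff]
  intro K hK
  exact ht (cyl K) ((h.mem_iff _).2 (Or.inl ⟨K, hS hK, rfl⟩)) (cyl_mono (sInf_le hK))

theorem IsFiberType.isEdge_graph (h : IsFiberType 𝒜' 𝒜 σ) (hM : IsEdge 𝒜' M) (i : ι) :
    IsEdge 𝒜 (graph (σ i) M) := by
  obtain ⟨hne, S, hS, rfl⟩ := hM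
  refine isEdge_of_forall (graph_nonempty hne) fun t ht => ⟨?_, ?_⟩
  · rw [AffineSubspace.mem_sInf_iff]
    intro K hK
    exact ht (cyl K) ((h.mem_iff _).2 (Or.inl ⟨K, hS hK, rfl⟩))
      fun t ht => (AffineSubspace.mem_sInf_iff _ _).1 ht.1 K hK
  · exact (ht (graph (σ i) ⊤) ((h.mem_iff _).2 (Or.inr ⟨i, rfl⟩)) (graph_mono le_top)).2

/-- An edge cut out by cylinders only is a cylinder. If a graph takes part, it determines the first
coordinate, and each further graph cuts the projection in the locus where two sections agree, which
is everything or a hyperplane of the base. -/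
theorem IsFiberType.edge_cases (h : IsFiberType 𝒜' 𝒜 σ) (hL : IsEdge 𝒜 L) :
    IsEdge 𝒜' (shadow L) ∧ (L = cyl (shadow L) ∨ ∃ i, L ≤ graph (σ i) ⊤) := by
  obtain ⟨⟨t₀, ht₀⟩, S, hS, rfl⟩ := hL
  have hne : (shadow (sInf S) : Set (Fin m → ℂ)).Nonempty := ⟨_, t₀, ht₀, rfl⟩
  by_cases hg : ∃ i, graph (σ i) ⊤ ∈ S
  · obtain ⟨i, hi⟩ := hg
    have hle : sInf S ≤ graph (σ i) ⊤ := sInf_le hi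
    refine ⟨isEdge_of_forall hne fun u hu => ?_, Or.inr ⟨i, hle⟩⟩
    -- A point of the base is lifted along the section whose graph contains the edge.
    refine ⟨Fin.cons (α := fun _ => ℂ) (σ i u) u, ?_, tailMap_cons (σ i u) u⟩
    refine (AffineSubspace.mem_sInf_iff _ _).2 fun H hH => ?_
    obtain ⟨K, hK, rfl⟩ | ⟨j, rfl⟩ := (h.mem_iff H).1 (hS hH)
    · rw [cons_mem_cyl]
      refine hu K hK ?_
      rintro _ ⟨t, ht, rfl⟩
      exact (AffineSubspace.mem_sInf_iff _ _).1 ht _ hH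
    · rw [cons_mem_graph]
      refine ⟨AffineSubspace.mem_top _ _ _, ?_⟩
      have heq : ∀ t ∈ sInf S, σ i (tailMap m t) = σ j (tailMap m t) := fun t ht => by
        rw [← (hle ht).2, ← ((AffineSubspace.mem_sInf_iff _ _).1 ht _ hH).2]
      obtain h1 | h1 | ⟨K, hK, h1⟩ := h.locus i j
      -- Sections that never agree cannot both contain the point `t₀` of the edge in their graphs.
      · exact absurd (heq t₀ ht₀) (h1 _)
      · exact h1 u
      · refine (h1 u).1 (hu K hK ?_)
        rintro _ ⟨t, ht, rfl⟩
        exact (h1 _).2 (heq t ht)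
  · push Not at hg
    have hcyl : sInf S = cyl (shadow (sInf S)) := by
      refine le_antisymm (fun t ht => ⟨t, ht, rfl⟩) ?_
      rintro t ⟨t', ht', e⟩
      refine (AffineSubspace.mem_sInf_iff _ _).2 fun H hH => ?_
      obtain ⟨K, hK, rfl⟩ | ⟨j, rfl⟩ := (h.mem_iff H).1 (hS hH)
      · have := (AffineSubspace.mem_sInf_iff _ _).1 ht' _ hH
        rw [mem_cyl] at this ⊢
        have e : tailMap m t' = tailMap m t := e
        rwa [← e]
      · exact absurd hH (hg j)
    refine ⟨isEdge_of_forall hne fun u hu => ?_, Or.inl hcyl⟩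
    -- Cylinders do not restrict the first coordinate, so the value `0` is as good as any other.
    refine ⟨Fin.cons (α := fun _ => ℂ) 0 u, ?_, tailMap_cons 0 u⟩
    refine (AffineSubspace.mem_sInf_iff _ _).2 fun H hH => ?_
    obtain ⟨K, hK, rfl⟩ | ⟨j, rfl⟩ := (h.mem_iff H).1 (hS hH)
    · rw [cons_mem_cyl]
      refine hu K hK ?_
      rintro _ ⟨t, ht, rfl⟩
      exact (AffineSubspace.mem_sInf_iff _ _).1 ht _ hH
    · exact absurd hH (hg j)

/-- A nonempty cylinder contains a vertical line, whereas a graph meets a vertical line only once;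
thus an edge above a cylinder lies in no graph. -/
theorem IsFiberType.eq_cyl_of_le (h : IsFiberType 𝒜' 𝒜 σ) (hL : (L : Set (Fin (m + 1) → ℂ)).Nonempty)
    (hv : L = cyl (shadow L)) (hK : IsEdge 𝒜 K) (hle : L ≤ K) : K = cyl (shadow K) := by
  refine (h.edge_cases hK).2.resolve_right ?_
  rintro ⟨i, hi⟩
  obtain ⟨t, ht⟩ := hL
  have hc : ∀ c, (Fin.cons (α := fun _ => ℂ) c (tailMap m t) : Fin (m + 1) → ℂ) ∈ K := fun c =>
    hle (hv ▸ cons_mem_cyl.2 ⟨t, ht, rfl⟩)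
  have h0 := (cons_mem_graph.1 (hi (hc 0))).2
  have h1 := (cons_mem_graph.1 (hi (hc 1))).2
  exact zero_ne_one (h0.trans h1.symm)

end FiberType

end

section

/-! ### Maps between flag spaces induced by maps of flags -/

section Functoriality

variable {V V' : Type*} [AddCommGroup V] [Module ℂ V] [AddCommGroup V'] [Module ℂ V']
  {𝒜 : Set (AffineSubspace ℂ V)} {𝒜' : Set (AffineSubspace ℂ V')} [Finite 𝒜] [Finite 𝒜'] {k k' : ℕ}

theorem gapSum_mem_flagRelations (F : Flag 𝒜 k) (i : Fin (k + 1)) (h0 : 0 < (i : ℕ))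
    (hi : (i : ℕ) < k) : gapSum F i ∈ flagRelations 𝒜 k :=
  Submodule.subset_span ⟨F, i, h0, hi, rfl⟩

/-- A map between flags which matches the completions of flags with gaps induces a map between
flag spaces. -/
theorem exists_flagSpace_map (f : Flag 𝒜' k' → Flag 𝒜 k) (hf : Function.Injective f)
    (h : ∀ (F : Flag 𝒜' k') (i : Fin (k' + 1)), 0 < (i : ℕ) → (i : ℕ) < k' →
      ∃ i' : Fin (k + 1), 0 < (i' : ℕ) ∧ (i' : ℕ) < k ∧
        ∀ G, (∀ j, j ≠ i' → G.edge j = (f F).edge j) ↔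
          ∃ G', (∀ j, j ≠ i → G'.edge j = F.edge j) ∧ f G' = G) :
    ∃ φ : FlagSpace 𝒜' k' →ₗ[ℂ] FlagSpace 𝒜 k, ∀ F, φ (flagClass F) = flagClass (f F) := by
  classical
  refine ⟨Submodule.mapQ _ _ (Finsupp.lmapDomain ℂ ℂ f) ?_, fun F => ?_⟩
  · unfold flagRelations
    rw [Submodule.span_le]
    rintro _ ⟨F, i, h0, hi, rfl⟩
    obtain ⟨i', h0', hi', hG⟩ := h F i h0 hi
    have : Finsupp.lmapDomain ℂ ℂ f (gapSum F i) = gapSum (f F) i' := by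
      rw [gapSum, gapSum, map_sum]
      simp only [Finsupp.lmapDomain_apply, Finsupp.mapDomain_single]
      rw [← Finset.sum_image (f := fun G => Finsupp.single G (1 : ℂ)) (g := f)
        (fun _ _ _ _ e => hf e)]
      refine Finset.sum_congr ?_ fun _ _ => rfl
      ext G
      simp only [Finset.mem_image, Finset.mem_filter, Finset.mem_univ, true_and]
      exact (hG G).symm
    change Finsupp.lmapDomain ℂ ℂ f (gapSum F i) ∈ flagRelations 𝒜 k
    rw [this]
    exact gapSum_mem_flagRelations _ _ h0' hi'
  · rw [flagClass, Submodule.mapQ_apply, Finsupp.lmapDomain_apply, Finsupp.mapDomain_single]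
    rfl

omit [Finite 𝒜] in
theorem Flag.le_of_le (F : Flag 𝒜 k) {i j : Fin (k + 1)} (h : i ≤ j) : F.edge j ≤ F.edge i :=
  Fin.antitone_iff_succ_le.2 F.anti h

omit [Finite 𝒜] in
theorem Flag.edge_zero [FiniteDimensional ℂ V] (F : Flag 𝒜 k) : F.edge 0 = ⊤ := by
  refine affine_eq_of_le_of_finrank (F.isEdge 0).1 le_top ?_
  have := F.codim 0
  rw [Fin.val_zero, add_zero] at this
  rw [this]
  exact Submodule.finrank_le _

/-- The classes of flags span the flag space. -/
theorem span_flagClass_le {W : Submodule ℂ (FlagSpace 𝒜 k)} (h : ∀ F, flagClass F ∈ W) :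
    W = ⊤ := by
  rw [eq_top_iff]
  intro u _
  have : (Submodule.mkQ W) = 0 := flagSpace_hom_ext fun F => by
    rw [LinearMap.zero_apply, Submodule.mkQ_apply, Submodule.Quotient.mk_eq_zero]
    exact h F
  rw [← Submodule.Quotient.mk_eq_zero, ← Submodule.mkQ_apply, this, LinearMap.zero_apply]

end Functoriality

/-! ### An upper bound for the flag spaces of an arrangement of fiber type -/

section FiberType

variable {m k : ℕ} {𝒜' : Set (AffineSubspace ℂ (Fin m → ℂ))}
  {𝒜 : Set (AffineSubspace ℂ (Fin (m + 1) → ℂ))} {ι : Type*} {σ : ι → (Fin m → ℂ) →ᵃ[ℂ] ℂ}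

/-- The flag of cylinders over the edges of a flag. -/
def cylFlag (h : IsFiberType 𝒜' 𝒜 σ) (F : Flag 𝒜' k) : Flag 𝒜 k where
  edge j := cyl (F.edge j)
  isEdge j := h.isEdge_cyl (F.isEdge j)
  codim j := by
    have := F.codim j
    rw [Module.finrank_fin_fun] at this ⊢
    rw [finrank_cyl (F.isEdge j).1]
    omega
  anti j := cyl_mono (F.anti j)

/-- The flag of graphs over the edges of a flag. -/
def graphFlag (h : IsFiberType 𝒜' 𝒜 σ) (i : ι) (F : Flag 𝒜' k) : Flag 𝒜 (k + 1) where
  edge := Fin.cons ⊤ fun j => graph (σ i) (F.edge j)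
  isEdge j := by
    induction j using Fin.cases with
    | zero => exact (trivialFlag 𝒜).isEdge 0
    | succ j => exact h.isEdge_graph (F.isEdge j) i
  codim j := by
    induction j using Fin.cases with
    | zero => exact (trivialFlag 𝒜).codim 0
    | succ j =>
      have := F.codim j
      rw [Module.finrank_fin_fun] at this ⊢
      rw [Fin.cons_succ, finrank_graph (F.isEdge j).1, Fin.val_succ]
      omega
  anti j := by
    induction j using Fin.cases with
    | zero => exact le_top
    | succ j =>
      rw [Fin.castSucc_succ, Fin.cons_succ, Fin.cons_succ]
      exact graph_mono (F.anti j)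

theorem graphFlag_edge_succ (h : IsFiberType 𝒜' 𝒜 σ) (i : ι) (F : Flag 𝒜' k) (j : Fin (k + 1)) :
    (graphFlag h i F).edge j.succ = graph (σ i) (F.edge j) := rfl

theorem exists_cylFlag (h : IsFiberType 𝒜' 𝒜 σ) (G : Flag 𝒜 k)
    (hG : G.last = cyl (shadow G.last)) : ∃ F, cylFlag h F = G := by
  have hcyl : ∀ j, G.edge j = cyl (shadow (G.edge j)) := fun j =>
    h.eq_cyl_of_le G.isEdge_last.1 hG (G.isEdge j) (G.le_of_le (Fin.le_last j))
  refine ⟨⟨fun j => shadow (G.edge j), fun j => (h.edge_cases (G.isEdge j)).1, fun j => ?_,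
    fun j => shadow_mono (G.anti j)⟩, ?_⟩
  · have := G.codim j
    rw [hcyl j, finrank_cyl (h.edge_cases (G.isEdge j)).1.1] at this
    rw [Module.finrank_fin_fun] at this ⊢
    omega
  · ext1
    funext j
    exact (hcyl j).symm

theorem exists_graphFlag (h : IsFiberType 𝒜' 𝒜 σ) (G : Flag 𝒜 (k + 1)) {i : ι}
    (hG : G.edge 1 ≤ graph (σ i) ⊤) : ∃ F, graphFlag h i F = G := by
  have hgr : ∀ j : Fin (k + 1), G.edge j.succ = graph (σ i) (shadow (G.edge j.succ)) := fun j =>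
    eq_graph_shadow ((G.le_of_le (Fin.succ_le_succ_iff.2 (Fin.zero_le j))).trans hG)
  refine ⟨⟨fun j => shadow (G.edge j.succ), fun j => (h.edge_cases (G.isEdge _)).1, fun j => ?_,
    fun j => shadow_mono ?_⟩, ?_⟩
  · have := G.codim j.succ
    rw [hgr j, finrank_graph (h.edge_cases (G.isEdge _)).1.1, Fin.val_succ] at this
    rw [Module.finrank_fin_fun] at this ⊢
    omega
  · exact G.anti j.succ
  · ext1
    funext j
    induction j using Fin.cases with
    | zero => exact G.edge_zero.symm
    | succ j => exact (hgr j).symm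

theorem cylFlag_injective (h : IsFiberType 𝒜' 𝒜 σ) :
    Function.Injective (cylFlag h : Flag 𝒜' k → Flag 𝒜 k) := by
  intro F F' e
  ext1
  funext j
  have := congrArg shadow (congrFun (congrArg Flag.edge e) j)
  rwa [cylFlag, cylFlag, shadow_cyl, shadow_cyl] at this

theorem graphFlag_injective (h : IsFiberType 𝒜' 𝒜 σ) (i : ι) :
    Function.Injective (graphFlag h i : Flag 𝒜' k → Flag 𝒜 (k + 1)) := by
  intro F F' e
  ext1
  funext j
  have := congrArg shadow (congrFun (congrArg Flag.edge e) j.succ)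
  rwa [graphFlag_edge_succ, graphFlag_edge_succ, shadow_graph, shadow_graph] at this

variable [Finite 𝒜] [Finite 𝒜']

/-- A gap never concerns the last edge. As this is a cylinder, every completion consists of
cylinders, so the completions correspond to those in the base. -/
theorem exists_cylMap (h : IsFiberType 𝒜' 𝒜 σ) (k : ℕ) :
    ∃ φ : FlagSpace 𝒜' k →ₗ[ℂ] FlagSpace 𝒜 k, ∀ F, φ (flagClass F) = flagClass (cylFlag h F) := by
  refine exists_flagSpace_map _ (cylFlag_injective h) fun F i h0 hi => ⟨i, h0, hi, fun G => ?_⟩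
  constructor
  · intro hG
    have hl : G.last = cyl (F.edge (Fin.last k)) := hG _ fun e => by
      rw [← e, Fin.val_last] at hi
      exact lt_irrefl _ hi
    obtain ⟨G', rfl⟩ := exists_cylFlag h G (by rw [hl, shadow_cyl])
    refine ⟨G', fun j hj => ?_, rfl⟩
    rw [← shadow_cyl (G'.edge j), ← shadow_cyl (F.edge j)]
    exact congrArg shadow (hG j hj)
  · rintro ⟨G', hG', rfl⟩ j hj
    exact congrArg cyl (hG' j hj)

/-- The edge of codimension `1`, the full graph, is not in the gap because gaps of the base flag are
at positions `l > 0` and move to `l + 1`. All later edges of a completion then lie in the graph. -/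
theorem exists_graphMap (h : IsFiberType 𝒜' 𝒜 σ) (k : ℕ) (i : ι) :
    ∃ φ : FlagSpace 𝒜' k →ₗ[ℂ] FlagSpace 𝒜 (k + 1),
      ∀ F, φ (flagClass F) = flagClass (graphFlag h i F) := by
  refine exists_flagSpace_map _ (graphFlag_injective h i) fun F l h0 hl =>
    ⟨l.succ, Nat.succ_pos _, Nat.succ_lt_succ hl, fun G => ?_⟩
  constructor
  · intro hG
    have hne : (0 : Fin (k + 1)) ≠ l := fun e => by
      rw [← e] at h0
      exact lt_irrefl _ h0
    have h1 : G.edge 1 = graph (σ i) (F.edge 0) :=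
      hG (Fin.succ 0) fun e => hne (Fin.succ_injective _ e)
    obtain ⟨G', rfl⟩ := exists_graphFlag h G (i := i) (h1.le.trans (graph_mono le_top))
    refine ⟨G', fun j hj => ?_, rfl⟩
    rw [← shadow_graph (σ i) (G'.edge j), ← shadow_graph (σ i) (F.edge j)]
    exact congrArg shadow (hG j.succ fun e => hj (Fin.succ_injective _ e))
  · rintro ⟨G', hG', rfl⟩ j hj
    induction j using Fin.cases with
    | zero => rfl
    | succ j => exact congrArg (graph (σ i)) (hG' j fun e => hj (e ▸ rfl))

omit [Finite 𝒜'] in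
/-- The flags of cylinders and graphs span the flag space. -/
theorem flagClass_mem_of_fiberType (h : IsFiberType 𝒜' 𝒜 σ) {W : Submodule ℂ (FlagSpace 𝒜 (k + 1))}
    (hcyl : ∀ F, flagClass (cylFlag h F) ∈ W) (hgraph : ∀ i F, flagClass (graphFlag h i F) ∈ W)
    (G : Flag 𝒜 (k + 1)) : flagClass G ∈ W := by
  classical
  -- A flag with a non-cylinder at position `q + 1` is treated by induction on `q`. For `q = 0` its
  -- first proper edge lies in a graph, hence so do all the later ones.
  have key : ∀ (q : ℕ) (hq : q < k + 1) (G : Flag 𝒜 (k + 1)),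
      G.edge ⟨q + 1, by omega⟩ ≠ cyl (shadow (G.edge ⟨q + 1, by omega⟩)) → flagClass G ∈ W := by
    intro q
    induction q with
    | zero =>
      intro hq G hG
      obtain ⟨i, hi⟩ := (h.edge_cases (G.isEdge _)).2.resolve_left hG
      obtain ⟨F, rfl⟩ := exists_graphFlag h G hi
      exact hgraph i F
    | succ q ih =>
      intro hq G hG
      by_cases hG1 : G.edge ⟨q + 1, by omega⟩ = cyl (shadow (G.edge ⟨q + 1, by omega⟩))
      · set l : Fin (k + 2) := ⟨q + 1, by omega⟩ with hl
        -- The last cylinder of the flag is at position `q + 1`. The flag relation there replaces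
        -- the flag by the negative of the sum of the other completions.
        have hrel : ∑ G' : Flag 𝒜 (k + 1) with ∀ j, j ≠ l → G'.edge j = G.edge j,
            flagClass G' = 0 := by
          have h1 := gapSum_mem_flagRelations G l (Nat.succ_pos q) (by simp only [hl]; omega)
          rw [← Submodule.Quotient.mk_eq_zero, gapSum] at h1
          rw [← h1]
          exact (map_sum (Submodule.mkQ (flagRelations 𝒜 (k + 1))) _ _).symm
        have hmem : G ∈ Finset.univ.filter
            (fun G' : Flag 𝒜 (k + 1) => ∀ j, j ≠ l → G'.edge j = G.edge j) := by simp
        rw [← Finset.add_sum_erase _ _ hmem, add_eq_zero_iff_eq_neg] at hrel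
        rw [hrel]
        refine Submodule.neg_mem _ (Submodule.sum_mem _ fun G' hG' => ?_)
        have hagree := (Finset.mem_filter.1 (Finset.mem_of_mem_erase hG')).2
        refine ih (by omega) G' fun hv => Finset.ne_of_mem_erase hG' ?_
        set l' : Fin (k + 2) := ⟨q + 2, by omega⟩ with hl'
        -- For dimension reasons the only cylinder that completes the gap is the one over the
        -- projection of the next edge. The other completions have a non-cylinder at position `q +
        -- 1`, and the induction hypothesis applies to them.
        have hshadow : ∀ H : Flag 𝒜 (k + 1), H.edge l = cyl (shadow (H.edge l)) →
            H.edge l' = G.edge l' → H.edge l = cyl (shadow (G.edge l')) := by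
          intro H hHl hHl'
          obtain ⟨i, hi⟩ := (h.edge_cases (G.isEdge l')).2.resolve_left hG
          have e1 := H.codim l
          have e2 := G.codim l'
          rw [hHl, finrank_cyl (h.edge_cases (H.isEdge l)).1.1] at e1
          rw [eq_graph_shadow hi, finrank_graph (h.edge_cases (G.isEdge l')).1.1] at e2
          have hle : shadow (G.edge l') ≤ shadow (H.edge l) := by
            rw [← hHl']
            exact shadow_mono (H.le_of_le (by rw [Fin.le_def]; simp [hl, hl']))
          have := affine_eq_of_le_of_finrank (h.edge_cases (G.isEdge l')).1.1 hle
            (by simp only [hl, hl'] at e1 e2 ⊢; omega)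
          rw [this]
          exact hHl
        ext1
        funext j
        by_cases hj : j = l
        · rw [hj, hshadow G' hv (hagree l' (by rw [Ne, Fin.ext_iff]; simp [hl, hl'])),
            hshadow G hG1 rfl]
        · exact hagree j hj
      · exact ih (by omega) G hG1
  by_cases hG : G.last = cyl (shadow G.last)
  · obtain ⟨F, rfl⟩ := exists_cylFlag h G hG
    exact hcyl F
  · exact key k (Nat.lt_succ_self k) G hG

theorem finrank_flagSpace_succ_le [Fintype ι] (h : IsFiberType 𝒜' 𝒜 σ) (k : ℕ) :
    Module.finrank ℂ (FlagSpace 𝒜 (k + 1)) ≤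
      Module.finrank ℂ (FlagSpace 𝒜' (k + 1)) +
        Fintype.card ι * Module.finrank ℂ (FlagSpace 𝒜' k) := by
  obtain ⟨φ, hφ⟩ := exists_cylMap h (k + 1)
  choose γ hγ using exists_graphMap h k
  classical
  let f : (FlagSpace 𝒜' (k + 1) × (ι → FlagSpace 𝒜' k)) →ₗ[ℂ] FlagSpace 𝒜 (k + 1) :=
    φ.coprod (LinearMap.lsum ℂ (fun _ => FlagSpace 𝒜' k) ℂ γ)
  have hf : Function.Surjective f := by
    rw [← LinearMap.range_eq_top]
    refine span_flagClass_le (flagClass_mem_of_fiberType h (fun F => ?_) fun i F => ?_)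
    · exact ⟨(flagClass F, 0), by simp [f, hφ]⟩
    · refine ⟨(0, Pi.single i (flagClass F)), ?_⟩
      simp only [f, LinearMap.coprod_apply, map_zero, zero_add, LinearMap.lsum_piSingle, hγ]
  refine (LinearMap.finrank_le_finrank_of_surjective hf).trans ?_
  have hpi : ∀ (W : Type _) [AddCommGroup W] [Module ℂ W] [FiniteDimensional ℂ W],
      Module.finrank ℂ (ι → W) = ∑ _ : ι, Module.finrank ℂ W := fun W _ _ _ =>
    Module.finrank_pi_fintype ℂ
  rw [Module.finrank_prod, hpi (FlagSpace 𝒜' k), Finset.sum_const, Finset.card_univ,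
    smul_eq_mul]

theorem finrank_flagSpace_zero_le (h : IsFiberType 𝒜' 𝒜 σ) :
    Module.finrank ℂ (FlagSpace 𝒜 0) ≤ Module.finrank ℂ (FlagSpace 𝒜' 0) := by
  obtain ⟨φ, hφ⟩ := exists_cylMap h 0
  refine LinearMap.finrank_le_finrank_of_surjective (f := φ) ?_
  rw [← LinearMap.range_eq_top]
  refine span_flagClass_le fun G => ⟨flagClass (trivialFlag 𝒜'), ?_⟩
  rw [hφ, G.eq_trivialFlag, Flag.eq_trivialFlag (cylFlag h _)]

end FiberType

theorem subsingleton_flagSpace_of_lt {m k : ℕ} {𝒜 : Set (AffineSubspace ℂ (Fin m → ℂ))} [Finite 𝒜]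
    (h : m < k) : Subsingleton (FlagSpace 𝒜 k) := by
  have : IsEmpty (Flag 𝒜 k) := ⟨fun F => by
    have := F.finrank_last
    rw [Module.finrank_fin_fun] at this
    omega⟩
  infer_instance

/-! ### The cyclotomic discriminantal arrangement is of fiber type -/

section

variable {T m N : ℕ} {ω : ℂ} {z : Fin N → ℂ}

/-- The values which the first coordinate must avoid, as functions of the other coordinates. -/
def sections (T m : ℕ) {N : ℕ} (ω : ℂ) (z : Fin N → ℂ) :
    Option (Fin N × ZMod T ⊕ Fin m × ZMod T) → (Fin m → ℂ) →ᵃ[ℂ] ℂ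
  | none => AffineMap.const ℂ _ 0
  | some (.inl (j, k)) => AffineMap.const ℂ _ (ω ^ k.val * z j)
  | some (.inr (i, k)) => (ω ^ k.val • LinearMap.proj i : (Fin m → ℂ) →ₗ[ℂ] ℂ).toAffineMap

variable [NeZero T]

/-- Over a point of the base, the first coordinate has to avoid `0`, the numbers `ω ^ k z_j` and the
numbers `ω ^ k t_i`. Constant values agree everywhere or nowhere, and every coincidence involving a
coordinate of the base is the equation of a hyperplane, or an identity. -/
theorem isFiberType_cda (hω : IsPrimitiveRoot ω T) :
    IsFiberType (cda T m ω z) (cda T (m + 1) ω z) (sections T m ω z) := by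
  have hω1 := hω.pow_eq_one
  have hiff : ∀ (k : ZMod T) (x y : ℂ), ω ^ k.val * x = y ↔ x = ω ^ (-k).val * y := by
    intro k x y
    constructor
    · rintro rfl
      rw [← mul_assoc, pow_val_neg_mul hω1, one_mul]
    · rintro rfl
      rw [← mul_assoc, mul_comm (ω ^ k.val), pow_val_neg_mul hω1, one_mul]
  have mem_diag : ∀ {n : ℕ} {t : Fin n → ℂ} {i j k}, t ∈ hypDiag (T := T) ω i j k ↔
      t i = ω ^ k.val * t j := Iff.rfl
  have mem_point : ∀ {n : ℕ} {t : Fin n → ℂ} {c : ℂ} {i : Fin n}, t ∈ hypPoint c i ↔ t i = c :=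
    Iff.rfl
  have htail : ∀ (t : Fin (m + 1) → ℂ) (i : Fin m), tailMap m t i = t i.succ := fun _ _ => rfl
  constructor
  · intro H
    constructor
    · rintro ((⟨i, j, k, hij, rfl⟩ | ⟨i, j, k, rfl⟩) | ⟨i, rfl⟩)
      · induction j using Fin.cases with
        | zero => exact absurd hij (Fin.not_lt_zero i)
        | succ j =>
          induction i using Fin.cases with
          | zero =>
            refine Or.inr ⟨some (.inr (j, k)), ?_⟩
            ext t
            rw [mem_diag, mem_graph]
            exact (and_iff_right (AffineSubspace.mem_top _ _ _)).symm
          | succ i =>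
            exact Or.inl ⟨_, Or.inl (Or.inl ⟨i, j, k, Fin.succ_lt_succ_iff.1 hij, rfl⟩), rfl⟩
      · induction i using Fin.cases with
        | zero =>
          refine Or.inr ⟨some (.inl (j, k)), ?_⟩
          ext t
          rw [mem_point, mem_graph]
          exact (and_iff_right (AffineSubspace.mem_top _ _ _)).symm
        | succ i => exact Or.inl ⟨_, Or.inl (Or.inr ⟨i, j, k, rfl⟩), rfl⟩
      · induction i using Fin.cases with
        | zero =>
          refine Or.inr ⟨none, ?_⟩
          ext t
          rw [mem_point, mem_graph]
          exact (and_iff_right (AffineSubspace.mem_top _ _ _)).symm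
        | succ i => exact Or.inl ⟨_, Or.inr ⟨i, rfl⟩, rfl⟩
    · rintro (⟨_, (⟨i, j, k, hij, rfl⟩ | ⟨i, j, k, rfl⟩) | ⟨i, rfl⟩, rfl⟩ | ⟨s, rfl⟩)
      · exact Or.inl (Or.inl ⟨i.succ, j.succ, k, Fin.succ_lt_succ_iff.2 hij, rfl⟩)
      · exact Or.inl (Or.inr ⟨i.succ, j, k, rfl⟩)
      · exact Or.inr ⟨i.succ, rfl⟩
      · rcases s with _ | ⟨j, k⟩ | ⟨j, k⟩
        · refine Or.inr ⟨0, ?_⟩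
          ext t
          rw [mem_point, mem_graph]
          exact and_iff_right (AffineSubspace.mem_top _ _ _)
        · refine Or.inl (Or.inr ⟨0, j, k, ?_⟩)
          ext t
          rw [mem_point, mem_graph]
          exact and_iff_right (AffineSubspace.mem_top _ _ _)
        · refine Or.inl (Or.inl ⟨0, j.succ, k, Fin.succ_pos j, ?_⟩)
          ext t
          rw [mem_diag, mem_graph]
          exact and_iff_right (AffineSubspace.mem_top _ _ _)
  · have hconst : ∀ c c' : ℂ, (∀ u : Fin m → ℂ, AffineMap.const ℂ (Fin m → ℂ) c u ≠
        AffineMap.const ℂ (Fin m → ℂ) c' u) ∨ (∀ u : Fin m → ℂ, AffineMap.const ℂ (Fin m → ℂ) c u =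
        AffineMap.const ℂ (Fin m → ℂ) c' u) ∨ ∃ K ∈ cda T m ω z, ∀ u, u ∈ K ↔
        AffineMap.const ℂ (Fin m → ℂ) c u = AffineMap.const ℂ (Fin m → ℂ) c' u := by
      intro c c'
      by_cases h : c = c'
      · exact Or.inr (Or.inl fun _ => h)
      · exact Or.inl fun _ => h
    have hmul : ∀ (i : Fin m) (k : ZMod T) (u : Fin m → ℂ),
        sections T m ω z (some (.inr (i, k))) u = ω ^ k.val * u i := fun _ _ _ => rfl
    have hsymm : ∀ a b, (∃ K ∈ cda T m ω z, ∀ u, u ∈ K ↔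
        sections T m ω z a u = sections T m ω z b u) → ∃ K ∈ cda T m ω z, ∀ u, u ∈ K ↔
        sections T m ω z b u = sections T m ω z a u := fun a b ⟨K, hK, h⟩ =>
      ⟨K, hK, fun u => (h u).trans eq_comm⟩
    have h0 : ∀ i k, ∃ K ∈ cda T m ω z, ∀ u, u ∈ K ↔
        sections T m ω z (some (.inr (i, k))) u = sections T m ω z none u := by
      intro i k
      refine ⟨hypPoint 0 i, Or.inr ⟨i, rfl⟩, fun u => ?_⟩
      rw [hmul, mem_point]
      exact ((mul_eq_zero_iff_left (pow_val_ne_zero hω1 k)).symm)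
    have h1 : ∀ i k j l, ∃ K ∈ cda T m ω z, ∀ u, u ∈ K ↔
        sections T m ω z (some (.inr (i, k))) u = sections T m ω z (some (.inl (j, l))) u := by
      intro i k j l
      refine ⟨hypPoint (ω ^ (-k + l).val * z j) i, Or.inl (Or.inr ⟨i, j, _, rfl⟩), fun u => ?_⟩
      rw [hmul, mem_point, hiff, pow_val_add hω1, mul_assoc]
      rfl
    have h2 : ∀ i k j l, i < j → ∃ K ∈ cda T m ω z, ∀ u, u ∈ K ↔
        sections T m ω z (some (.inr (i, k))) u = sections T m ω z (some (.inr (j, l))) u := by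
      intro i k j l hij
      refine ⟨hypDiag ω i j (-k + l), Or.inl (Or.inl ⟨i, j, _, hij, rfl⟩), fun u => ?_⟩
      rw [hmul, hmul, mem_diag, hiff, pow_val_add hω1, mul_assoc]
    rintro (_ | ⟨j, k⟩ | ⟨i, k⟩) (_ | ⟨j', k'⟩ | ⟨i', k'⟩)
    · exact hconst _ _
    · exact hconst _ _
    · exact Or.inr (Or.inr (hsymm _ _ (h0 i' k')))
    · exact hconst _ _
    · exact hconst _ _
    · exact Or.inr (Or.inr (hsymm _ _ (h1 i' k' j k)))
    · exact Or.inr (Or.inr (h0 i k))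
    · exact Or.inr (Or.inr (h1 i k j' k'))
    · rcases lt_trichotomy i i' with h | rfl | h
      · exact Or.inr (Or.inr (h2 i k i' k' h))
      -- Two different multiples of the same coordinate agree only where it vanishes, as `ω` is
      -- primitive.
      · by_cases hk : k = k'
        · exact Or.inr (Or.inl fun _ => by rw [hk])
        · refine Or.inr (Or.inr ⟨hypPoint 0 i, Or.inr ⟨i, rfl⟩, fun u => ?_⟩)
          rw [hmul, hmul, mem_point, ← sub_eq_zero (a := ω ^ k.val * u i), ← sub_mul]
          exact (mul_eq_zero_iff_left (sub_ne_zero.2 fun e => hk (pow_val_inj hω e))).symm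
      · exact Or.inr (Or.inr (hsymm _ _ (h2 i' k' i k h)))

/-- Each new coordinate multiplies the total dimension by at most one plus the number of sections,
which is `1 + (1 + N T + m T)`. -/
theorem sum_finrank_flagSpace_le (hω : IsPrimitiveRoot ω T) (m : ℕ) :
    ∑ k ∈ Finset.range (m + 1), Module.finrank ℂ (FlagSpace (cda T m ω z) k) ≤
      ∏ i ∈ Finset.range m, (2 + N * T + i * T) := by
  induction m with
  | zero =>
    rw [zero_add, Finset.sum_range_one, Finset.prod_range_zero]
    refine (LinearMap.finrank_le_finrank_of_surjective (Submodule.mkQ_surjective _)).trans ?_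
    have : Subsingleton (Flag (cda T 0 ω z) 0) :=
      ⟨fun F G => F.eq_trivialFlag.trans G.eq_trivialFlag.symm⟩
    rw [Module.finrank_finsupp_self]
    exact Fintype.card_le_one_iff_subsingleton.2 this
  | succ m ih =>
    have hft := isFiberType_cda (m := m) (z := z) hω
    have hcard : Fintype.card (Option (Fin N × ZMod T ⊕ Fin m × ZMod T)) = 1 + N * T + m * T := by
      simp [ZMod.card]
      ring
    rw [Finset.sum_range_succ', Finset.prod_range_succ]
    have h1 := Finset.sum_le_sum fun k (_ : k ∈ Finset.range (m + 1)) =>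
      finrank_flagSpace_succ_le hft k
    have h2 := finrank_flagSpace_zero_le hft
    rw [Finset.sum_add_distrib, ← Finset.mul_sum, hcard] at h1
    -- Flags in `ℂᵐ` have length at most `m`, so the shifted sum loses only a zero space.
    have h3 : ∑ k ∈ Finset.range (m + 1), Module.finrank ℂ (FlagSpace (cda T m ω z) (k + 1)) +
        Module.finrank ℂ (FlagSpace (cda T m ω z) 0) =
        ∑ k ∈ Finset.range (m + 1), Module.finrank ℂ (FlagSpace (cda T m ω z) k) := by
      rw [← Finset.sum_range_succ' fun k => Module.finrank ℂ (FlagSpace (cda T m ω z) k),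
        Finset.sum_range_succ]
      have := subsingleton_flagSpace_of_lt (𝒜 := cda T m ω z) (Nat.lt_succ_self m)
      rw [Module.finrank_zero_of_subsingleton, add_zero]
    calc _ ≤ (1 + (1 + N * T + m * T)) * ∑ k ∈ Finset.range (m + 1),
          Module.finrank ℂ (FlagSpace (cda T m ω z) k) := by
          rw [add_mul, one_mul]
          linarith
      _ ≤ (1 + (1 + N * T + m * T)) * ∏ i ∈ Finset.range m, (2 + N * T + i * T) :=
          Nat.mul_le_mul_left _ ih
      _ = _ := by ring

end

end

section

attribute [local instance] LieRing.ofAssociativeRing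

variable {T m N : ℕ}

/-! ### Splitting words at their left-to-right minima -/

/-- The blocks of a word, given by their first letters and their other letters. A new block starts
at each letter whose index is not larger than the index of the first letter of the block. -/
def blocks : List (ZMod T × Fin m) → List ((ZMod T × Fin m) × List (ZMod T × Fin m))
  | [] => []
  | a :: l => (a, l.takeWhile fun c => a.2 < c.2) :: blocks (l.dropWhile fun c => a.2 < c.2)
termination_by l => l.length
decreasing_by
  rw [List.length_cons]
  exact Nat.lt_succ_of_le (List.dropWhile_suffix _).length_le

/-- The word of a block. -/
def blockWord (b : (ZMod T × Fin m) × List (ZMod T × Fin m)) : List (ZMod T × Fin m) := b.1 :: b.2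

/-- The first letter of a block has the smallest index. -/
def IsBlock (b : (ZMod T × Fin m) × List (ZMod T × Fin m)) : Prop := ∀ c ∈ b.2, b.1.2 < c.2

theorem blocks_cons (a : ZMod T × Fin m) (l : List (ZMod T × Fin m)) :
    blocks (a :: l) =
      (a, l.takeWhile fun c => a.2 < c.2) :: blocks (l.dropWhile fun c => a.2 < c.2) := by
  rw [blocks]

theorem word_induction {motive : List (ZMod T × Fin m) → Prop} (nil : motive [])
    (cons : ∀ a l, motive (l.dropWhile fun c => a.2 < c.2) → motive (a :: l))
    (w : List (ZMod T × Fin m)) : motive w := by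
  induction w using blocks.induct with
  | case1 => exact nil
  | case2 a l ih => exact cons a l ih

theorem flatMap_blocks (w : List (ZMod T × Fin m)) : (blocks w).flatMap blockWord = w := by
  induction w using word_induction with
  | nil => simp [blocks]
  | cons a l ih =>
    rw [blocks_cons, List.flatMap_cons, ih, blockWord, List.cons_append,
      List.takeWhile_append_dropWhile]

theorem isBlock_of_mem_blocks {w : List (ZMod T × Fin m)} : ∀ b ∈ blocks w, IsBlock b := by
  induction w using word_induction with
  | nil => simp [blocks]
  | cons a l ih =>
    rw [blocks_cons]
    simp only [List.mem_cons, forall_eq_or_imp]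
    exact ⟨fun c hc => by simpa using List.mem_takeWhile_imp hc, ih⟩

theorem head_dropWhile_le {a c : ZMod T × Fin m} {l l' : List (ZMod T × Fin m)}
    (h : (l.dropWhile fun c => a.2 < c.2) = c :: l') : c.2 ≤ a.2 := by
  induction l with
  | nil => simp at h
  | cons b l ih =>
    by_cases hb : a.2 < b.2
    · rw [List.dropWhile_cons_of_pos (by simpa using hb)] at h
      exact ih h
    · rw [List.dropWhile_cons_of_neg (by simpa using hb), List.cons.injEq] at h
      rw [← h.1]
      exact not_lt.1 hb

theorem head_le_of_mem_blocks {w : List (ZMod T × Fin m)} :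
    ∀ {a l}, w = a :: l → ∀ b ∈ blocks w, b.1.2 ≤ a.2 := by
  induction w using word_induction with
  | nil => simp
  | cons a l ih =>
    intro a' l' e
    obtain ⟨rfl, rfl⟩ := List.cons.inj e
    rw [blocks_cons]
    simp only [List.mem_cons, forall_eq_or_imp, le_refl, true_and]
    intro b hb
    rcases h : l.dropWhile fun c => a.2 < c.2 with _ | ⟨c, l'⟩
    · rw [h] at hb
      simp [blocks] at hb
    · exact (ih h b hb).trans (head_dropWhile_le h)

theorem pairwise_blocks (w : List (ZMod T × Fin m)) :
    (blocks w).Pairwise fun b c => c.1.2 ≤ b.1.2 := by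
  induction w using word_induction with
  | nil => simp [blocks]
  | cons a l ih =>
    have h := head_le_of_mem_blocks (w := a :: l) rfl
    rw [blocks_cons] at h ⊢
    exact List.pairwise_cons.2 ⟨fun b hb => h b (List.mem_cons_of_mem _ hb), ih⟩

theorem heads_sublist (L : List ((ZMod T × Fin m) × List (ZMod T × Fin m))) :
    (L.map Prod.fst).Sublist (L.flatMap blockWord) := by
  induction L with
  | nil => exact List.Sublist.refl _
  | cons b L ih =>
    rw [List.map_cons, List.flatMap_cons, blockWord, List.cons_append]
    exact (ih.trans (List.sublist_append_right _ _)).cons_cons _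

theorem pairwise_blocks_of_nodup {w : List (ZMod T × Fin m)} (h : (w.map Prod.snd).Nodup) :
    (blocks w).Pairwise fun b c => c.1.2 < b.1.2 := by
  have h1 := ((heads_sublist (blocks w)).map Prod.snd).nodup (by rwa [flatMap_blocks])
  rw [List.map_map, List.nodup_iff_pairwise_ne, List.pairwise_map] at h1
  exact ((pairwise_blocks w).and h1).imp fun h => lt_of_le_of_ne h.1 h.2.symm

/-- The left-to-right minima of a word have label `0`. -/
def IsNormal (w : List (ZMod T × Fin m)) : Prop :=
  ∀ u a v, w = u ++ a :: v → (∀ b ∈ u, a.2 ≤ b.2) → a.1 = 0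

theorem IsNormal.append_rest {p l l' : List (ZMod T × Fin m)} {a c : ZMod T × Fin m}
    (hp : ∀ b ∈ p, a.2 ≤ b.2) (h : (l.dropWhile fun c => a.2 < c.2) = c :: l') :
    ∀ b ∈ p ++ a :: l.takeWhile fun c => a.2 < c.2, c.2 ≤ b.2 := by
  have hc := head_dropWhile_le h
  intro b hb
  rcases List.mem_append.1 hb with hb | hb
  · exact hc.trans (hp b hb)
  · rcases List.mem_cons.1 hb with rfl | hb
    · exact hc
    · have : a.2 < b.2 := by simpa using List.mem_takeWhile_imp hb
      exact hc.trans this.le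

/-- The first letters of the blocks are left-to-right minima of the whole word. -/
theorem IsNormal.label_head {w : List (ZMod T × Fin m)} (hw : IsNormal w) :
    ∀ b ∈ blocks w, b.1.1 = 0 := by
  -- The part `p` already read must be carried along, since being a left-to-right minimum refers to
  -- all the earlier letters. The hypothesis says that the next letter is a minimum with respect to
  -- `p`.
  have key : ∀ p w : List (ZMod T × Fin m), (∀ a l, w = a :: l → ∀ b ∈ p, a.2 ≤ b.2) →
      IsNormal (p ++ w) → ∀ b ∈ blocks w, b.1.1 = 0 := by
    intro p w
    induction w using word_induction generalizing p with
    | nil => simp [blocks]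
    | cons a l ih =>
      intro hp hn
      rw [blocks_cons]
      simp only [List.mem_cons, forall_eq_or_imp]
      refine ⟨hn p a l rfl (hp a l rfl), ih (p ++ a :: l.takeWhile fun c => a.2 < c.2) ?_ ?_⟩
      · exact fun c l' e => IsNormal.append_rest (hp a l rfl) e
      · rwa [List.append_assoc, List.cons_append, List.takeWhile_append_dropWhile]
  exact key [] w (fun a l _ b hb => absurd hb List.not_mem_nil) hw

/-! ### Left-normed commutators -/

/-- The left-normed commutator in the letters of a block. -/
def dyn (b : (ZMod T × Fin m) × List (ZMod T × Fin m)) : Comm T m :=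
  b.2.foldl (fun g a => Comm.br g (Comm.gen a.1 a.2)) (Comm.gen b.1.1 b.1.2)

theorem dyn_append (a : ZMod T × Fin m) (l : List (ZMod T × Fin m)) (c : ZMod T × Fin m) :
    dyn (a, l ++ [c]) = Comm.br (dyn (a, l)) (Comm.gen c.1 c.2) := by
  simp [dyn]

theorem content_dyn (b : (ZMod T × Fin m) × List (ZMod T × Fin m)) :
    (dyn b).content = blockWord b := by
  obtain ⟨a, l⟩ := b
  induction l using List.reverseRecOn with
  | nil => rfl
  | append_singleton l c ih =>
    rw [dyn_append, Comm.content, ih, Comm.content]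
    simp [blockWord]

/-- The translation of a letter. -/
def letterShift (k : ZMod T) (a : ZMod T × Fin m) : ZMod T × Fin m := (a.1 + k, a.2)

theorem shift_dyn (k : ZMod T) (b : (ZMod T × Fin m) × List (ZMod T × Fin m)) :
    (dyn b).shift k = dyn (letterShift k b.1, b.2.map (letterShift k)) := by
  obtain ⟨a, l⟩ := b
  induction l using List.reverseRecOn with
  | nil => rfl
  | append_singleton l c ih =>
    rw [dyn_append, Comm.shift, ih, List.map_append, List.map_singleton, dyn_append]
    rfl

/-! ### Leading words of left-normed commutators -/

/-- The element of the free algebra given by a word. -/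
def wordElt (w : List (ZMod T × Fin m)) : WordAlg T m :=
  MonoidAlgebra.of ℂ _ (FreeMonoid.ofList w)

/-- The coefficient of a word. -/
def coeffAt (w : List (ZMod T × Fin m)) : WordAlg T m →ₗ[ℂ] ℂ where
  toFun x := x.coeff (FreeMonoid.ofList w)
  map_add' _ _ := rfl
  map_smul' _ _ := rfl

theorem coeffAt_wordElt [DecidableEq (List (ZMod T × Fin m))] (w v : List (ZMod T × Fin m)) :
    coeffAt w (wordElt v) = if v = w then 1 else 0 := by
  classical
  change (MonoidAlgebra.of ℂ _ (FreeMonoid.ofList v) : WordAlg T m).coeff (FreeMonoid.ofList w) = _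
  rw [MonoidAlgebra.of_apply, MonoidAlgebra.coeff_single, Finsupp.single_apply]
  simp only [FreeMonoid.ofList.injective.eq_iff]

theorem wordElt_append (w v : List (ZMod T × Fin m)) :
    wordElt (w ++ v) = wordElt w * wordElt v := by
  rw [wordElt, wordElt, wordElt, ← map_mul, FreeMonoid.ofList_append]

theorem wordElt_prod (w : List (ZMod T × Fin m)) :
    (w.map fun a => wordHom T m (Comm.gen a.1 a.2).eval).prod = wordElt w := by
  induction w with
  | nil => exact (map_one (MonoidAlgebra.of ℂ (FreeMonoid (ZMod T × Fin m)))).symm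
  | cons a l ih =>
    rw [List.map_cons, List.prod_cons, ih, wordHom_gen, ← List.singleton_append, wordElt_append]
    rfl

theorem coeffAt_mul_ne_zero {x y : WordAlg T m} {w : List (ZMod T × Fin m)}
    (h : coeffAt w (x * y) ≠ 0) : ∃ u v, w = u ++ v ∧ coeffAt u x ≠ 0 ∧ coeffAt v y ≠ 0 := by
  obtain ⟨u, v, e, hu, hv⟩ := exists_mul_of_coeff_mul_ne_zero h
  exact ⟨u.toList, v.toList, e.symm, hu, hv⟩

/-- As all words of `x` have the length of `u`, the word `u ++ v` splits in one way only. -/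
theorem coeffAt_append_mul {x y : WordAlg T m} {u v : List (ZMod T × Fin m)}
    (hx : ∀ w, coeffAt w x ≠ 0 → w.length = u.length) :
    coeffAt (u ++ v) (x * y) = coeffAt u x * coeffAt v y := by
  classical
  have hcoe : ∀ w (x : WordAlg T m), coeffAt w x = x.coeff (FreeMonoid.ofList w) :=
    fun _ _ => rfl
  have hsplit : ∀ a b : FreeMonoid (ZMod T × Fin m), x.coeff a ≠ 0 →
      a * b = FreeMonoid.ofList (u ++ v) → a = FreeMonoid.ofList u ∧ b = FreeMonoid.ofList v := by
    intro a b ha e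
    exact List.append_inj (s₁ := a.toList) (t₁ := b.toList) e (hx a.toList ha)
  rw [hcoe, hcoe, hcoe, MonoidAlgebra.coeff_mul, Finsupp.sum,
    Finset.sum_eq_single (FreeMonoid.ofList u), Finsupp.sum,
    Finset.sum_eq_single (FreeMonoid.ofList v)]
  · exact if_pos rfl
  · intro b _ hb
    exact if_neg fun e => hb (List.append_cancel_left (as := u) (bs := b.toList) e)
  · intro h
    rw [Finsupp.notMem_support_iff.1 h, mul_zero, ite_self]
  · intro a ha hne
    refine Finset.sum_eq_zero fun b _ => if_neg fun e => hne ?_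
    exact (hsplit a b (Finsupp.mem_support_iff.1 ha) e).1
  · intro h
    rw [Finsupp.sum, Finsupp.notMem_support_iff.1 h]
    simp

theorem wordHom_eval_perm (g : Comm T m) :
    wordHom T m g.eval ∈ wordSpan {v | v.toList.Perm g.content} := by
  induction g with
  | gen k i =>
    rw [wordHom_gen]
    exact of_mem_wordSpan (List.Perm.refl _)
  | br g h ihg ihh =>
    rw [wordHom_br]
    refine Submodule.sub_mem _ (mul_mem_wordSpan ihg ihh fun u hu v hv => ?_)
      (mul_mem_wordSpan ihh ihg fun u hu v hv => ?_)
    · exact List.Perm.append hu hv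
    · exact (List.Perm.append hu hv).trans List.perm_append_comm

/-- Bracketing with a further letter `c` gives words ending in `c` minus words starting with `c`.
The former keep their first letter, so the only word with the original first letter is the one in
the original order. -/
theorem wordHom_dyn_sub (b : (ZMod T × Fin m) × List (ZMod T × Fin m)) :
    wordHom T m (dyn b).eval - wordElt (blockWord b) ∈
      wordSpan {v | v.toList.Perm (blockWord b) ∧ ∃ c ∈ b.2, v.toList.head? = some c} := by
  obtain ⟨a, l⟩ := b
  induction l using List.reverseRecOn with
  | nil =>
    have : wordHom T m (dyn (a, [])).eval = wordElt (blockWord (a, [])) := wordHom_gen _ _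
    rw [this, sub_self]
    exact Submodule.zero_mem _
  | append_singleton l c ih =>
    have hc : wordHom T m (Comm.gen c.1 c.2).eval = wordElt [c] := wordHom_gen _ _
    have e : wordElt (blockWord (a, l ++ [c])) = wordElt (blockWord (a, l)) * wordElt [c] := by
      rw [← wordElt_append]
      rfl
    have hcm : wordElt [c] ∈ wordSpan {v : FreeMonoid (ZMod T × Fin m) | v.toList = [c]} :=
      of_mem_wordSpan rfl
    rw [dyn_append, wordHom_br, e, hc, sub_right_comm, ← sub_mul]
    refine Submodule.sub_mem _ (mul_mem_wordSpan ih hcm ?_)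
      (mul_mem_wordSpan hcm (wordHom_eval_perm _) ?_)
    · rintro u ⟨hu, d, hd, hh⟩ v hv
      have hv : v.toList = [c] := hv
      refine ⟨?_, d, List.mem_append_left _ hd, ?_⟩
      · rw [FreeMonoid.toList_mul, hv]
        exact List.Perm.append hu (List.Perm.refl [c])
      · rw [FreeMonoid.toList_mul, List.head?_append, hh]
        rfl
    · intro u hu v hv
      have hu : u.toList = [c] := hu
      have hv : v.toList.Perm (dyn (a, l)).content := hv
      rw [content_dyn] at hv
      refine ⟨?_, c, by simp, ?_⟩
      · rw [FreeMonoid.toList_mul, hu]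
        exact (List.Perm.append (List.Perm.refl [c]) hv).trans List.perm_append_comm
      · rw [FreeMonoid.toList_mul, hu]
        rfl

theorem coeffAt_dyn {b : (ZMod T × Fin m) × List (ZMod T × Fin m)} {w : List (ZMod T × Fin m)}
    (h : coeffAt w (wordHom T m (dyn b).eval) ≠ 0) :
    w = blockWord b ∨ (w.Perm (blockWord b) ∧ ∃ c ∈ b.2, w.head? = some c) := by
  classical
  by_cases hw : w = blockWord b
  · exact Or.inl hw
  · refine Or.inr (wordHom_dyn_sub b (FreeMonoid.ofList w) fun h' => h ?_)
    have h' : coeffAt w (wordHom T m (dyn b).eval - wordElt (blockWord b)) = 0 := h'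
    rwa [map_sub, coeffAt_wordElt, if_neg (Ne.symm hw), sub_zero] at h'

theorem coeffAt_dyn_self {b : (ZMod T × Fin m) × List (ZMod T × Fin m)} (hb : IsBlock b) :
    coeffAt (blockWord b) (wordHom T m (dyn b).eval) = 1 := by
  classical
  have h : coeffAt (blockWord b) (wordHom T m (dyn b).eval - wordElt (blockWord b)) = 0 := by
    by_contra h
    obtain ⟨-, c, hc, hh⟩ := wordHom_dyn_sub b (FreeMonoid.ofList (blockWord b)) h
    have hh : some b.1 = some c := hh
    have := hb c hc
    rw [← Option.some.inj hh] at this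
    exact lt_irrefl _ this
  rwa [map_sub, coeffAt_wordElt, if_pos rfl, sub_eq_zero] at h

variable [NeZero T]

theorem wordHom_bar_dyn (b : (ZMod T × Fin m) × List (ZMod T × Fin m)) :
    wordHom T m (bar T m (dyn b).eval : FreeLie T m) = ∑ k : ZMod T,
      wordHom T m (dyn (letterShift k b.1, b.2.map (letterShift k))).eval := by
  rw [coe_bar, map_sum]
  simp only [← Comm.eval_shift, shift_dyn]

/-- In each translate the leading word is the translated block, and any other word starts with a
letter other than the head of the block, whose index is larger. -/
theorem coeffAt_bar_dyn {b : (ZMod T × Fin m) × List (ZMod T × Fin m)} (hb : IsBlock b)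
    {w : List (ZMod T × Fin m)}
    (h : coeffAt w (wordHom T m (bar T m (dyn b).eval : FreeLie T m)) ≠ 0) :
    (w.map Prod.snd).Perm ((blockWord b).map Prod.snd) ∧
    ((∃ k, w = (blockWord b).map (letterShift k)) ∨ ∃ c, w.head? = some c ∧ b.1.2 < c.2) := by
  rw [wordHom_bar_dyn, map_sum] at h
  obtain ⟨k, -, h⟩ := Finset.exists_ne_zero_of_sum_ne_zero h
  have e : blockWord (letterShift k b.1, b.2.map (letterShift k)) =
    (blockWord b).map (letterShift k) := rfl
  have e2 : ((blockWord b).map (letterShift k)).map Prod.snd = (blockWord b).map Prod.snd := by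
    rw [List.map_map]
    rfl
  rcases coeffAt_dyn h with rfl | ⟨hp, c, hc, hh⟩
  · rw [e]
    exact ⟨by rw [e2], Or.inl ⟨k, rfl⟩⟩
  · rw [e] at hp
    refine ⟨e2 ▸ hp.map Prod.snd, Or.inr ⟨c, hh, ?_⟩⟩
    obtain ⟨d, hd, rfl⟩ := List.mem_map.1 hc
    exact hb d hd

theorem coeffAt_bar_dyn_self {b : (ZMod T × Fin m) × List (ZMod T × Fin m)} (hb : IsBlock b) :
    coeffAt (blockWord b) (wordHom T m (bar T m (dyn b).eval : FreeLie T m)) = 1 := by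
  rw [wordHom_bar_dyn, map_sum, Finset.sum_eq_single 0]
  · have : (letterShift (T := T) 0 : ZMod T × Fin m → ZMod T × Fin m) = id := by
      funext a
      simp [letterShift]
    rw [this, List.map_id]
    exact coeffAt_dyn_self hb
  · intro k _ hk
    by_contra h
    rcases coeffAt_dyn h with e | ⟨-, c, hc, hh⟩
    · have := congrArg Prod.fst (List.cons.inj e).1
      exact hk (by simpa [letterShift] using this)
    · obtain ⟨d, hd, rfl⟩ := List.mem_map.1 hc
      have hh : some b.1 = some (letterShift k d) := hh
      have h1 := hb d hd
      rw [Option.some.inj hh] at h1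
      exact lt_irrefl _ h1
  · exact fun h => absurd (Finset.mem_univ _) h

/-- The words in a product of left-normed commutators are at least as large as the word formed by
the blocks. -/
theorem eq_or_lt_of_coeffAt_prod {w w' : List (ZMod T × Fin m)} (hw : IsNormal w)
    (hw' : IsNormal w') (h : coeffAt w' ((blocks w).map fun b =>
      wordHom T m (bar T m (dyn b).eval : FreeLie T m)).prod ≠ 0) :
    w = w' ∨ w.map Prod.snd < w'.map Prod.snd := by
  -- Again `p` is the part common to both words that has already been compared; normality concerns
  -- the complete words.
  have key : ∀ w p w' : List (ZMod T × Fin m), (∀ a l, w = a :: l → ∀ b ∈ p, a.2 ≤ b.2) →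
      IsNormal (p ++ w) → IsNormal (p ++ w') → coeffAt w' ((blocks w).map fun b =>
        wordHom T m (bar T m (dyn b).eval : FreeLie T m)).prod ≠ 0 →
      w = w' ∨ w.map Prod.snd < w'.map Prod.snd := by
    intro w
    induction w using word_induction with
    | nil =>
      intro p w' _ _ _ h
      classical
      left
      by_contra hne
      refine h ?_
      rw [blocks, List.map_nil, List.prod_nil]
      have : (1 : WordAlg T m) = wordElt [] := (map_one (MonoidAlgebra.of ℂ _)).symm
      rw [this, coeffAt_wordElt, if_neg hne]
    | cons a l ih =>
      intro p w' hp hn hn' h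
      have hblock := isBlock_of_mem_blocks (w := a :: l)
      rw [blocks_cons] at h hblock
      rw [List.map_cons, List.prod_cons] at h
      obtain ⟨u, v, rfl, hu, hv⟩ := coeffAt_mul_ne_zero h
      rcases (coeffAt_bar_dyn (hblock _ List.mem_cons_self) hu).2 with ⟨k, rfl⟩ | ⟨c, hc, hlt⟩
      · have hp1 := hp a l rfl
        -- The head of the block and its translate are left-to-right minima of two normal words, so
        -- both have label `0` and the translation is trivial.
        have ha : a.1 = 0 := hn p a l rfl hp1
        have hk : a.1 + k = 0 := hn' p (letterShift k a) _ rfl hp1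
        rw [ha, zero_add] at hk
        have hid : (letterShift k : ZMod T × Fin m → ZMod T × Fin m) = id := by
          funext b
          simp [letterShift, hk]
        rw [hid, List.map_id] at hn' ⊢
        rw [blockWord] at hn' ⊢
        dsimp only at hn' ⊢
        have hsplit : a :: l = (a :: l.takeWhile fun c => a.2 < c.2) ++
            l.dropWhile fun c => a.2 < c.2 := by
          rw [List.cons_append, List.takeWhile_append_dropWhile]
        have hih := ih (p ++ a :: l.takeWhile fun c => a.2 < c.2) v
          (fun c l' e => IsNormal.append_rest hp1 e)
          (by rwa [List.append_assoc, ← hsplit]) (by rwa [List.append_assoc]) hv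
        rw [hsplit]
        rcases hih with rfl | hlt
        · exact Or.inl rfl
        · right
          rw [List.map_append, List.map_append]
          exact List.append_left_lt hlt
      -- A word that is not a leading one starts with a larger index, so the comparison ends at this
      -- letter.
      · right
        obtain ⟨u', rfl⟩ : ∃ u', u = c :: u' := by
          cases u with
          | nil => simp at hc
          | cons d u' =>
            rw [List.head?_cons, Option.some.injEq] at hc
            exact ⟨u', by rw [hc]⟩
        rw [List.cons_append, List.map_cons, List.map_cons, List.cons_lt_cons_iff]
        exact Or.inl hlt
  exact key w [] w' (fun a l _ b hb => absurd hb List.not_mem_nil) hw hw' h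

/-- The factors are homogeneous, so the coefficient of the concatenated blocks is the product of the
coefficients of the single blocks. -/
theorem coeffAt_prod_self (w : List (ZMod T × Fin m)) :
    coeffAt w ((blocks w).map fun b =>
      wordHom T m (bar T m (dyn b).eval : FreeLie T m)).prod = 1 := by
  have key : ∀ L : List ((ZMod T × Fin m) × List (ZMod T × Fin m)), (∀ b ∈ L, IsBlock b) →
      coeffAt (L.flatMap blockWord) (L.map fun b =>
        wordHom T m (bar T m (dyn b).eval : FreeLie T m)).prod = 1 := by
    intro L
    induction L with
    | nil =>
      intro _
      classical
      have : (1 : WordAlg T m) = wordElt [] := (map_one (MonoidAlgebra.of ℂ _)).symm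
      rw [List.map_nil, List.prod_nil, List.flatMap_nil, this, coeffAt_wordElt, if_pos rfl]
    | cons b L ih =>
      intro h
      rw [List.map_cons, List.prod_cons, List.flatMap_cons, coeffAt_append_mul,
        coeffAt_bar_dyn_self (h b List.mem_cons_self),
        ih fun b hb => h b (List.mem_cons_of_mem _ hb), one_mul]
      intro u hu
      simpa using (coeffAt_bar_dyn (h b List.mem_cons_self) hu).1.length_eq
  have := key (blocks w) isBlock_of_mem_blocks
  rwa [flatMap_blocks] at this

end

section

attribute [local instance] LieRing.ofAssociativeRing

variable {T m N : ℕ}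

/-! ### Configurations of words -/

/-- A word at each of the swimming islands (`none`), the origin (`some none`) and the points. -/
abbrev Config (T m N : ℕ) : Type := Option (Option (Fin N)) → List (ZMod T × Fin m)

/-- The words contain each of the first `n` indices once, and those at the swimming islands and at
the origin are normal. -/
structure IsConfig (n : ℕ) (W : Config T m N) : Prop where
  count : ∀ i : Fin m, ∑ s, ((W s).map Prod.snd).count i = if (i : ℕ) < n then 1 else 0
  swim : IsNormal (W none)
  zero : IsNormal (W (some none))

/-- The ways to insert a letter with index `n` into a configuration: in front of one of its words,
or after a letter. -/
abbrev Choice (T N n : ℕ) : Type := (Bool ⊕ (Fin N × ZMod T)) ⊕ (Fin n × ZMod T)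

/-- Insertion of a letter after the first letter with index `i`. -/
def insertAfter (i : Fin m) (x : ZMod T × Fin m) : List (ZMod T × Fin m) → List (ZMod T × Fin m)
  | [] => []
  | a :: l => if a.2 = i then a :: x :: l else a :: insertAfter i x l

/-- The word and the label for an insertion in front of a word. -/
def frontSlot : Bool ⊕ (Fin N × ZMod T) → Option (Option (Fin N)) × ZMod T
  | .inl false => (none, 0)
  | .inl true => (some none, 0)
  | .inr (j, k) => (some (some j), k)

/-- Insertion of a letter into a configuration. -/
def Config.insert (W : Config T m N) (n : Fin m) : Choice T N n → Config T m N
  | .inl c => Function.update W (frontSlot c).1 (((frontSlot c).2, n) :: W (frontSlot c).1)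
  | .inr (i, k) => fun s => insertAfter (i.castLE n.2.le) (k, n) (W s)

theorem frontSlot_injective : Function.Injective (frontSlot : Bool ⊕ (Fin N × ZMod T) → _) := by
  rintro ((_ | _) | ⟨j, k⟩) ((_ | _) | ⟨j', k'⟩) h <;> simp_all [frontSlot]

theorem count_insertAfter {i : Fin m} {x : ZMod T × Fin m} {l : List (ZMod T × Fin m)}
    (h : (l.map Prod.snd).count i ≤ 1) (j : Fin m) :
    ((insertAfter i x l).map Prod.snd).count j =
      (l.map Prod.snd).count j + if x.2 = j then (l.map Prod.snd).count i else 0 := by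
  induction l with
  | nil => simp [insertAfter]
  | cons a l ih =>
    rw [insertAfter]
    rw [List.map_cons, List.count_cons] at h
    by_cases ha : a.2 = i
    · have h0 : (l.map Prod.snd).count i = 0 := by simp [ha] at h; omega
      rw [if_pos ha]
      simp only [List.map_cons, List.count_cons, h0, ha, beq_self_eq_true, if_true, beq_iff_eq]
      split_ifs <;> omega
    · rw [if_neg ha]
      simp only [List.map_cons, List.count_cons, ih (by omega), beq_iff_eq, if_neg ha]
      split_ifs <;> omega

theorem filter_insertAfter {i n : Fin m} {k : ZMod T} (l : List (ZMod T × Fin m)) :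
    (insertAfter i (k, n) l).filter (fun a => a.2 ≠ n) = l.filter fun a => a.2 ≠ n := by
  induction l with
  | nil => rfl
  | cons a l ih =>
    rw [insertAfter]
    split_ifs
    · by_cases h : a.2 = n <;> simp [h]
    · by_cases h : a.2 = n <;> simp [h] <;> simpa using ih

theorem head?_insertAfter (i : Fin m) (x : ZMod T × Fin m) (l : List (ZMod T × Fin m)) :
    (insertAfter i x l).head? = l.head? := by
  cases l with
  | nil => rfl
  | cons a l =>
    rw [insertAfter]
    split_ifs <;> rfl

theorem insertAfter_injective {n i j : Fin m} {k k' : ZMod T} {l : List (ZMod T × Fin m)}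
    (hl : ∀ a ∈ l, a.2 ≠ n) (hi : i ∈ l.map Prod.snd)
    (h : insertAfter i (k, n) l = insertAfter j (k', n) l) : i = j ∧ k = k' := by
  have hne : ∀ (i : Fin m) (k k' : ZMod T) (l : List (ZMod T × Fin m)), (∀ a ∈ l, a.2 ≠ n) →
      (k, n) :: l ≠ insertAfter i (k', n) l := by
    intro i k k' l hl e
    have := head?_insertAfter i (k', n) l
    rw [← e, List.head?_cons] at this
    exact hl (k, n) (List.mem_of_mem_head? this.symm) rfl
  induction l with
  | nil => simp at hi
  | cons a l ih =>
    have hl' : ∀ a ∈ l, a.2 ≠ n := fun a ha => hl a (List.mem_cons_of_mem _ ha)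
    rw [insertAfter, insertAfter] at h
    split_ifs at h with h1 h2 h2
    · simp only [List.cons.injEq, true_and, Prod.mk.injEq, and_true] at h
      exact ⟨h1.symm.trans h2, h⟩
    · exact absurd (List.cons.inj h).2 (hne _ _ _ _ hl')
    · exact absurd (List.cons.inj h).2.symm (hne _ _ _ _ hl')
    · rw [List.map_cons, List.mem_cons] at hi
      exact ih hl' (hi.resolve_left (Ne.symm h1)) (List.cons.inj h).2

theorem IsConfig.lt {n : ℕ} {W : Config T m N} (hW : IsConfig n W) {s : Option (Option (Fin N))}
    {a : ZMod T × Fin m} (ha : a ∈ W s) : (a.2 : ℕ) < n := by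
  by_contra h
  have h1 := hW.count a.2
  rw [if_neg h, Finset.sum_eq_zero_iff] at h1
  have := h1 s (Finset.mem_univ s)
  rw [List.count_eq_zero] at this
  exact this (List.mem_map_of_mem ha)

theorem IsConfig.count_le {n : ℕ} {W : Config T m N} (hW : IsConfig n W)
    (s : Option (Option (Fin N))) (i : Fin m) : ((W s).map Prod.snd).count i ≤ 1 := by
  have h1 := Finset.single_le_sum (f := fun s => ((W s).map Prod.snd).count i)
    (fun _ _ => Nat.zero_le _) (Finset.mem_univ s)
  refine h1.trans ?_
  rw [hW.count]
  split_ifs <;> omega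

/-- A letter with the largest index is a left-to-right minimum only in front, and deleting it does
not affect the minimality of other letters. -/
theorem IsNormal.of_filter {n : Fin m} {w w' : List (ZMod T × Fin m)} (hw : IsNormal w)
    (hf : w'.filter (fun a => a.2 ≠ n) = w) (hle : ∀ a ∈ w', a.2 ≤ n)
    (hc : (w'.map Prod.snd).count n ≤ 1) (hh : ∀ a l, w' = a :: l → a.2 = n → a.1 = 0) :
    IsNormal w' := by
  intro u a v e hu
  by_cases ha : a.2 = n
  · cases u with
    | nil => exact hh a v e ha
    | cons b u =>
      have hb : b.2 = n := le_antisymm (hle b (by simp [e])) (ha ▸ hu b List.mem_cons_self)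
      simp [e, ha, hb] at hc
  · refine hw (u.filter fun a => a.2 ≠ n) a (v.filter fun a => a.2 ≠ n) ?_
      fun b hb => hu b (List.mem_of_mem_filter hb)
    rw [← hf, e, List.filter_append, List.filter_cons_of_pos (by simpa using ha)]

theorem IsConfig.insert_eq_filter {n : Fin m} {W : Config T m N} (hW : IsConfig n W)
    (c : Choice T N n) (s : Option (Option (Fin N))) :
    ((W.insert n c) s).filter (fun a => a.2 ≠ n) = W s := by
  have h0 : (W s).filter (fun a => a.2 ≠ n) = W s := by
    rw [List.filter_eq_self]
    intro a ha
    have := hW.lt ha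
    simpa [Fin.ext_iff] using this.ne
  rcases c with c | ⟨i, k⟩
  · simp only [Config.insert]
    by_cases hs : s = (frontSlot c).1
    · subst hs
      rw [Function.update_self, List.filter_cons_of_neg (by simp), h0]
    · rw [Function.update_of_ne hs, h0]
  · simp only [Config.insert]
    rw [filter_insertAfter, h0]

theorem IsConfig.count_insert {n : Fin m} {W : Config T m N} (hW : IsConfig n W)
    (c : Choice T N n) (i : Fin m) : ∑ s, (((W.insert n c) s).map Prod.snd).count i =
      if (i : ℕ) < n + 1 then 1 else 0 := by
  have key : ∑ s, (((W.insert n c) s).map Prod.snd).count i =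
      (if (i : ℕ) < n then 1 else 0) + if n = i then 1 else 0 := by
    rw [← hW.count i]
    rcases c with c | ⟨j, k⟩
    · simp only [Config.insert]
      rw [← Finset.add_sum_erase _ _ (Finset.mem_univ (frontSlot c).1),
        ← Finset.add_sum_erase _ (fun s => ((W s).map Prod.snd).count i)
          (Finset.mem_univ (frontSlot c).1), Function.update_self, List.map_cons, List.count_cons]
      rw [Finset.sum_congr rfl fun s hs => by rw [Function.update_of_ne (Finset.ne_of_mem_erase hs)]]
      simp only [beq_iff_eq]
      ring
    · simp only [Config.insert, count_insertAfter (hW.count_le _ _), Finset.sum_add_distrib]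
      congr 1
      split_ifs with h
      · rw [hW.count]
        simp
      · exact Finset.sum_const_zero
  rw [key]
  simp only [Fin.ext_iff]
  split_ifs <;> omega

theorem IsConfig.insert {n : Fin m} {W : Config T m N} (hW : IsConfig n W) (c : Choice T N n) :
    IsConfig (n + 1) (W.insert n c) := by
  have hle : ∀ s, ∀ a ∈ (W.insert n c) s, a.2 ≤ n := by
    intro s a ha
    have h := hW.count_insert c a.2
    by_contra hlt
    rw [if_neg (by rw [Fin.le_def] at hlt; omega), Finset.sum_eq_zero_iff] at h
    have := h s (Finset.mem_univ s)
    rw [List.count_eq_zero] at this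
    exact this (List.mem_map_of_mem ha)
  have hhead : ∀ s, (s = none ∨ s = some none) → ∀ a l, (W.insert n c) s = a :: l → a.2 = n →
      a.1 = 0 := by
    intro s hs a l e ha
    have hWs : ∀ b ∈ W s, b.2 ≠ n := fun b hb => by
      have := hW.lt hb
      rw [Ne, Fin.ext_iff]
      exact this.ne
    rcases c with c | ⟨i, k⟩
    · simp only [Config.insert] at e
      by_cases h : s = (frontSlot c).1
      · subst h
        rw [Function.update_self, List.cons.injEq] at e
        rw [← e.1]
        rcases c with (_ | _) | ⟨j, k⟩
        · rfl
        · rfl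
        · simp [frontSlot] at hs
      · rw [Function.update_of_ne h] at e
        exact absurd ha (hWs a (by simp [e]))
    · simp only [Config.insert] at e
      have := head?_insertAfter (i.castLE n.2.le) (k, n) (W s)
      rw [e, List.head?_cons] at this
      exact absurd ha (hWs a (List.mem_of_mem_head? this.symm))
  have hcount : ∀ s, (((W.insert n c) s).map Prod.snd).count n ≤ 1 := by
    intro s
    refine (Finset.single_le_sum (f := fun s => (((W.insert n c) s).map Prod.snd).count n)
      (fun _ _ => Nat.zero_le _) (Finset.mem_univ s)).trans ?_
    rw [hW.count_insert c, if_pos (Nat.lt_succ_self _)]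
  exact ⟨hW.count_insert c, hW.swim.of_filter (hW.insert_eq_filter c _) (hle _) (hcount _)
    (hhead _ (Or.inl rfl)), hW.zero.of_filter (hW.insert_eq_filter c _) (hle _) (hcount _)
    (hhead _ (Or.inr rfl))⟩

/-- Deleting the letter with index `n` recovers the old configuration. Its place and its label
recover the choice: in front, the first letter of a word has changed, and otherwise the place is
determined by the index of the preceding letter. -/
theorem IsConfig.insert_injective {n : Fin m} {W W' : Config T m N} (hW : IsConfig n W)
    (hW' : IsConfig n W') {c c' : Choice T N n} (h : W.insert n c = W'.insert n c') :
    W = W' ∧ c = c' := by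
  have hWW : W = W' := by
    funext s
    rw [← hW.insert_eq_filter c s, h, hW'.insert_eq_filter c' s]
  subst hWW
  refine ⟨rfl, ?_⟩
  have hWs : ∀ s, ∀ b ∈ W s, b.2 ≠ n := fun s b hb => by
    have := hW.lt hb
    rw [Ne, Fin.ext_iff]
    exact this.ne
  have hmix : ∀ c (i : Fin n) k, W.insert n (.inl c) ≠ W.insert n (.inr (i, k)) := by
    intro c i k e
    have h1 := congrFun e (frontSlot c).1
    simp only [Config.insert, Function.update_self] at h1
    have h2 := head?_insertAfter (i.castLE n.2.le) (k, n) (W (frontSlot c).1)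
    rw [← h1, List.head?_cons] at h2
    exact hWs _ _ (List.mem_of_mem_head? h2.symm) rfl
  rcases c with c | ⟨i, k⟩ <;> rcases c' with c' | ⟨i', k'⟩
  · have h1 := congrFun h (frontSlot c).1
    simp only [Config.insert, Function.update_self] at h1
    by_cases hs : (frontSlot c).1 = (frontSlot c').1
    · rw [← hs, Function.update_self, List.cons.injEq, Prod.mk.injEq] at h1
      rw [frontSlot_injective (Prod.ext hs h1.1.1)]
    · rw [Function.update_of_ne hs] at h1
      have := congrArg List.length h1
      simp at this
  · exact absurd h (hmix _ _ _)
  · exact absurd h.symm (hmix _ _ _)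
  · have hex : ∃ s, i.castLE n.2.le ∈ (W s).map Prod.snd := by
      by_contra! hno
      have h1 := hW.count (i.castLE n.2.le)
      rw [Finset.sum_eq_zero fun s _ => List.count_eq_zero.2 (hno s)] at h1
      simp at h1
    obtain ⟨s, hs⟩ := hex
    obtain ⟨h1, h2⟩ := insertAfter_injective (hWs s) hs (congrFun h s)
    rw [h2, Fin.castLE_injective _ h1]

/-- The indices are inserted in increasing order. The letter with index `n` can go in front of the
word of the swimming islands or of the origin with label `0`, in front of the word at a point with
any label, or after any of the `n` letters present with any label. This gives `2 + N T + n T`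
choices, the factor that occurs in the bound for the flag spaces. -/
theorem exists_configs [NeZero T] : ∀ n ≤ m, ∃ S : Finset (Config T m N),
    (∀ W ∈ S, IsConfig n W) ∧ S.card = ∏ i ∈ Finset.range n, (2 + N * T + i * T) := by
  classical
  intro n
  induction n with
  | zero =>
    intro _
    refine ⟨{fun _ => []}, fun W hW => ?_, by simp⟩
    rw [Finset.mem_singleton] at hW
    subst hW
    have hnil : IsNormal ([] : List (ZMod T × Fin m)) := fun u a v e => by simp at e
    exact ⟨fun i => by simp, hnil, hnil⟩
  | succ n ih =>
    intro hn
    obtain ⟨S, hS, hcard⟩ := ih (by omega)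
    let n' : Fin m := ⟨n, hn⟩
    refine ⟨(S ×ˢ (Finset.univ : Finset (Choice T N n'))).image
      fun x => Config.insert x.1 n' x.2, ?_, ?_⟩
    · intro W hW
      obtain ⟨x, hx, rfl⟩ := Finset.mem_image.1 hW
      exact IsConfig.insert (n := n') (hS x.1 (Finset.mem_product.1 hx).1) x.2
    · rw [Finset.card_image_of_injOn, Finset.card_product, hcard, Finset.prod_range_succ,
        Finset.card_univ]
      · congr 1
        simp [Choice, n', ZMod.card]
      · intro x hx y hy e
        obtain ⟨h1, h2⟩ := IsConfig.insert_injective (n := n') (hS x.1 (Finset.mem_product.1 hx).1)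
          (hS y.1 (Finset.mem_product.1 hy).1) e
        exact Prod.ext h1 h2

end

section

attribute [local instance] LieRing.ofAssociativeRing

variable {T m N : ℕ}

/-! ### Linear independence of the monomials given by configurations -/

/-- In a linear relation, the form belonging to a vector with the smallest key among those with
nonzero coefficient vanishes on all the others. -/
theorem linearIndependent_of_triangular {ι V κ : Type*} [AddCommGroup V] [Module ℂ V]
    [LinearOrder κ] (v : ι → V) (f : ι → V →ₗ[ℂ] ℂ) (key : ι → κ) (hself : ∀ i, f i (v i) ≠ 0)
    (hne : ∀ i j, f j (v i) ≠ 0 → i = j ∨ key i < key j) : LinearIndependent ℂ v := by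
  classical
  rw [linearIndependent_iff']
  intro s c hc i hi
  by_contra hci
  obtain ⟨j, hj, hmin⟩ := (s.filter fun i => c i ≠ 0).exists_min_image key
    ⟨i, Finset.mem_filter.2 ⟨hi, hci⟩⟩
  obtain ⟨hjs, hcj⟩ := Finset.mem_filter.1 hj
  have h := congrArg (f j) hc
  rw [map_sum, map_zero, Finset.sum_eq_single j] at h
  · rw [map_smul, smul_eq_zero] at h
    exact h.elim hcj (hself j)
  · intro k hk hkj
    rw [map_smul, smul_eq_zero]
    by_contra! hcon
    exact (hne k j hcon.2).elim hkj
      (not_lt.2 (hmin k (Finset.mem_filter.2 ⟨hk, hcon.1⟩)))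
  · exact fun h => absurd hjs h

section Blocks

variable {p : ℕ}

/-- The blocks of a word with `p` blocks. -/
def blockAt {w : List (ZMod T × Fin m)} (h : (blocks w).length = p) (a : Fin p) :
    (ZMod T × Fin m) × List (ZMod T × Fin m) :=
  (blocks w).get (a.cast h.symm)

theorem ofFn_blockAt {w : List (ZMod T × Fin m)} (h : (blocks w).length = p) :
    List.ofFn (blockAt h) = blocks w := by
  subst h
  exact List.ofFn_get _

theorem blockAt_mem {w : List (ZMod T × Fin m)} (h : (blocks w).length = p) (a : Fin p) :
    blockAt h a ∈ blocks w := List.get_mem _ _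

theorem blockAt_head_injective {w : List (ZMod T × Fin m)} (hn : (w.map Prod.snd).Nodup)
    (h : (blocks w).length = p) {a b : Fin p} (e : (blockAt h a).1.2 = (blockAt h b).1.2) :
    a = b := by
  have := pairwise_blocks_of_nodup hn
  rw [← ofFn_blockAt h, List.pairwise_ofFn] at this
  rcases lt_trichotomy a b with hab | hab | hab
  · exact absurd e (this hab).ne'
  · exact hab
  · exact absurd e (this hab).ne

variable [NeZero T]

/-- A translate of `b` whose head also has label `0` is `b` itself. In the other case `b'` would
start with an index larger than that of the head of `b`; but `b'` contains that index too, and its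
head has the smallest one. -/
theorem eq_of_coeffAt_bar_dyn {b b' : (ZMod T × Fin m) × List (ZMod T × Fin m)} (hb : IsBlock b)
    (hb' : IsBlock b') (h0 : b.1.1 = 0) (h0' : b'.1.1 = 0)
    (h : coeffAt (blockWord b') (wordHom T m (bar T m (dyn b).eval : FreeLie T m)) ≠ 0) :
    b' = b := by
  obtain ⟨hp, ⟨k, hk⟩ | ⟨c, hc, hlt⟩⟩ := coeffAt_bar_dyn hb h
  · have h1 : b'.1 = letterShift k b.1 := (List.cons.inj hk).1
    have hk0 : k = 0 := by
      have := congrArg Prod.fst h1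
      simpa [letterShift, h0, h0'] using this.symm
    have hid : (letterShift k : ZMod T × Fin m → ZMod T × Fin m) = id := by
      funext b
      simp [letterShift, hk0]
    rw [hid, List.map_id] at hk
    exact Prod.ext (List.cons.inj hk).1 (List.cons.inj hk).2
  · have hc' : b'.1 = c := Option.some.inj hc
    have hm : b.1.2 ∈ (blockWord b').map Prod.snd := hp.mem_iff.2 (by simp [blockWord])
    obtain ⟨d, hd, hd2⟩ := List.mem_map.1 hm
    rw [← hc', ← hd2] at hlt
    rcases List.mem_cons.1 hd with rfl | hd
    · exact absurd hlt (lt_irrefl _)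
    · exact absurd hlt (hb' d hd).not_gt

/-- The determinant of the coefficients of the words of `p` blocks. -/
def blockForm (b : Fin p → (ZMod T × Fin m) × List (ZMod T × Fin m)) :
    (⋀[ℂ]^p (nbar T m)) →ₗ[ℂ] ℂ :=
  exteriorPower.alternatingMapLinearEquiv
    (Matrix.detRowAlternating.compLinearMap (LinearMap.pi fun i => coeffAt (blockWord (b i)) ∘ₗ
      (wordHom T m).toLinearMap ∘ₗ (nbar T m).toSubmodule.subtype))

theorem blockForm_apply (b : Fin p → (ZMod T × Fin m) × List (ZMod T × Fin m))
    (g : Fin p → Comm T m) :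
    blockForm b (exteriorPower.ιMulti ℂ p fun a => bar T m (g a).eval) =
      Matrix.det (Matrix.of fun a i => coeffAt (blockWord (b i))
        (wordHom T m (bar T m (g a).eval : FreeLie T m))) := by
  rw [blockForm, exteriorPower.alternatingMapLinearEquiv_apply_ιMulti]
  rfl

theorem blockForm_self {w : List (ZMod T × Fin m)} (hw : IsNormal w)
    (hn : (w.map Prod.snd).Nodup) (h : (blocks w).length = p) :
    blockForm (blockAt h) (exteriorPower.ιMulti ℂ p fun a => bar T m (dyn (blockAt h a)).eval) =
      1 := by
  rw [blockForm_apply, ← Matrix.det_one (n := Fin p)]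
  congr 1
  ext a i
  rw [Matrix.of_apply, Matrix.one_apply]
  split_ifs with hai
  · rw [hai]
    exact coeffAt_bar_dyn_self (isBlock_of_mem_blocks _ (blockAt_mem h i))
  · by_contra hne
    have := eq_of_coeffAt_bar_dyn (isBlock_of_mem_blocks _ (blockAt_mem h a))
      (isBlock_of_mem_blocks _ (blockAt_mem h i)) (hw.label_head _ (blockAt_mem h a))
      (hw.label_head _ (blockAt_mem h i)) hne
    exact hai (blockAt_head_injective hn h (by rw [this]))

/-- A nonzero term in the expansion of the determinant matches the blocks of the two words by a
permutation. The heads decrease strictly along each word, so the order of the blocks is determined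
and the words agree. -/
theorem eq_of_blockForm_ne_zero {w w' : List (ZMod T × Fin m)} (hw : IsNormal w)
    (hw' : IsNormal w') (hn : (w.map Prod.snd).Nodup) (hn' : (w'.map Prod.snd).Nodup)
    (h : (blocks w).length = p) (h' : (blocks w').length = p)
    (hne : blockForm (blockAt h')
      (exteriorPower.ιMulti ℂ p fun a => bar T m (dyn (blockAt h a)).eval) ≠ 0) : w = w' := by
  rw [blockForm_apply, Matrix.det_apply] at hne
  obtain ⟨σ, -, hσ⟩ := Finset.exists_ne_zero_of_sum_ne_zero hne
  have hσ' : ∀ i, blockAt h' i = blockAt h (σ i) := by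
    intro i
    refine eq_of_coeffAt_bar_dyn (isBlock_of_mem_blocks _ (blockAt_mem h _))
      (isBlock_of_mem_blocks _ (blockAt_mem h' i)) (hw.label_head _ (blockAt_mem h _))
      (hw'.label_head _ (blockAt_mem h' i)) fun h0 => hσ ?_
    rw [Finset.prod_eq_zero (Finset.mem_univ i), smul_zero]
    exact h0
  have hperm : (blocks w').Perm (blocks w) := by
    rw [← ofFn_blockAt h', ← ofFn_blockAt h, funext hσ']
    exact Equiv.Perm.ofFn_comp_perm σ (blockAt h)
  have := hperm.eq_of_pairwise (fun a b _ _ h1 h2 => absurd h1 h2.not_gt)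
    (pairwise_blocks_of_nodup hn') (pairwise_blocks_of_nodup hn)
  rw [← flatMap_blocks w, ← flatMap_blocks w', this]

end Blocks

variable {p : ℕ}

/-- The monomial of a configuration: a left-normed commutator for every block at the swimming
islands and at the origin, and a product of generators at each point. -/
def configMono (W : Config T m N) (h : (blocks (W none)).length = p) : Mono T m N p where
  wedge a := dyn (blockAt h a)
  zero := (blocks (W (some none))).map dyn
  point j := (W (some (some j))).map fun a => Comm.gen a.1 a.2

theorem IsConfig.weight_configMono {W : Config T m N} (hW : IsConfig m W)
    (h : (blocks (W none)).length = p) : (configMono W h).weight = 1 := by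
  funext i
  have h1 := hW.count i
  rw [if_pos i.2, Fintype.sum_option, Fintype.sum_option] at h1
  rw [Mono.weight_eq_sum, Fintype.sum_sum_type, Fintype.sum_option, Pi.one_apply, ← h1]
  have hz : (configMono W h).letters (.inr none) = W (some none) := by
    rw [Mono.letters, configMono, List.flatMap_map]
    simp only [content_dyn]
    exact flatMap_blocks _
  have hp : ∀ j, (configMono W h).letters (.inr (some j)) = W (some (some j)) := by
    intro j
    rw [Mono.letters, configMono, List.flatMap_map]
    exact List.flatMap_singleton' _
  rw [hz]
  simp only [hp]
  congr 1
  simp only [Mono.letters, configMono, content_dyn]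
  conv_rhs => rw [← flatMap_blocks (W none), ← ofFn_blockAt h, List.map_flatMap,
    List.count_flatMap, List.map_ofFn, List.sum_ofFn]
  rfl

theorem IsConfig.nodup {n : ℕ} {W : Config T m N} (hW : IsConfig n W)
    (s : Option (Option (Fin N))) : ((W s).map Prod.snd).Nodup :=
  List.nodup_iff_count_le_one.2 (hW.count_le s)

variable [NeZero T]

/-- The form which takes the coefficients of the words of a configuration. -/
def configForm (W : Config T m N) (h : (blocks (W none)).length = p) :
    Chains (nbar T m) (ModM T m N) p →ₗ[ℂ] ℂ :=
  chainForm (blockForm (blockAt h)) (coeffAt (W (some none))) fun j => coeffAt (W (some (some j)))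

theorem configForm_configMono (W W' : Config T m N) (h : (blocks (W none)).length = p)
    (h' : (blocks (W' none)).length = p) :
    configForm W' h' (configMono W h).eval =
      blockForm (blockAt h')
        (exteriorPower.ιMulti ℂ p fun a => bar T m (dyn (blockAt h a)).eval) *
      (coeffAt (W' (some none)) ((blocks (W (some none))).map fun b =>
        wordHom T m (bar T m (dyn b).eval : FreeLie T m)).prod *
      ∏ j, coeffAt (W' (some (some j))) (wordElt (W (some (some j))))) := by
  rw [configForm, chainForm_eval]
  simp only [configMono, List.map_map, ← wordElt_prod]
  rfl

theorem IsConfig.configForm_self {n : ℕ} {W : Config T m N} (hW : IsConfig n W)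
    (h : (blocks (W none)).length = p) : configForm W h (configMono W h).eval = 1 := by
  classical
  rw [configForm_configMono, blockForm_self hW.swim (hW.nodup none), coeffAt_prod_self]
  simp [coeffAt_wordElt]

/-- The forms at the swimming islands and at the points separate words exactly. Only at the origin,
where a product of commutators has several words, is the matrix merely triangular; so the word at
the origin serves as key. -/
theorem IsConfig.eq_or_lt {n : ℕ} {W W' : Config T m N} (hW : IsConfig n W) (hW' : IsConfig n W')
    (h : (blocks (W none)).length = p) (h' : (blocks (W' none)).length = p)
    (hne : configForm W' h' (configMono W h).eval ≠ 0) :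
    W = W' ∨ (W (some none)).map Prod.snd < (W' (some none)).map Prod.snd := by
  classical
  rw [configForm_configMono] at hne
  have hs := eq_of_blockForm_ne_zero hW.swim hW'.swim (hW.nodup _) (hW'.nodup _) h h'
    (left_ne_zero_of_mul hne)
  rcases eq_or_lt_of_coeffAt_prod hW.zero hW'.zero
    (left_ne_zero_of_mul (right_ne_zero_of_mul hne)) with hz | hlt
  · left
    funext s
    rcases s with _ | _ | j
    · exact hs
    · exact hz
    · have := Finset.prod_ne_zero_iff.1 (right_ne_zero_of_mul (right_ne_zero_of_mul hne)) j
        (Finset.mem_univ j)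
      rw [coeffAt_wordElt] at this
      by_contra hj
      exact this (if_neg hj)
  · exact Or.inr hlt

theorem card_filter_le_finrank [∀ p, Module.Finite ℂ (multilinearPart T m N p)]
    {S : Finset (Config T m N)} (hS : ∀ W ∈ S, IsConfig m W) (p : ℕ) :
    (S.filter fun W => (blocks (W none)).length = p).card ≤
      Module.finrank ℂ (multilinearPart T m N p) := by
  let S' := S.filter fun W => (blocks (W none)).length = p
  have hS' : ∀ W : S', IsConfig m W.1 := fun W => hS W.1 (Finset.mem_filter.1 W.2).1
  have hl : ∀ W : S', (blocks (W.1 none)).length = p := fun W => (Finset.mem_filter.1 W.2).2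
  have key : LinearIndependent ℂ fun W : S' =>
      (configMono W.1 (hl W)).vec ((hS' W).weight_configMono (hl W)) := by
    refine linearIndependent_of_triangular _
      (fun W => configForm W.1 (hl W) ∘ₗ (multilinearPart T m N p).subtype)
      (fun W => (W.1 (some none)).map Prod.snd) (fun W => ?_) fun W W' h => ?_
    · exact ((hS' W).configForm_self (hl W)).trans_ne one_ne_zero
    · exact ((hS' W).eq_or_lt (hS' W') (hl W) (hl W') h).imp Subtype.ext id
  rw [← Fintype.card_coe]
  exact key.fintype_card_le_finrank

theorem prod_le_sum_finrank_multilinearPart [∀ p, Module.Finite ℂ (multilinearPart T m N p)] :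
    ∏ i ∈ Finset.range m, (2 + N * T + i * T) ≤
      ∑ p ∈ Finset.range (m + 1), Module.finrank ℂ (multilinearPart T m N p) := by
  obtain ⟨S, hS, hcard⟩ := exists_configs (T := T) (N := N) m le_rfl
  rw [← hcard, Finset.card_eq_sum_card_fiberwise (f := fun W => (blocks (W none)).length)
    (t := Finset.range (m + 1))]
  · exact Finset.sum_le_sum fun p _ => card_filter_le_finrank hS p
  · intro W hW
    exact Finset.mem_coe.2 (Finset.mem_range_succ_iff.2 ((configMono W rfl).le_of_weight
      ((hS W hW).weight_configMono rfl)))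

end

section

variable {T m N : ℕ} [NeZero T] {ω : ℂ} {z : Fin N → ℂ}

/-! ### The isomorphism of complexes -/

theorem multilinearD_multilinearD (p : ℕ) :
    multilinearD T m N p ∘ₗ multilinearD T m N (p + 1) = 0 := by
  refine LinearMap.ext fun u => Subtype.ext ?_
  exact LinearMap.congr_fun (ceD_ceD (L := nbar T m) (M := ModM T m N) p) u.1

theorem finite_multilinearPart (hω : IsPrimitiveRoot ω T) (hz : ∀ j, z j ≠ 0)
    (hzorb : ∀ i j, i ≠ j → ∀ k : ℕ, z i ≠ ω ^ k * z j) (p : ℕ) :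
    Module.Finite ℂ (multilinearPart T m N p) := by
  by_cases hp : p ≤ m
  · exact Module.Finite.of_surjective _
      (flagMap_surjective hω hz hzorb (Nat.add_sub_cancel' hp))
  · rw [multilinearPart_eq_bot (not_le.1 hp)]
    infer_instance

/-- The total dimension of the flag spaces is at most the product, and that of the multilinear parts
is at least the same product. Surjectivity gives the opposite inequality in every degree, so the
dimensions agree degree by degree. -/
theorem flagMap_injective (hω : IsPrimitiveRoot ω T) (hz : ∀ j, z j ≠ 0)
    (hzorb : ∀ i j, i ≠ j → ∀ k : ℕ, z i ≠ ω ^ k * z j) {k p : ℕ} (h : p + k = m) :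
    Function.Injective (flagMap hω z h) := by
  have := finite_multilinearPart (m := m) hω hz hzorb
  have hle : ∀ k ∈ Finset.range (m + 1), Module.finrank ℂ (multilinearPart T m N (m - k)) ≤
      Module.finrank ℂ (FlagSpace (cda T m ω z) k) := fun k hk =>
    LinearMap.finrank_le_finrank_of_surjective (flagMap_surjective hω hz hzorb
      (Nat.sub_add_cancel (Finset.mem_range_succ_iff.1 hk)))
  have hsum : ∑ k ∈ Finset.range (m + 1), Module.finrank ℂ (multilinearPart T m N (m - k)) =
      ∑ k ∈ Finset.range (m + 1), Module.finrank ℂ (FlagSpace (cda T m ω z) k) := by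
    refine le_antisymm (Finset.sum_le_sum hle) ((sum_finrank_flagSpace_le hω m).trans ?_)
    rw [Finset.sum_flip fun p => Module.finrank ℂ (multilinearPart T m N p)]
    exact prod_le_sum_finrank_multilinearPart
  have heq := (Finset.sum_eq_sum_iff_of_le hle).1 hsum k (Finset.mem_range_succ_iff.2 (by omega))
  obtain rfl : p = m - k := by omega
  exact (LinearMap.injective_iff_surjective_of_finrank_eq_finrank heq.symm).2
    (flagMap_surjective hω hz hzorb h)

/-- The identity is transported from chains through the injective chain map; when `k + 2 > m` the
target is zero. -/
theorem flagD_flagD (hω : IsPrimitiveRoot ω T) (hz : ∀ j, z j ≠ 0)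
    (hzorb : ∀ i j, i ≠ j → ∀ k : ℕ, z i ≠ ω ^ k * z j) (k : ℕ) :
    flagD (cda T m ω z) (k + 1) ∘ₗ flagD (cda T m ω z) k = 0 := by
  refine LinearMap.ext fun u => ?_
  by_cases hk : k + 2 ≤ m
  · obtain ⟨p, hp⟩ := Nat.exists_eq_add_of_le' hk
    refine flagMap_injective hω hz hzorb (p := p) hp.symm ?_
    rw [LinearMap.comp_apply, ← multilinearD_flagMap hω (h := by omega),
      ← multilinearD_flagMap hω (h := by omega), LinearMap.zero_apply, LinearMap.map_zero]
    exact LinearMap.congr_fun (multilinearD_multilinearD p) _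
  · have := subsingleton_flagSpace_of_lt (𝒜 := cda T m ω z) (not_le.1 hk)
    exact Subsingleton.elim _ _

/-- The isomorphisms from the flag spaces to the multilinear parts. -/
def flagEquiv (hω : IsPrimitiveRoot ω T) (hz : ∀ j, z j ≠ 0)
    (hzorb : ∀ i j, i ≠ j → ∀ k : ℕ, z i ≠ ω ^ k * z j) (p k : ℕ) (h : p + k = m) :
    FlagSpace (cda T m ω z) k ≃ₗ[ℂ] multilinearPart T m N p :=
  LinearEquiv.ofBijective (flagMap hω z h)
    ⟨flagMap_injective hω hz hzorb h, flagMap_surjective hω hz hzorb h⟩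

end

end

end CycloArr

theorem theorem1p1 (T : ℕ) [NeZero T] (m N : ℕ) (ω : ℂ) (hω : IsPrimitiveRoot ω T)
    (z : Fin N → ℂ) (hz : ∀ j, z j ≠ 0)
    (hzorb : ∀ i j, i ≠ j → ∀ k : ℕ, z i ≠ ω ^ k * z j) :
    (∀ p, CycloArr.multilinearD T m N p ∘ₗ CycloArr.multilinearD T m N (p + 1) = 0) ∧
    (∀ k, CycloArr.flagD (CycloArr.cda T m ω z) (k + 1) ∘ₗ
      CycloArr.flagD (CycloArr.cda T m ω z) k = 0) ∧
    (∀ p, m < p → CycloArr.multilinearPart T m N p = ⊥) ∧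
    ∃ ψ : ∀ p k : ℕ, p + k = m →
        (CycloArr.multilinearPart T m N p ≃ₗ[ℂ] CycloArr.FlagSpace (CycloArr.cda T m ω z) k),
      CycloArr.IsFlagMap ω z (fun p k h => (ψ p k h).toLinearMap) ∧
      (∀ φ : ∀ p k : ℕ, p + k = m →
          (CycloArr.multilinearPart T m N p →ₗ[ℂ] CycloArr.FlagSpace (CycloArr.cda T m ω z) k),
        CycloArr.IsFlagMap ω z φ → φ = fun p k h => (ψ p k h).toLinearMap) ∧
      ∀ (p k : ℕ) (h : (p + 1) + k = m) (h' : p + (k + 1) = m)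
        (u : CycloArr.multilinearPart T m N (p + 1)),
        CycloArr.flagD (CycloArr.cda T m ω z) k (ψ (p + 1) k h u) =
          ψ p (k + 1) h' (CycloArr.multilinearD T m N p u) := by
  have hψ := CycloArr.isFlagMap_symm hω hz hzorb
    (e := CycloArr.flagEquiv (m := m) hω hz hzorb) fun _ _ _ => rfl
  refine ⟨CycloArr.multilinearD_multilinearD, CycloArr.flagD_flagD hω hz hzorb,
    fun p hp => CycloArr.multilinearPart_eq_bot hp,
    fun p k h => (CycloArr.flagEquiv hω hz hzorb p k h).symm, hψ,
    fun φ hφ => hψ.unique hφ, fun p k h h' u => ?_⟩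
  -- The compatibility with the differentials is known for the inverse of `ψ`, so the chain is
  -- written as the image of an element of the flag space.
  obtain ⟨v, rfl⟩ := (CycloArr.flagEquiv hω hz hzorb (p + 1) k h).surjective u
  rw [LinearEquiv.symm_apply_apply, LinearEquiv.eq_symm_apply]
  exact (CycloArr.multilinearD_flagMap hω h h' v).symm
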